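/- **Proposition (nonlinear damping estimate on the forward-modulated perturbation).** Let $\alpha,\beta\in\mathbb R$ with $\beta\neq 0$, let $F>0$ and $T>0$, and let $\phi:\mathbb R\to\mathbb C$ be a smooth $T$-periodic stationary solution of the Lugiato–Lefever equation $$\psi_t=-\mathrm i\beta\psi_{xx}-(1+\mathrm i\alpha)\psi+\mathrm i|\psi|^2\psi+F. \tag{LLE}$$ For $N\in\mathbb N$, $N\ge 1$, write $L^2_N=L^2_{\rm per}(0,NT)$ and $H^m_N=H^m_{\rm per}(0,NT)$, with $\|f\|_{H^m_N}^2=\sum_{k=0}^m\int_0^{NT}|f^{(k)}(x)|^2\,dx$. Then there exist constants $R_1,C>0$, depending only on $\alpha,\beta,F,T,\phi$ (in particular not on $N$), such that the following holds for every integer $N\ge1$. Let $v_0\in H^2_N$, let $T_{\max}\in(0,\infty]$, let $\psi\in C([0,T_{\max}),H^2_N)\cap C^1([0,T_{\max}),L^2_N)$ be a classical solution of (LLE) with $\psi(0)=\phi+v_0$, let $\tau_{\max}\in(0,T_{\max}]$, and let $$(\sigma,\gamma)\in C\big([0,\tau_{\max}),\mathbb R\times H^4_N\big)\cap C^1\big([0,\tau_{\max}),\mathbb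 R\times H^2_N\big)$$ be real-valued with $(\sigma,\gamma)(0)=0$. Then the forward-modulated perturbation $$\mathring v(x,t)=\psi(x,t)-\phi\big(x+\gamma(x,t)+\tfrac1N\sigma(t)\big)$$ satisfies $$\|\mathring v(t)\|_{H^2_N}^2\le C e^{-t}\|v_0\|_{H^2_N}^2+C\|\mathring v(t)\|_{L^2_N}^2+C\int_0^t e^{-(t-s)}\Big(\|\mathring v(s)\|_{L^2_N}^2+\|\gamma_x(s)\|_{H^3_N}^2+\|\partial_s\gamma(s)\|_{H^2_N}^2+|\partial_s\sigma(s)|^2\Big)\,ds$$ for every $t\in[0,\tau_{\max})$ with $$\sup_{0\le s\le t}\Big(\|\mathring v(s)\|_{H^2_N}+\|\gamma_x(s)\|_{H^3_N}+\|\partial_s\gamma(s)\|_{H^2_N}+|\partial_s\sigma(s)|\Big)\le R_1 .$$ -/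

import Mathlib

open Set Filter Topology MeasureTheory
open scoped ContDiff

noncomputable section

namespace LLE

variable {E : Type*} [NormedAddCommGroup E] [NormedSpace ℝ E]

/-! ### `L`-periodic Lebesgue and Sobolev spaces

Elements of `L²_per(0, L)` and `H^m_per(0, L)` are represented by `L`-periodic functions on `ℝ`;
nothing below depends on the chosen representative modulo null sets. -/

/-- `f` represents an element of `L²_per(0, L)`. -/
def MemL2 (L : ℝ) (f : ℝ → E) : Prop :=
  Function.Periodic f L ∧ MemLp f 2 (volume.restrict (Ioc 0 L))

/-- `g` is the derivative of the `L`-periodic function `f` in the sense of (periodic)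
distributions. -/
def IsWeakDeriv (L : ℝ) (f g : ℝ → E) : Prop :=
  ∀ η : ℝ → ℝ, ContDiff ℝ ∞ η → Function.Periodic η L →
    ∫ x in (0 : ℝ)..L, deriv η x • f x = -∫ x in (0 : ℝ)..L, η x • g x

/-- `f` represents an element of `H^m_per(0, L)`: its weak derivatives up to order `m` exist and
lie in `L²_per(0, L)`. -/
def MemH (L : ℝ) : ℕ → (ℝ → E) → Prop
  | 0, f => MemL2 L f
  | m + 1, f => MemL2 L f ∧ ∃ g, IsWeakDeriv L f g ∧ MemH L m g

open Classical in
/-- The weak derivative `f' ∈ L²_per(0, L)` (unique modulo null sets) of `f ∈ H¹_per(0, L)`;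
the junk value `0` is used if `f` has no weak derivative in `L²_per(0, L)`. -/
def weakDeriv (L : ℝ) (f : ℝ → E) : ℝ → E :=
  if h : ∃ g, MemL2 L g ∧ IsWeakDeriv L f g then h.choose else 0

/-- The squared norm of `H^m_per(0, L)`, that is the sum over `0 ≤ k ≤ m` of the squared
`L²(0, L)`-norms of the `k`-th derivatives. For `m = 0` it is the squared norm of
`L²_per(0, L)`. -/
def normSqH (L : ℝ) (m : ℕ) (f : ℝ → E) : ℝ :=
  ∑ k ∈ Finset.range (m + 1), ∫ x in (0 : ℝ)..L, ‖(weakDeriv L)^[k] f x‖ ^ 2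

/-- The norm of `H^m_per(0, L)`. -/
def normH (L : ℝ) (m : ℕ) (f : ℝ → E) : ℝ := Real.sqrt (normSqH L m f)

/-! ### Functions of time with values in `H^m_per(0, L)`; `u t x` is the value at time `t` and
position `x` -/

/-- The time interval `[0, τ)`, where `τ = ⊤` is allowed. -/
def timeInterval (τ : EReal) : Set ℝ := {t | 0 ≤ t ∧ (t : EReal) < τ}

/-- `u ∈ C(I, H^m_per(0, L))`. -/
def ContH (L : ℝ) (m : ℕ) (I : Set ℝ) (u : ℝ → ℝ → E) : Prop :=
  (∀ t ∈ I, MemH L m (u t)) ∧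
    ∀ t₀ ∈ I, Tendsto (fun t => normH L m (u t - u t₀)) (𝓝[I] t₀) (𝓝 0)

/-- `u ∈ C¹(I, H^m_per(0, L))` with time derivative `u'` (one-sided at an end point of `I`). -/
def IsC1H (L : ℝ) (m : ℕ) (I : Set ℝ) (u u' : ℝ → ℝ → E) : Prop :=
  ContH L m I u ∧ ContH L m I u' ∧
    ∀ t₀ ∈ I, Tendsto (fun t => normH L m ((t - t₀)⁻¹ • (u t - u t₀) - u' t₀))
      (𝓝[I \ {t₀}] t₀) (𝓝 0)

/-- `σ ∈ C¹(I, ℝ)` with derivative `σ'` (one-sided at an end point of `I`). -/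
def IsC1Real (I : Set ℝ) (σ σ' : ℝ → ℝ) : Prop :=
  (∀ t ∈ I, HasDerivWithinAt σ (σ' t) I t) ∧ ContinuousOn σ' I

/-! ### The Lugiato-Lefever equation -/

/-- `φ` is a smooth `T`-periodic stationary solution of the Lugiato-Lefever equation
`ψ_t = -iβ ψ_xx - (1 + iα) ψ + i |ψ|² ψ + F`. -/
def IsStationaryWave (α β F T : ℝ) (φ : ℝ → ℂ) : Prop :=
  ContDiff ℝ ∞ φ ∧ Function.Periodic φ T ∧
    ∀ x, -Complex.I * β * deriv (deriv φ) x - (1 + Complex.I * α) * φ x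
      + Complex.I * (‖φ x‖ : ℂ) ^ 2 * φ x + F = 0

/-- `ψ ∈ C([0, τ), H²_per(0, L)) ∩ C¹([0, τ), L²_per(0, L))` is a classical solution on `[0, τ)` of
the Lugiato-Lefever equation `ψ_t = -iβ ψ_xx - (1 + iα) ψ + i |ψ|² ψ + F`, the equation being an
identity in `L²_per(0, L)` at every time. -/
def IsClassicalSolution (α β F L : ℝ) (τ : EReal) (ψ : ℝ → ℝ → ℂ) : Prop :=
  ContH L 2 (timeInterval τ) ψ ∧
    ∃ ψt : ℝ → ℝ → ℂ, IsC1H L 0 (timeInterval τ) ψ ψt ∧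
      ∀ t ∈ timeInterval τ, ∀ᵐ x, ψt t x =
        -Complex.I * β * weakDeriv L (weakDeriv L (ψ t)) x - (1 + Complex.I * α) * ψ t x
          + Complex.I * (‖ψ t x‖ : ℂ) ^ 2 * ψ t x + F

/-- The forward-modulated perturbation `ψ(x, t) - φ(x + γ(x, t) + σ(t) / N)`. -/
def forwardPert (φ : ℝ → ℂ) (N : ℕ) (ψ : ℝ → ℝ → ℂ) (γ : ℝ → ℝ → ℝ) (σ : ℝ → ℝ) :
    ℝ → ℝ → ℂ :=
  fun t x => ψ t x - φ (x + γ t x + σ t / N)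

end LLE

end

noncomputable section

namespace LLE

open scoped BoundedContinuousFunction ENNReal InnerProductSpace

section

variable {𝕜 : Type*} [RCLike 𝕜] {L : ℝ}

/-! ### Products of absolutely continuous functions -/

/-! The proof runs on the modified energy E = ‖ψ_t‖² − β Re ∫ ψ² (v̄_x)², where v is the
forward-modulated perturbation and norms are taken in L²(0, L), L = NT. Differentiating the equation
in time removes the forcing, and formally d/dt ‖ψ_t‖² = −2‖ψ_t‖² + 2⟨ψ_t, iψ² conj(ψ_t)⟩: the
dispersion, the α-term and the 2i|ψ|²-term are skew-adjoint and drop out. The last term is of the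
same order as the damping and is not small. However, ψ_t = −iβ v_xx + r, where r is controlled by v,
γ_x and γ_xx in L²; this follows by subtracting the profile equation at the shifted argument
(`norm_remainder_le`). Up to products with a lower-order factor, the bad term is therefore the time
derivative of β Re ∫ ψ² (v̄_x)², and the correction in E cancels it (`energyDeriv_eq`). Every
remaining product contains at most one factor ψ_t, so Young's inequality and the interpolation
‖v_x‖² ≤ ‖v‖ ‖v_xx‖ give E' + E ≤ K(‖v‖² + modulation terms). Since |β| ‖v_xx‖ ≤ ‖ψ_t‖ + ‖r‖, the
energy also controls the H²-norm of v, up to ‖v‖², ‖γ_x‖² and ‖γ_xx‖² (`energy_bounds`).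

Coercivity at the final time leaves ‖γ_x(t)‖² + ‖γ_xx(t)‖², which the claim does not allow outside
the integral. A multiple of this quantity is added to E before Grönwall's inequality: it vanishes at
time 0, and its derivative is paid for by γ_t in H² (`exists_damping_bound`).

Two points need care. Regularity: ψ_t is only continuous with values in L², and v_x need not be
differentiable in time, so both parts of E are differentiated through difference quotients
(`hasDerivWithinAt_norm_sq_timeDeriv`, `hasDerivWithinAt_inner_bmul_sq`). Uniformity in N: the
Sobolev constant depends on T only, quantities such as ψ and φ' whose L²-norm may grow with N enter
through sup norms, and the spatial constant σ_t/N has L²-norm at most √T |σ_t|. -/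

theorem absolutelyContinuous_primitive {d : ℝ → 𝕜} (hd : IntervalIntegrable d volume 0 L) :
    AbsolutelyContinuousOnInterval (fun x => ∫ s in (0 : ℝ)..x, d s) 0 L := by
  have h := hd.norm.absolutelyContinuousOnInterval_intervalIntegral (c := 0) (by simp)
  unfold AbsolutelyContinuousOnInterval at h ⊢
  refine squeeze_zero' (Eventually.of_forall fun _ => Finset.sum_nonneg fun i _ => dist_nonneg)
    ?_ h
  rw [eventually_inf_principal]
  filter_upwards with (n, I) hnI
  refine Finset.sum_le_sum fun i hi => ?_
  have h1 := (hnI.1 i hi).1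
  have h2 := (hnI.1 i hi).2
  have hsub : ∀ x ∈ uIcc 0 L, IntervalIntegrable d volume 0 x := fun x hx =>
    hd.mono_set (uIcc_subset_uIcc (by simp) hx)
  rw [dist_eq_norm, dist_eq_norm,
    intervalIntegral.integral_interval_sub_left (hsub _ h1) (hsub _ h2),
    intervalIntegral.integral_interval_sub_left (hsub _ h1).norm (hsub _ h2).norm]
  simpa [Real.norm_eq_abs] using intervalIntegral.norm_integral_le_abs_integral_norm (f := d)

/-- The product minus the candidate primitive is absolutely continuous with a.e. vanishing
derivative, hence constant. -/
theorem mul_eq_add_integral {c c' d d' : ℝ → 𝕜} (hL : 0 ≤ L)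
    (hd : IntervalIntegrable d volume 0 L) (hd' : IntervalIntegrable d' volume 0 L)
    (hc : ContinuousOn c (Icc 0 L)) (hc' : ContinuousOn c' (Icc 0 L))
    (h : ∀ x ∈ Icc 0 L, c x = c 0 + ∫ s in (0 : ℝ)..x, d s)
    (h' : ∀ x ∈ Icc 0 L, c' x = c' 0 + ∫ s in (0 : ℝ)..x, d' s) :
    ∀ x ∈ Icc 0 L, c x * c' x = c 0 * c' 0 + ∫ s in (0 : ℝ)..x, (c s * d' s + c' s * d s) := by
  have hu : uIcc 0 L = Icc 0 L := uIcc_of_le hL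
  set F : ℝ → 𝕜 := fun x => c 0 + ∫ s in (0 : ℝ)..x, d s
  set G : ℝ → 𝕜 := fun x => c' 0 + ∫ s in (0 : ℝ)..x, d' s
  have hconst : ∀ a : 𝕜, AbsolutelyContinuousOnInterval (fun _ : ℝ => a) 0 L := fun a =>
    (LipschitzWith.const a).lipschitzOnWith.absolutelyContinuousOnInterval (K := 0)
  have hF : AbsolutelyContinuousOnInterval F 0 L :=
    (hconst _).add (absolutelyContinuous_primitive hd)
  have hG : AbsolutelyContinuousOnInterval G 0 L :=
    (hconst _).add (absolutelyContinuous_primitive hd')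
  have hi : IntervalIntegrable (fun s => c s * d' s + c' s * d s) volume 0 L :=
    (hd'.continuousOn_mul (by rwa [hu])).add (hd.continuousOn_mul (by rwa [hu]))
  have hK := (hF.smul hG).sub (absolutelyContinuous_primitive hi)
  obtain ⟨C, hC⟩ := hK.const_of_ae_hasDerivAt_zero (by
    have hne : ∀ᵐ x : ℝ, x ≠ L := by simp [ae_iff]
    have hne0 : ∀ᵐ x : ℝ, x ≠ 0 := by simp [ae_iff]
    filter_upwards [hd.ae_hasDerivAt_integral, hd'.ae_hasDerivAt_integral,
      hi.ae_hasDerivAt_integral] with x h1 h2 h3 hx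
    have e1 := (h1 hx 0 (by simp)).const_add (c 0)
    have e2 := (h2 hx 0 (by simp)).const_add (c' 0)
    have e3 := h3 hx 0 (by simp)
    have := (e1.mul e2).sub e3
    have e4 : d x * (c' 0 + ∫ s in (0 : ℝ)..x, d' s) + (c 0 + ∫ s in (0 : ℝ)..x, d s) * d' x
        - (c x * d' x + c' x * d x) = 0 := by
      rw [← h x (hu ▸ hx), ← h' x (hu ▸ hx)]; ring
    rw [e4] at this
    exact this)
  intro x hx
  have h1 := hC x (hu ▸ hx)
  have h2 := hC 0 (by simp)
  simp only [Pi.sub_apply, smul_eq_mul, Pi.mul_apply, F, G, intervalIntegral.integral_same,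
    add_zero, sub_zero] at h1 h2
  rw [← h x hx, ← h' x hx, sub_eq_iff_eq_add] at h1
  rw [h1, h2]

/-! ### The space `L²(0, L)` and multiplication by bounded continuous functions -/

/-- The Hilbert space `L²(0, L)`. -/
abbrev L2 (L : ℝ) (𝕜 : Type*) [RCLike 𝕜] := Lp 𝕜 2 (volume.restrict (Ioc 0 L))

/-- The class in `L²(0, L)` of a bounded continuous function. -/
def bc (L : ℝ) : (ℝ →ᵇ 𝕜) →L[𝕜] L2 L 𝕜 :=
  BoundedContinuousFunction.toLp 2 (volume.restrict (Ioc 0 L)) 𝕜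

theorem coeFn_bc (c : ℝ →ᵇ 𝕜) : bc L c =ᵐ[volume.restrict (Ioc 0 L)] c :=
  BoundedContinuousFunction.coeFn_toLp _ _ _ _

/-- Multiplication of an element of `L²(0, L)` by a bounded continuous function. -/
def bmul (L : ℝ) : (ℝ →ᵇ 𝕜) →L[𝕜] L2 L 𝕜 →L[𝕜] L2 L 𝕜 :=
  ((ContinuousLinearMap.mul 𝕜 𝕜).holderL (volume.restrict (Ioc 0 L)) ∞ 2 2).comp
    (BoundedContinuousFunction.toLp ∞ (volume.restrict (Ioc 0 L)) 𝕜)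

theorem coeFn_bmul (c : ℝ →ᵇ 𝕜) (f : L2 L 𝕜) :
    bmul L c f =ᵐ[volume.restrict (Ioc 0 L)] fun x => c x * f x := by
  have h1 := ContinuousLinearMap.coeFn_holder (r := 2) (ContinuousLinearMap.mul 𝕜 𝕜)
    (BoundedContinuousFunction.toLp ∞ (volume.restrict (Ioc 0 L)) 𝕜 c) f
  filter_upwards [h1, BoundedContinuousFunction.coeFn_toLp ∞ (volume.restrict (Ioc 0 L)) 𝕜 c]
    with x h1 h2
  rw [← h2]
  exact h1

/-- Complex conjugation on `L²(0, L)`. -/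
def conjL (L : ℝ) : L2 L 𝕜 →L[ℝ] L2 L 𝕜 :=
  ((RCLike.conjCLE : 𝕜 ≃L[ℝ] 𝕜) : 𝕜 →L[ℝ] 𝕜).compLpL 2 (volume.restrict (Ioc 0 L))

theorem coeFn_conjL (f : L2 L 𝕜) :
    conjL L f =ᵐ[volume.restrict (Ioc 0 L)] fun x => star (f x) :=
  ContinuousLinearMap.coeFn_compLpL _ f

attribute [irreducible] bc bmul conjL

theorem norm_bmul_le_of_bound {c : ℝ →ᵇ 𝕜} {C : ℝ} (hC : ∀ x, ‖c x‖ ≤ C) (f : L2 L 𝕜) :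
    ‖bmul L c f‖ ≤ C * ‖f‖ := by
  refine Lp.norm_le_mul_norm_of_ae_le_mul ?_
  filter_upwards [coeFn_bmul c f] with x hx
  rw [hx, norm_mul]
  exact mul_le_mul_of_nonneg_right (hC x) (norm_nonneg _)

theorem norm_bmul_le (c : ℝ →ᵇ 𝕜) (f : L2 L 𝕜) : ‖bmul L c f‖ ≤ ‖c‖ * ‖f‖ :=
  norm_bmul_le_of_bound c.norm_coe_le_norm f

@[simp] theorem norm_conjL (f : L2 L 𝕜) : ‖conjL L f‖ = ‖f‖ := by
  refine le_antisymm (Lp.norm_le_norm_of_ae_le ?_) (Lp.norm_le_norm_of_ae_le ?_) <;>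
  · filter_upwards [coeFn_conjL f] with x hx
    rw [hx, norm_star]

theorem bmul_mul (c d : ℝ →ᵇ 𝕜) (f : L2 L 𝕜) : bmul L (c * d) f = bmul L c (bmul L d f) := by
  refine Lp.ext ?_
  filter_upwards [coeFn_bmul (c * d) f, coeFn_bmul c (bmul L d f), coeFn_bmul d f] with x h1 h2 h3
  rw [h1, h2, h3, BoundedContinuousFunction.mul_apply, mul_assoc]

theorem bmul_bc (c d : ℝ →ᵇ 𝕜) : bmul L c (bc L d) = bc L (c * d) := by
  refine Lp.ext ?_
  filter_upwards [coeFn_bmul c (bc L d), coeFn_bc (L := L) d, coeFn_bc (L := L) (c * d)]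
    with x h1 h2 h3
  rw [h1, h2, h3, BoundedContinuousFunction.mul_apply]

theorem conjL_bc (c : ℝ →ᵇ 𝕜) : conjL L (bc L c) = bc L (star c) := by
  refine Lp.ext ?_
  filter_upwards [coeFn_conjL (bc L c), coeFn_bc (L := L) c, coeFn_bc (L := L) (star c)]
    with x h1 h2 h3
  rw [h1, h2, h3, BoundedContinuousFunction.star_apply]

theorem conjL_I_smul (f : L2 L ℂ) : conjL L (Complex.I • f) = -(Complex.I • conjL L f) := by
  refine Lp.ext ?_
  filter_upwards [coeFn_conjL (Complex.I • f), Lp.coeFn_smul Complex.I f,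
    Lp.coeFn_neg (Complex.I • conjL L f), Lp.coeFn_smul Complex.I (conjL L f), coeFn_conjL f]
    with x h1 h2 h3 h4 h5
  rw [h1, h2, h3, Pi.neg_apply, h4]
  simp [h5]

theorem inner_bmul_left (c : ℝ →ᵇ ℂ) (f g : L2 L ℂ) :
    ⟪bmul L c f, g⟫_ℝ = ⟪f, bmul L (star c) g⟫_ℝ := by
  rw [L2.inner_def, L2.inner_def]
  refine integral_congr_ae ?_
  filter_upwards [coeFn_bmul c f, coeFn_bmul (star c) g] with x h1 h2
  rw [h1, h2]
  simp [Complex.inner]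
  ring

theorem inner_I_smul_left (f g : L2 L ℂ) : ⟪Complex.I • f, g⟫_ℝ = -⟪f, Complex.I • g⟫_ℝ := by
  rw [L2.inner_def, L2.inner_def, ← integral_neg]
  refine integral_congr_ae ?_
  filter_upwards [Lp.coeFn_smul Complex.I f, Lp.coeFn_smul Complex.I g] with x h1 h2
  rw [h1, h2]
  simp [Complex.inner]
  ring

theorem inner_I_smul_self (f : L2 L ℂ) : ⟪f, Complex.I • f⟫_ℝ = 0 := by
  have := inner_I_smul_left f f
  rw [real_inner_comm] at this
  linarith

/-- Both sides are the real part of ∫ c f̄ ḡ. This symmetry is what allows differences of the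
quadratic form in v_x to be factored. -/
theorem inner_bmul_conjL_comm (c : ℝ →ᵇ ℂ) (f g : L2 L ℂ) :
    ⟪f, bmul L c (conjL L g)⟫_ℝ = ⟪g, bmul L c (conjL L f)⟫_ℝ := by
  rw [L2.inner_def, L2.inner_def]
  refine integral_congr_ae ?_
  filter_upwards [coeFn_bmul c (conjL L f), coeFn_bmul c (conjL L g), coeFn_conjL f,
    coeFn_conjL g] with x h1 h2 h3 h4
  rw [h1, h2, h3, h4]
  simp [Complex.inner]
  ring

/-! ### Pairs of a continuous periodic function and its derivative in `L²` -/

theorem intervalIntegrable_L2 (hL : 0 ≤ L) (d : L2 L 𝕜) : IntervalIntegrable d volume 0 L := by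
  rw [intervalIntegrable_iff_integrableOn_Ioc_of_le hL]
  exact (Lp.memLp d).integrable (by norm_num)

/-- `c` is an absolutely continuous `L`-periodic function with derivative `d` in `L²(0, L)`. -/
def IsH1 (L : ℝ) (c : ℝ →ᵇ 𝕜) (d : L2 L 𝕜) : Prop :=
  Function.Periodic c L ∧ ∀ x ∈ Icc 0 L, c x = c 0 + ∫ s in (0 : ℝ)..x, d s

theorem integral_congr_L2 {f g : ℝ → 𝕜} (h : f =ᵐ[volume.restrict (Ioc 0 L)] g) {x : ℝ}
    (hx : x ∈ Icc 0 L) : ∫ s in (0 : ℝ)..x, f s = ∫ s in (0 : ℝ)..x, g s := by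
  refine intervalIntegral.integral_congr_ae ?_
  rw [uIoc_of_le hx.1]
  filter_upwards [(ae_restrict_iff' measurableSet_Ioc).1 h] with s hs hs'
  exact hs ⟨hs'.1, hs'.2.trans hx.2⟩

namespace IsH1

variable {c c' : ℝ →ᵇ 𝕜} {d d' : L2 L 𝕜}

theorem mul (hL : 0 ≤ L) (h : IsH1 L c d) (h' : IsH1 L c' d') :
    IsH1 L (c * c') (bmul L c d' + bmul L c' d) := by
  refine ⟨h.1.mul h'.1, fun x hx => ?_⟩
  have := mul_eq_add_integral hL (intervalIntegrable_L2 hL d) (intervalIntegrable_L2 hL d')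
    c.continuous.continuousOn c'.continuous.continuousOn h.2 h'.2 x hx
  rw [BoundedContinuousFunction.mul_apply, BoundedContinuousFunction.mul_apply, this]
  congr 1
  refine integral_congr_L2 ?_ hx
  filter_upwards [Lp.coeFn_add (bmul L c d') (bmul L c' d), coeFn_bmul c d', coeFn_bmul c' d]
    with y h1 h2 h3
  rw [h1, Pi.add_apply, h2, h3]

theorem smul_add_smul (hL : 0 ≤ L) (a b : 𝕜) (h : IsH1 L c d) (h' : IsH1 L c' d') :
    IsH1 L (a • c + b • c') (a • d + b • d') := by
  refine ⟨fun x => by simp [h.1 x, h'.1 x], fun x hx => ?_⟩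
  have e : ∫ s in (0 : ℝ)..x, (a • d + b • d' : L2 L 𝕜) s
      = ∫ s in (0 : ℝ)..x, (a * d s + b * d' s) := by
    refine integral_congr_L2 ?_ hx
    filter_upwards [Lp.coeFn_add (a • d) (b • d'), Lp.coeFn_smul a d, Lp.coeFn_smul b d']
      with y h1 h2 h3
    rw [h1, Pi.add_apply, h2, h3]
    simp
  have hi : ∀ d : L2 L 𝕜, IntervalIntegrable d volume 0 x := fun d =>
    (intervalIntegrable_L2 hL d).mono_set (uIcc_subset_uIcc (by simp) (by rwa [uIcc_of_le hL]))
  rw [e, intervalIntegral.integral_add ((hi d).const_mul a) ((hi d').const_mul b),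
    intervalIntegral.integral_const_mul, intervalIntegral.integral_const_mul]
  simp only [BoundedContinuousFunction.add_apply, BoundedContinuousFunction.smul_apply, smul_eq_mul,
    h.2 x hx, h'.2 x hx]
  ring

theorem add (hL : 0 ≤ L) (h : IsH1 L c d) (h' : IsH1 L c' d') : IsH1 L (c + c') (d + d') := by
  simpa using smul_add_smul hL 1 1 h h'

theorem sub (hL : 0 ≤ L) (h : IsH1 L c d) (h' : IsH1 L c' d') : IsH1 L (c - c') (d - d') := by
  simpa [sub_eq_add_neg] using smul_add_smul hL 1 (-1) h h'

theorem smul (hL : 0 ≤ L) (a : 𝕜) (h : IsH1 L c d) : IsH1 L (a • c) (a • d) := by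
  simpa using smul_add_smul hL a 0 h h

theorem star (h : IsH1 L c d) : IsH1 L (star c) (conjL L d) := by
  refine ⟨fun x => by simp [h.1 x], fun x hx => ?_⟩
  rw [BoundedContinuousFunction.star_apply, BoundedContinuousFunction.star_apply, h.2 x hx,
    integral_congr_L2 (coeFn_conjL d) hx, star_add]
  congr 1
  simp only [RCLike.star_def]
  exact (intervalIntegral.intervalIntegral_conj (𝕜 := 𝕜)).symm

theorem integral_eq_zero (hL : 0 ≤ L) (h : IsH1 L c d) : ∫ s in (0 : ℝ)..L, d s = 0 := by
  have h1 := h.2 L ⟨hL, le_rfl⟩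
  have h2 := h.1 0
  rw [zero_add] at h2
  rw [h2] at h1
  simpa using h1.symm

end IsH1

/-- Integration by parts. -/
theorem inner_deriv_eq_neg (hL : 0 ≤ L) {c c' : ℝ →ᵇ ℂ} {d d' : L2 L ℂ} (h : IsH1 L c d)
    (h' : IsH1 L c' d') : ⟪d, bc L c'⟫_ℝ = -⟪bc L c, d'⟫_ℝ := by
  have h0 := (h.star.mul hL h').integral_eq_zero hL
  rw [← add_eq_zero_iff_eq_neg, L2.inner_def, L2.inner_def,
    ← integral_add (L2.integrable_inner _ _) (L2.integrable_inner _ _)]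
  have h1 := congrArg Complex.re h0
  rw [intervalIntegral.integral_of_le hL] at h1
  have hint : Integrable (bmul L (star c) d' + bmul L c' (conjL L d) : L2 L ℂ)
      (volume.restrict (Ioc 0 L)) := (Lp.memLp _).integrable (by norm_num)
  have h2 := integral_re hint
  simp only [RCLike.re_to_complex] at h2
  rw [← h2] at h1
  refine Eq.trans (integral_congr_ae ?_) (h1.trans Complex.zero_re)
  filter_upwards [Lp.coeFn_add (bmul L (star c) d') (bmul L c' (conjL L d)),
    coeFn_bmul (star c) d', coeFn_bmul c' (conjL L d), coeFn_conjL d, coeFn_bc (L := L) c,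
    coeFn_bc (L := L) c'] with x h1 h2 h3 h4 h5 h6
  rw [h1, Pi.add_apply, h2, h3, h4, h5, h6]
  simp [Complex.inner]
  ring

theorem norm_sq_L2 (hL : 0 ≤ L) (f : L2 L 𝕜) : ‖f‖ ^ 2 = ∫ x in (0 : ℝ)..L, ‖f x‖ ^ 2 := by
  have h := congrArg RCLike.re (L2.inner_def (𝕜 := 𝕜) f f)
  rw [← integral_re (L2.integrable_inner f f)] at h
  simp only [← norm_sq_eq_re_inner] at h
  rw [h, intervalIntegral.integral_of_le hL]

theorem norm_sq_bc (hL : 0 ≤ L) (c : ℝ →ᵇ 𝕜) :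
    ‖bc L c‖ ^ 2 = ∫ x in (0 : ℝ)..L, ‖c x‖ ^ 2 := by
  rw [norm_sq_L2 hL]
  refine integral_congr_L2 ?_ ⟨hL, le_rfl⟩
  filter_upwards [coeFn_bc (L := L) c] with x hx
  rw [hx]

theorem norm_integral_le_sqrt_mul {d : L2 L 𝕜} {x y : ℝ} (h0 : 0 ≤ y) (hyx : y ≤ x) (hx : x ≤ L) :
    ‖∫ s in y..x, d s‖ ≤ √(x - y) * ‖d‖ := by
  have hs : MeasurableSet (Ioc y x) := measurableSet_Ioc
  have hsub : Ioc y x ⊆ Ioc 0 L := Ioc_subset_Ioc h0 hx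
  have hμ : volume.restrict (Ioc 0 L) (Ioc y x) ≠ ⊤ := measure_ne_top _ _
  have h := L2.inner_indicatorConstLp_one (𝕜 := 𝕜) hs hμ d
  rw [Measure.restrict_restrict hs, inter_eq_left.2 hsub] at h
  rw [intervalIntegral.integral_of_le hyx, ← h]
  refine (norm_inner_le_norm _ _).trans_eq ?_
  rw [norm_indicatorConstLp (by norm_num) (by norm_num), measureReal_restrict_apply hs,
    inter_eq_left.2 hsub, Real.volume_real_Ioc_of_le hyx, Real.sqrt_eq_rpow]
  simp

/-- Sobolev's inequality, with a constant depending only on a lower bound of the period. -/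
theorem IsH1.norm_apply_le {T : ℝ} (hT : 0 < T) (hTL : T ≤ L) {c : ℝ →ᵇ 𝕜} {d : L2 L 𝕜}
    (h : IsH1 L c d) (x : ℝ) : ‖c x‖ ≤ (√T)⁻¹ * ‖bc L c‖ + √T * ‖d‖ := by
  have hL : 0 < L := hT.trans_le hTL
  wlog hx : x ∈ Icc 0 L generalizing x
  · have := this (toIcoMod hL 0 x) (by
      have := toIcoMod_mem_Ico hL 0 x
      rw [zero_add] at this
      exact Ico_subset_Icc_self this)
    rwa [← self_sub_toIcoDiv_zsmul, h.1.sub_zsmul_eq] at this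
  -- A window [a, a + T] inside [0, L] containing x: the minimum of ‖c‖ on it is bounded by the
  -- L²-norm, and c varies by at most √T ‖d‖ across it. Only the length T enters the constants.
  set a := min x (L - T)
  have ha : 0 ≤ a := le_min hx.1 (by linarith)
  have hax : a ≤ x := min_le_left _ _
  have haT : a + T ≤ L := by linarith [min_le_right x (L - T)]
  have hxa : x ≤ a + T := by
    rcases min_cases x (L - T) with h | h <;> simp only [a, h.1] <;> linarith [hx.2, h.2]
  obtain ⟨y, hy, hmin⟩ := (isCompact_Icc (a := a) (b := a + T)).exists_isMinOn
    ⟨a, left_mem_Icc.2 (by linarith)⟩ c.continuous.norm.continuousOn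
  have hyc : ‖c y‖ ≤ (√T)⁻¹ * ‖bc L c‖ := by
    have h1 : T * ‖c y‖ ^ 2 ≤ ‖bc L c‖ ^ 2 := by
      have hcont : Continuous fun x => ‖c x‖ ^ 2 := c.continuous.norm.pow 2
      calc T * ‖c y‖ ^ 2 = ∫ _ in a..a + T, ‖c y‖ ^ 2 := by simp
        _ ≤ ∫ x in a..a + T, ‖c x‖ ^ 2 := by
          refine intervalIntegral.integral_mono_on (by linarith) (by simp)
            (hcont.intervalIntegrable _ _) fun z hz => ?_
          have : ‖c y‖ ≤ ‖c z‖ := hmin hz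
          gcongr
        _ ≤ ∫ x in (0 : ℝ)..L, ‖c x‖ ^ 2 :=
          intervalIntegral.integral_mono_interval ha (by linarith) haT
            (Eventually.of_forall fun _ => by positivity) (hcont.intervalIntegrable _ _)
        _ = ‖bc L c‖ ^ 2 := (norm_sq_bc hL.le c).symm
    rw [inv_mul_eq_div, le_div_iff₀ (by positivity)]
    refine (sq_le_sq₀ (by positivity) (by positivity)).1 ?_
    rw [mul_pow, Real.sq_sqrt hT.le]
    linarith
  have hdiff : ‖c x - c y‖ ≤ √T * ‖d‖ := by
    have hi : ∀ z ∈ Icc 0 L, IntervalIntegrable d volume 0 z := fun z hz =>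
      (intervalIntegrable_L2 hL.le d).mono_set
        (uIcc_subset_uIcc (by simp) (by rwa [uIcc_of_le hL.le]))
    have hyL : y ∈ Icc 0 L := ⟨ha.trans hy.1, hy.2.trans haT⟩
    rw [h.2 x hx, h.2 y hyL, add_sub_add_left_eq_sub,
      intervalIntegral.integral_interval_sub_left (hi x hx) (hi y hyL)]
    rcases le_total y x with hyx | hyx
    · refine (norm_integral_le_sqrt_mul hyL.1 hyx hx.2).trans ?_
      gcongr
      linarith [hy.1]
    · rw [intervalIntegral.integral_symm, norm_neg]
      refine (norm_integral_le_sqrt_mul hx.1 hyx hyL.2).trans ?_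
      gcongr
      linarith [hy.2]
  calc ‖c x‖ = ‖c y + (c x - c y)‖ := by rw [add_sub_cancel]
    _ ≤ ‖c y‖ + ‖c x - c y‖ := norm_add_le _ _
    _ ≤ _ := add_le_add hyc hdiff

theorem IsH1.norm_le {T : ℝ} (hT : 0 < T) (hTL : T ≤ L) {c : ℝ →ᵇ 𝕜} {d : L2 L 𝕜}
    (h : IsH1 L c d) : ‖c‖ ≤ (√T)⁻¹ * ‖bc L c‖ + √T * ‖d‖ :=
  (BoundedContinuousFunction.norm_le (by positivity)).2 (h.norm_apply_le hT hTL)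

end

section

variable {𝕜 : Type*} [RCLike 𝕜] {L : ℝ}

/-! ### The fundamental lemma of the calculus of variations for periodic functions -/

theorem integral_cos_sin_smul_eq_zero (hL : 0 < L) {u : ℝ → ℂ}
    (h : ∀ η : ℝ → ℝ, ContDiff ℝ ∞ η → Function.Periodic η L →
      ∫ x in (0 : ℝ)..L, deriv η x • u x = 0) {n : ℤ} (hn : n ≠ 0) :
    (∫ x in (0 : ℝ)..L, Real.cos (2 * Real.pi * n / L * x) • u x = 0) ∧
      ∫ x in (0 : ℝ)..L, Real.sin (2 * Real.pi * n / L * x) • u x = 0 := by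
  set κ : ℝ := 2 * Real.pi * n / L with hκ
  have hκ0 : κ ≠ 0 := by
    have : (n : ℝ) ≠ 0 := by exact_mod_cast hn
    positivity
  have hκL : ∀ x, κ * (x + L) = κ * x + n * (2 * Real.pi) := fun x => by
    rw [hκ]; field_simp
  constructor
  · have h1 := h (fun x => κ⁻¹ * Real.sin (κ * x)) (by fun_prop)
      (fun x => by simp only [hκL, Real.sin_add_int_mul_two_pi])
    have hd : deriv (fun x => κ⁻¹ * Real.sin (κ * x)) = fun x => Real.cos (κ * x) := by
      funext x
      have := ((((hasDerivAt_id x).const_mul κ).sin).const_mul κ⁻¹).deriv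
      simp only [id] at this
      rw [this]
      field_simp
    rwa [hd] at h1
  · have h1 := h (fun x => -κ⁻¹ * Real.cos (κ * x)) (by fun_prop)
      (fun x => by simp only [hκL, Real.cos_add_int_mul_two_pi])
    have hd : deriv (fun x => -κ⁻¹ * Real.cos (κ * x)) = fun x => Real.sin (κ * x) := by
      funext x
      have := ((((hasDerivAt_id x).const_mul κ).cos).const_mul (-κ⁻¹)).deriv
      simp only [id] at this
      rw [this]
      field_simp
    rwa [hd] at h1

theorem integral_deriv_smul_const {η : ℝ → ℝ} (hη : ContDiff ℝ ∞ η)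
    (hp : Function.Periodic η L) {E : Type*} [NormedAddCommGroup E] [NormedSpace ℝ E]
    [CompleteSpace E] (a : E) :
    ∫ x in (0 : ℝ)..L, deriv η x • a = 0 := by
  rw [intervalIntegral.integral_smul_const, intervalIntegral.integral_deriv_eq_sub
    (fun x _ => (hη.differentiable (by simp)).differentiableAt)
    ((hη.continuous_deriv (by simp)).intervalIntegrable _ _)]
  have := hp 0
  rw [zero_add] at this
  rw [this, sub_self, zero_smul]

theorem intervalIntegrable_of_memLp (hL : 0 ≤ L) {E : Type*} [NormedAddCommGroup E] {f : ℝ → E}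
    (hf : MemLp f 2 (volume.restrict (Ioc 0 L))) : IntervalIntegrable f volume 0 L := by
  rw [intervalIntegrable_iff_integrableOn_Ioc_of_le hL]
  exact hf.integrable (by norm_num)

/-- Derivatives of periodic test functions include all sines and cosines of nonzero frequency. After
subtracting the mean, every Fourier coefficient vanishes and Parseval's identity concludes. -/
theorem ae_eq_const_of_complex (hL : 0 < L) {u : ℝ → ℂ}
    (hu : MemLp u 2 (volume.restrict (Ioc 0 L)))
    (h : ∀ η : ℝ → ℝ, ContDiff ℝ ∞ η → Function.Periodic η L →
      ∫ x in (0 : ℝ)..L, deriv η x • u x = 0) :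
    ∃ a, u =ᵐ[volume.restrict (Ioc 0 L)] fun _ => a := by
  set a : ℂ := L⁻¹ • ∫ x in (0 : ℝ)..L, u x
  set w : ℝ → ℂ := fun x => u x - a
  have hw : MemLp w 2 (volume.restrict (Ioc 0 L)) := hu.sub (memLp_const a)
  have hui := intervalIntegrable_of_memLp hL.le hu
  have hwi := intervalIntegrable_of_memLp hL.le hw
  have hwη : ∀ η : ℝ → ℝ, ContDiff ℝ ∞ η → Function.Periodic η L →
      ∫ x in (0 : ℝ)..L, deriv η x • w x = 0 := by
    intro η hη hp
    have hηc : ContinuousOn (deriv η) (uIcc 0 L) := (hη.continuous_deriv (by simp)).continuousOn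
    simp only [w, smul_sub]
    rw [intervalIntegral.integral_sub (hui.continuousOn_smul hηc)
      (intervalIntegrable_const.continuousOn_smul hηc), h η hη hp,
      integral_deriv_smul_const hη hp, sub_zero]
  have hcoef : ∀ n : ℤ, fourierCoeffOn hL w n = 0 := by
    intro n
    rw [fourierCoeffOn_eq_integral]
    rcases eq_or_ne n 0 with rfl | hn
    · simp only [neg_zero, fourier_zero, one_smul, w, sub_zero]
      rw [intervalIntegral.integral_sub hui intervalIntegrable_const]
      simp only [intervalIntegral.integral_const, sub_zero, a]
      rw [smul_smul L, mul_inv_cancel₀ hL.ne', one_smul, sub_self, smul_zero]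
    · obtain ⟨h1, h2⟩ := integral_cos_sin_smul_eq_zero hL hwη (n := -n) (by simpa using hn)
      have hcos : IntervalIntegrable
          (fun x => Real.cos (2 * Real.pi * (-n : ℤ) / L * x) • w x) volume 0 L :=
        hwi.continuousOn_smul (by fun_prop)
      have hsin : IntervalIntegrable
          (fun x => Complex.I • (Real.sin (2 * Real.pi * (-n : ℤ) / L * x) • w x)) volume 0 L :=
        (hwi.continuousOn_smul (by fun_prop)).smul Complex.I
      have e : ∀ x : ℝ, fourier (-n) (x : AddCircle (L - 0)) • w x
          = Real.cos (2 * Real.pi * (-n : ℤ) / L * x) • w x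
            + Complex.I • (Real.sin (2 * Real.pi * (-n : ℤ) / L * x) • w x) := by
        intro x
        rw [fourier_coe_apply]
        have : (2 * Real.pi * Complex.I * (-n : ℤ) * x / ((L - 0 : ℝ) : ℂ))
            = ((2 * Real.pi * (-n : ℤ) / L * x : ℝ) : ℂ) * Complex.I := by
          push_cast; ring
        rw [this, Complex.exp_mul_I, ← Complex.ofReal_cos, ← Complex.ofReal_sin]
        simp only [smul_eq_mul, Complex.real_smul]
        ring
      simp_rw [e]
      rw [intervalIntegral.integral_add hcos hsin, intervalIntegral.integral_smul, h1, h2]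
      simp
  have hsum := hasSum_sq_fourierCoeffOn hL hw
  simp only [hcoef] at hsum
  have h0 : ∫ x in (0 : ℝ)..L, ‖w x‖ ^ 2 = 0 := by
    have := hsum.unique (by simp [hasSum_zero] : HasSum (fun _ : ℤ => ‖(0 : ℂ)‖ ^ 2) 0)
    simpa [hL.ne'] using this
  rw [intervalIntegral.integral_of_le hL.le, integral_eq_zero_iff_of_nonneg
    (fun _ => by positivity) hw.integrable_norm_pow'] at h0
  refine ⟨a, ?_⟩
  filter_upwards [h0] with x hx
  simpa [w, sub_eq_zero] using hx

theorem ae_eq_const (hL : 0 < L) {u : ℝ → 𝕜} (hu : MemLp u 2 (volume.restrict (Ioc 0 L)))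
    (h : ∀ η : ℝ → ℝ, ContDiff ℝ ∞ η → Function.Periodic η L →
      ∫ x in (0 : ℝ)..L, deriv η x • u x = 0) :
    ∃ a, u =ᵐ[volume.restrict (Ioc 0 L)] fun _ => a := by
  have key : ∀ Λ : 𝕜 →L[ℝ] ℂ, ∃ a, (fun x => Λ (u x)) =ᵐ[volume.restrict (Ioc 0 L)]
      fun _ => a := by
    intro Λ
    refine ae_eq_const_of_complex hL (Λ.comp_memLp' hu) fun η hη hp => ?_
    have hi := (intervalIntegrable_of_memLp hL.le hu).continuousOn_smul
      (hη.continuous_deriv (by simp)).continuousOn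
    have := Λ.intervalIntegral_comp_comm hi
    simp only [map_smul] at this
    rw [this, h η hη hp, map_zero]
  obtain ⟨a, ha⟩ := key (Complex.ofRealCLM.comp RCLike.reCLM)
  obtain ⟨b, hb⟩ := key (Complex.ofRealCLM.comp RCLike.imCLM)
  refine ⟨(a.re : 𝕜) + b.re * RCLike.I, ?_⟩
  filter_upwards [ha, hb] with x h1 h2
  rw [← h1, ← h2]
  simp

/-! ### Weak derivatives and absolutely continuous representatives -/

open Classical in
/-- The class in `L²(0, L)` of a square integrable function (and `0` for other functions). -/
def toH (L : ℝ) (f : ℝ → 𝕜) : L2 L 𝕜 :=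
  if h : MemLp f 2 (volume.restrict (Ioc 0 L)) then h.toLp f else 0

theorem coeFn_toH {f : ℝ → 𝕜} (h : MemLp f 2 (volume.restrict (Ioc 0 L))) :
    toH L f =ᵐ[volume.restrict (Ioc 0 L)] f := by
  rw [toH, dif_pos h]
  exact h.coeFn_toLp

theorem toH_congr {f g : ℝ → 𝕜} (h : f =ᵐ[volume.restrict (Ioc 0 L)] g) : toH L f = toH L g := by
  by_cases hf : MemLp f 2 (volume.restrict (Ioc 0 L))
  · rw [toH, toH, dif_pos hf, dif_pos (hf.ae_eq h)]
    exact MemLp.toLp_congr _ _ h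
  · rw [toH, toH, dif_neg hf, dif_neg fun hg => hf (hg.ae_eq h.symm)]

theorem toH_eq_iff {f : ℝ → 𝕜} (h : MemLp f 2 (volume.restrict (Ioc 0 L))) {d : L2 L 𝕜} :
    toH L f = d ↔ f =ᵐ[volume.restrict (Ioc 0 L)] d :=
  ⟨fun e => e ▸ (coeFn_toH h).symm, fun e => Lp.ext ((coeFn_toH h).trans e)⟩

theorem toH_eq_bc {f : ℝ → 𝕜} {c : ℝ →ᵇ 𝕜} (h : f =ᵐ[volume.restrict (Ioc 0 L)] c) :
    toH L f = bc L c := by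
  have hf : MemLp f 2 (volume.restrict (Ioc 0 L)) :=
    (Lp.memLp (bc L c)).ae_eq ((coeFn_bc c).trans h.symm)
  exact (toH_eq_iff hf).2 (h.trans (coeFn_bc c).symm)

theorem exists_coe_eq (hL : 0 < L) {f : ℝ → 𝕜} (hf : Continuous f) (hp : Function.Periodic f L) :
    ∃ c : ℝ →ᵇ 𝕜, ⇑c = f := by
  obtain ⟨C, hC⟩ := (hp.isBounded_of_continuous hL.ne' hf).exists_norm_le
  exact ⟨BoundedContinuousFunction.ofNormedAddCommGroup f hf C fun x => hC _ ⟨x, rfl⟩, rfl⟩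

theorem IsH1.of_hasDerivAt {c c' : ℝ →ᵇ 𝕜} (hp : Function.Periodic c L)
    (h : ∀ x ∈ Ioo 0 L, HasDerivAt c (c' x) x) : IsH1 L c (bc L c') := by
  refine ⟨hp, fun x hx => ?_⟩
  rw [integral_congr_L2 (coeFn_bc c') hx, intervalIntegral.integral_eq_sub_of_hasDerivAt_of_le hx.1
    c.continuous.continuousOn (fun y hy => h y ⟨hy.1, hy.2.trans_le hx.2⟩)
    (c'.continuous.intervalIntegrable _ _)]
  ring

theorem IsH1.isWeakDeriv (hL : 0 < L) {c : ℝ →ᵇ 𝕜} {d : L2 L 𝕜} (h : IsH1 L c d) {f g : ℝ → 𝕜}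
    (hf : f =ᵐ[volume.restrict (Ioc 0 L)] c) (hg : g =ᵐ[volume.restrict (Ioc 0 L)] d) :
    IsWeakDeriv L f g := by
  intro η hη hp
  have hLL : L ∈ Icc 0 L := ⟨hL.le, le_rfl⟩
  have hη' : Continuous (deriv η) := hη.continuous_deriv (by simp)
  have hp' : Function.Periodic (deriv η) L := fun x => by
    rw [← deriv_comp_add_const, show (fun x => η (x + L)) = η from funext hp]
  obtain ⟨e, he⟩ := exists_coe_eq (𝕜 := 𝕜) hL (f := fun x => (η x : 𝕜))
    (RCLike.continuous_ofReal.comp hη.continuous) (fun x => by simp [hp x])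
  obtain ⟨e', he'⟩ := exists_coe_eq (𝕜 := 𝕜) hL (f := fun x => ((deriv η x : ℝ) : 𝕜))
    (RCLike.continuous_ofReal.comp hη') (fun x => by simp [hp' x])
  have heH : IsH1 L e (bc L e') := IsH1.of_hasDerivAt (by rw [he]; intro x; simp [hp x])
    fun x _ => by
      rw [he, he']
      exact (RCLike.ofRealCLM (K := 𝕜)).hasFDerivAt.comp_hasDerivAt x
        (hη.differentiable (by simp)).differentiableAt.hasDerivAt
  have h0 := (heH.mul hL.le h).integral_eq_zero hL.le
  rw [integral_congr_L2 (g := fun x => η x • g x + deriv η x • f x) ?_ hLL] at h0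
  · have hfi : IntervalIntegrable f volume 0 L :=
      intervalIntegrable_of_memLp hL.le ((Lp.memLp (bc L c)).ae_eq ((coeFn_bc c).trans hf.symm))
    have hgi : IntervalIntegrable g volume 0 L :=
      intervalIntegrable_of_memLp hL.le ((Lp.memLp d).ae_eq hg.symm)
    rw [intervalIntegral.integral_add (hgi.continuousOn_smul hη.continuous.continuousOn)
      (hfi.continuousOn_smul hη'.continuousOn)] at h0
    rw [← add_eq_zero_iff_eq_neg, add_comm, h0]
  · filter_upwards [Lp.coeFn_add (bmul L e d) (bmul L c (bc L e')), coeFn_bmul e d,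
      coeFn_bmul c (bc L e'), coeFn_bc (L := L) e', hf, hg] with x h1 h2 h3 h4 h5 h6
    rw [h1, Pi.add_apply, h2, h3, h4, h5, h6, he, he', RCLike.real_smul_eq_coe_mul,
      RCLike.real_smul_eq_coe_mul, mul_comm (c x)]

/-- Testing with η = 1 shows that g has mean zero, so its primitive is periodic. The difference
between f and this primitive has zero weak derivative and is a.e. constant. -/
theorem exists_isH1_of_isWeakDeriv (hL : 0 < L) {f g : ℝ → 𝕜} (hf : MemL2 L f) (hg : MemL2 L g)
    (h : IsWeakDeriv L f g) : ∃ c : ℝ →ᵇ 𝕜, bc L c = toH L f ∧ IsH1 L c (toH L g) := by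
  have hgi := intervalIntegrable_of_memLp hL.le hg.2
  have hmean : ∫ x in (0 : ℝ)..L, g x = 0 := by
    have := h (fun _ => 1) contDiff_const (fun _ => rfl)
    simpa using this
  have hgi' : ∀ a b, IntervalIntegrable g volume a b := fun a b =>
    hg.1.intervalIntegrable hL.ne' (t := 0) (by rwa [zero_add]) a b
  obtain ⟨c, hc⟩ := exists_coe_eq hL (f := fun x => ∫ s in (0 : ℝ)..x, g s)
    (intervalIntegral.continuous_primitive hgi' 0) (fun x => by
      have h1 := hg.1.intervalIntegral_add_eq x 0
      rw [zero_add, hmean] at h1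
      simp only
      rw [← intervalIntegral.integral_add_adjacent_intervals (hgi' 0 x) (hgi' x (x + L)), h1,
        add_zero])
  have hcp : Function.Periodic c L := by
    rw [hc]
    intro x
    have h1 := hg.1.intervalIntegral_add_eq x 0
    rw [zero_add, hmean] at h1
    simp only
    rw [← intervalIntegral.integral_add_adjacent_intervals (hgi' 0 x) (hgi' x (x + L)), h1,
      add_zero]
  have hcH : IsH1 L c (toH L g) := by
    refine ⟨hcp, fun x hx => ?_⟩
    rw [integral_congr_L2 (coeFn_toH hg.2) hx, hc]
    simp
  have hw := hcH.isWeakDeriv hL (f := c) (g := g) (EventuallyEq.refl _ _) (coeFn_toH hg.2).symm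
  have hcL : MemLp c 2 (volume.restrict (Ioc 0 L)) := (Lp.memLp (bc L c)).ae_eq (coeFn_bc c)
  obtain ⟨a, ha⟩ := ae_eq_const hL (hf.2.sub hcL) fun η hη hp => by
    have hηc : ContinuousOn (deriv η) (uIcc 0 L) := (hη.continuous_deriv (by simp)).continuousOn
    simp only [Pi.sub_apply, smul_sub]
    rw [intervalIntegral.integral_sub
      ((intervalIntegrable_of_memLp hL.le hf.2).continuousOn_smul hηc)
      ((intervalIntegrable_of_memLp hL.le hcL).continuousOn_smul hηc), h η hη hp, hw η hη hp,
      sub_self]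
  refine ⟨c + BoundedContinuousFunction.const ℝ a, ?_, fun x => by simp [hcp x], fun x hx => ?_⟩
  · refine (toH_eq_bc ?_).symm
    filter_upwards [ha] with x hx
    simp only [Pi.sub_apply] at hx
    simp [← hx]
  · simp only [BoundedContinuousFunction.add_apply, BoundedContinuousFunction.const_apply]
    rw [hcH.2 x hx]
    ring

theorem isWeakDeriv_unique (hL : 0 < L) {f g g' : ℝ → 𝕜} (hg : MemL2 L g) (hg' : MemL2 L g')
    (h : IsWeakDeriv L f g) (h' : IsWeakDeriv L f g') :
    g =ᵐ[volume.restrict (Ioc 0 L)] g' := by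
  have hgi := intervalIntegrable_of_memLp hL.le hg.2
  have hgi' := intervalIntegrable_of_memLp hL.le hg'.2
  have key : ∀ η : ℝ → ℝ, ContDiff ℝ ∞ η → Function.Periodic η L →
      ∫ x in (0 : ℝ)..L, η x • (g - g') x = 0 := by
    intro η hη hp
    simp only [Pi.sub_apply, smul_sub]
    rw [intervalIntegral.integral_sub (hgi.continuousOn_smul hη.continuous.continuousOn)
      (hgi'.continuousOn_smul hη.continuous.continuousOn), sub_eq_zero, ← neg_inj,
      ← h η hη hp, ← h' η hη hp]
  obtain ⟨a, ha⟩ := ae_eq_const hL (hg.2.sub hg'.2) fun η hη hp =>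
    key (deriv η) ((contDiff_infty_iff_deriv.1 hη).2) fun x => by
      rw [← deriv_comp_add_const, show (fun x => η (x + L)) = η from funext hp]
  have h1 := key (fun _ => 1) contDiff_const (fun _ => rfl)
  rw [integral_congr_L2 (g := fun _ => a) (by
    filter_upwards [ha] with x hx
    rw [one_smul, hx]) ⟨hL.le, le_rfl⟩] at h1
  have ha0 : a = 0 := by simpa [hL.ne'] using h1
  filter_upwards [ha] with x hx
  rw [ha0] at hx
  simpa [sub_eq_zero] using hx

/-- Functions that agree a.e. have the same predicate `IsWeakDeriv`, so the choice in `weakDeriv`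
returns literally the same function, not just an a.e. equal one. -/
theorem weakDeriv_congr (hL : 0 < L) {f f' : ℝ → 𝕜} (h : f =ᵐ[volume.restrict (Ioc 0 L)] f') :
    weakDeriv L f = weakDeriv L f' := by
  have : IsWeakDeriv L f = IsWeakDeriv L f' := by
    funext g
    refine propext (forall_congr' fun η => ?_)
    have e : ∫ x in (0 : ℝ)..L, deriv η x • f x = ∫ x in (0 : ℝ)..L, deriv η x • f' x :=
      integral_congr_L2 (by filter_upwards [h] with x hx; rw [hx]) ⟨hL.le, le_rfl⟩
    rw [e]
  unfold weakDeriv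
  rw [this]

theorem toH_iterate_congr (hL : 0 < L) {f f' : ℝ → 𝕜} (h : f =ᵐ[volume.restrict (Ioc 0 L)] f')
    (k : ℕ) : toH L ((weakDeriv L)^[k] f) = toH L ((weakDeriv L)^[k] f') := by
  cases k with
  | zero => exact toH_congr h
  | succ k => rw [Function.iterate_succ_apply, Function.iterate_succ_apply, weakDeriv_congr hL h]

theorem weakDeriv_spec {f : ℝ → 𝕜} (h : ∃ g, MemL2 L g ∧ IsWeakDeriv L f g) :
    MemL2 L (weakDeriv L f) ∧ IsWeakDeriv L f (weakDeriv L f) := by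
  rw [weakDeriv, dif_pos h]
  exact h.choose_spec

theorem MemH.memL2 {m : ℕ} {f : ℝ → 𝕜} (h : MemH L m f) : MemL2 L f := by
  cases m with
  | zero => exact h
  | succ m => exact h.1

theorem MemL2.congr {f f' : ℝ → 𝕜} (hf : MemL2 L f) (hp : Function.Periodic f' L)
    (h : f =ᵐ[volume.restrict (Ioc 0 L)] f') : MemL2 L f' := ⟨hp, hf.2.ae_eq h⟩

theorem MemH.congr (hL : 0 < L) {m : ℕ} {f f' : ℝ → 𝕜} (hf : MemH L m f)
    (hp : Function.Periodic f' L) (h : f =ᵐ[volume.restrict (Ioc 0 L)] f') : MemH L m f' := by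
  cases m with
  | zero => exact MemL2.congr hf hp h
  | succ m =>
    obtain ⟨h1, g, hg, hm⟩ := hf
    refine ⟨h1.congr hp h, g, fun η hη hηp => ?_, hm⟩
    rw [← hg η hη hηp]
    exact integral_congr_L2 (by filter_upwards [h] with x hx; rw [hx]) ⟨hL.le, le_rfl⟩

/-- Uniqueness of weak derivatives transfers the regularity of the witness hidden in `MemH` to the
chosen `weakDeriv`. -/
theorem MemH.weakDeriv (hL : 0 < L) {m : ℕ} {f : ℝ → 𝕜} (h : MemH L (m + 1) f) :
    IsWeakDeriv L f (weakDeriv L f) ∧ MemH L m (LLE.weakDeriv L f) := by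
  obtain ⟨h1, g, hg, hm⟩ := h
  obtain ⟨h2, h3⟩ := weakDeriv_spec ⟨g, hm.memL2, hg⟩
  exact ⟨h3, hm.congr hL h2.1 (isWeakDeriv_unique hL hm.memL2 h2 hg h3)⟩

theorem MemH.exists_isH1 (hL : 0 < L) {m : ℕ} {f : ℝ → 𝕜} (h : MemH L (m + 1) f) :
    ∃ c : ℝ →ᵇ 𝕜, bc L c = toH L f ∧ IsH1 L c (toH L (LLE.weakDeriv L f)) :=
  exists_isH1_of_isWeakDeriv hL h.memL2 (h.weakDeriv hL).2.memL2 (h.weakDeriv hL).1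

theorem exists_memL2_eq (hL : 0 < L) (d : L2 L 𝕜) : ∃ g, MemL2 L g ∧ toH L g = d := by
  have hae : (fun x => d (toIocMod hL 0 x)) =ᵐ[volume.restrict (Ioc 0 L)] d := by
    filter_upwards [ae_restrict_mem measurableSet_Ioc] with x hx
    rw [(toIocMod_eq_self hL).2 (by rwa [zero_add])]
  have hm := (Lp.memLp d).ae_eq hae.symm
  exact ⟨fun x => d (toIocMod hL 0 x), ⟨fun x => by simp only [toIocMod_periodic hL 0 x], hm⟩,
    (toH_eq_iff hm).2 hae⟩

theorem IsH1.toH_weakDeriv (hL : 0 < L) {c : ℝ →ᵇ 𝕜} {d : L2 L 𝕜} (h : IsH1 L c d) {f : ℝ → 𝕜}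
    (hf : f =ᵐ[volume.restrict (Ioc 0 L)] c) :
    MemL2 L (LLE.weakDeriv L f) ∧ toH L (LLE.weakDeriv L f) = d := by
  obtain ⟨g, hg, rfl⟩ := exists_memL2_eq hL d
  have hw := h.isWeakDeriv hL hf (coeFn_toH hg.2).symm
  obtain ⟨h2, h3⟩ := weakDeriv_spec ⟨g, hg, hw⟩
  exact ⟨h2, toH_congr (isWeakDeriv_unique hL h2 hg h3 hw)⟩

/-! ### Sobolev norms in terms of classes in `L²(0, L)` -/

theorem isWeakDeriv_smul_add_smul (hL : 0 < L) (a b : ℝ) {f g f' g' : ℝ → 𝕜} (hf : MemL2 L f)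
    (hg : MemL2 L g) (hf' : MemL2 L f') (hg' : MemL2 L g') (h : IsWeakDeriv L f f')
    (h' : IsWeakDeriv L g g') : IsWeakDeriv L (a • f + b • g) (a • f' + b • g') := by
  intro η hη hp
  have hηc : ContinuousOn (deriv η) (uIcc 0 L) := (hη.continuous_deriv (by simp)).continuousOn
  have hηd : ContinuousOn η (uIcc 0 L) := hη.continuous.continuousOn
  have hi := fun {u : ℝ → 𝕜} (hu : MemL2 L u) => intervalIntegrable_of_memLp hL.le hu.2
  simp only [Pi.add_apply, Pi.smul_apply, smul_add]
  simp_rw [smul_comm _ a, smul_comm _ b]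
  have h1 := intervalIntegral.integral_add (((hi hf).continuousOn_smul hηc).smul a)
    (((hi hg).continuousOn_smul hηc).smul b)
  have h2 := intervalIntegral.integral_add (((hi hf').continuousOn_smul hηd).smul a)
    (((hi hg').continuousOn_smul hηd).smul b)
  simp only [Pi.smul_apply] at h1 h2
  rw [h1, h2]
  simp only [intervalIntegral.integral_smul, h η hη hp, h' η hη hp]
  simp only [smul_neg]
  abel

theorem MemL2.smul_add_smul (a b : ℝ) {f g : ℝ → 𝕜} (hf : MemL2 L f) (hg : MemL2 L g) :
    MemL2 L (a • f + b • g) ∧ toH L (a • f + b • g) = a • toH L f + b • toH L g := by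
  have hm : MemLp (a • f + b • g) 2 (volume.restrict (Ioc 0 L)) :=
    (hf.2.const_smul a).add (hg.2.const_smul b)
  refine ⟨⟨fun x => by simp [hf.1 x, hg.1 x], hm⟩, (toH_eq_iff hm).2 ?_⟩
  filter_upwards [Lp.coeFn_add (a • toH L f) (b • toH L g), Lp.coeFn_smul a (toH L f),
    Lp.coeFn_smul b (toH L g), coeFn_toH hf.2, coeFn_toH hg.2] with x h1 h2 h3 h4 h5
  rw [h1]
  simp [h2, h3, h4, h5]

/-- Since `weakDeriv` is a choice, it is linear only modulo null sets. Linearity is therefore stated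
for classes in L²(0, L), and the induction replaces representatives at each order. -/
theorem MemH.smul_add_smul (hL : 0 < L) (a b : ℝ) {m : ℕ} {f g : ℝ → 𝕜} (hf : MemH L m f)
    (hg : MemH L m g) : MemH L m (a • f + b • g) ∧ ∀ k ≤ m,
      toH L ((LLE.weakDeriv L)^[k] (a • f + b • g))
        = a • toH L ((LLE.weakDeriv L)^[k] f) + b • toH L ((LLE.weakDeriv L)^[k] g) := by
  induction m generalizing f g with
  | zero =>
    refine ⟨(MemL2.smul_add_smul a b hf hg).1, fun k hk => ?_⟩
    obtain rfl := Nat.le_zero.1 hk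
    exact (MemL2.smul_add_smul a b hf hg).2
  | succ m ih =>
    obtain ⟨f1, f2⟩ := hf.weakDeriv hL
    obtain ⟨g1, g2⟩ := hg.weakDeriv hL
    obtain ⟨i1, i2⟩ := ih f2 g2
    obtain ⟨j1, j2⟩ := MemL2.smul_add_smul a b hf.memL2 hg.memL2
    have hw := isWeakDeriv_smul_add_smul hL a b hf.memL2 hg.memL2 f2.memL2 g2.memL2 f1 g1
    refine ⟨⟨j1, _, hw, i1⟩, fun k hk => ?_⟩
    cases k with
    | zero => exact j2
    | succ k =>
      obtain ⟨w1, w2⟩ := weakDeriv_spec ⟨_, i1.memL2, hw⟩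
      simp only [Function.iterate_succ_apply]
      rw [toH_iterate_congr hL (isWeakDeriv_unique hL w1 i1.memL2 w2 hw) k]
      exact i2 k (by omega)

theorem MemH.iterate (hL : 0 < L) {m k : ℕ} {f : ℝ → 𝕜} (h : MemH L (m + k) f) :
    MemH L m ((LLE.weakDeriv L)^[k] f) := by
  induction k generalizing f with
  | zero => exact h
  | succ k ih => exact ih (MemH.weakDeriv hL (m := m + k) h).2

theorem integral_norm_sq_eq (hL : 0 < L) {f : ℝ → 𝕜} (hf : MemL2 L f) :
    ∫ x in (0 : ℝ)..L, ‖f x‖ ^ 2 = ‖toH L f‖ ^ 2 := by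
  rw [norm_sq_L2 hL.le]
  exact integral_congr_L2 (by filter_upwards [coeFn_toH hf.2] with x hx; rw [hx]) ⟨hL.le, le_rfl⟩

theorem MemH.normSqH_eq (hL : 0 < L) {m : ℕ} {f : ℝ → 𝕜} (h : MemH L m f) :
    normSqH L m f = ∑ k ∈ Finset.range (m + 1), ‖toH L ((LLE.weakDeriv L)^[k] f)‖ ^ 2 := by
  refine Finset.sum_congr rfl fun k hk => ?_
  obtain ⟨j, rfl⟩ := Nat.exists_eq_add_of_le' (Nat.le_of_lt_succ (Finset.mem_range.1 hk))
  exact integral_norm_sq_eq hL (h.iterate hL).memL2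

theorem normSqH_nonneg (hL : 0 < L) (m : ℕ) (f : ℝ → 𝕜) : 0 ≤ normSqH L m f :=
  Finset.sum_nonneg fun _ _ => intervalIntegral.integral_nonneg hL.le fun _ _ => by positivity

theorem normH_sq (hL : 0 < L) (m : ℕ) (f : ℝ → 𝕜) : normH L m f ^ 2 = normSqH L m f :=
  Real.sq_sqrt (normSqH_nonneg hL m f)

theorem MemH.norm_toH_le (hL : 0 < L) {m k : ℕ} (hk : k ≤ m) {f : ℝ → 𝕜} (h : MemH L m f) :
    ‖toH L ((LLE.weakDeriv L)^[k] f)‖ ≤ normH L m f := by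
  refine Real.le_sqrt_of_sq_le ?_
  rw [h.normSqH_eq hL]
  exact Finset.single_le_sum (f := fun k => ‖toH L ((LLE.weakDeriv L)^[k] f)‖ ^ 2)
    (fun _ _ => by positivity) (Finset.mem_range.2 (by omega))

theorem ContH.continuousOn (hL : 0 < L) {m k : ℕ} (hk : k ≤ m) {I : Set ℝ} {u : ℝ → ℝ → 𝕜}
    (h : ContH L m I u) : ContinuousOn (fun t => toH L ((weakDeriv L)^[k] (u t))) I := by
  intro t₀ ht₀
  rw [ContinuousWithinAt, tendsto_iff_norm_sub_tendsto_zero]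
  refine squeeze_zero' (Eventually.of_forall fun _ => norm_nonneg _) ?_ (h.2 t₀ ht₀)
  filter_upwards [self_mem_nhdsWithin] with t ht
  have h1 := (h.1 t ht).smul_add_smul hL 1 (-1) (h.1 t₀ ht₀)
  simp only [one_smul, neg_smul, ← sub_eq_add_neg] at h1
  rw [← h1.2 k hk]
  exact h1.1.norm_toH_le hL hk

/-- Turns the definition by Sobolev norms of difference quotients into an ordinary derivative of a
curve in the Hilbert space, one spatial order at a time. -/
theorem IsC1H.hasDerivWithinAt (hL : 0 < L) {m k : ℕ} (hk : k ≤ m) {I : Set ℝ}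
    {u u' : ℝ → ℝ → 𝕜} (h : IsC1H L m I u u') {t₀ : ℝ} (ht₀ : t₀ ∈ I) :
    HasDerivWithinAt (fun t => toH L ((weakDeriv L)^[k] (u t)))
      (toH L ((weakDeriv L)^[k] (u' t₀))) I t₀ := by
  rw [hasDerivWithinAt_iff_tendsto_slope, tendsto_iff_norm_sub_tendsto_zero]
  refine squeeze_zero' (Eventually.of_forall fun _ => norm_nonneg _) ?_ (h.2.2 t₀ ht₀)
  filter_upwards [self_mem_nhdsWithin] with t ht
  have h1 := (h.1.1 t ht.1).smul_add_smul hL 1 (-1) (h.1.1 t₀ ht₀)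
  have h2 := h1.1.smul_add_smul hL (t - t₀)⁻¹ (-1) (h.2.1.1 t₀ ht₀)
  simp only [one_smul, neg_smul, ← sub_eq_add_neg] at h1 h2
  rw [slope_def_module, ← h1.2 k hk, ← h2.2 k hk]
  exact h2.1.norm_toH_le hL hk

end

section

variable {L : ℝ}

/-! ### Differentiating the energy of the time derivative -/

theorem inner_I_smul_bmul_self {c : ℝ →ᵇ ℂ} (hc : star c = c) (f : L2 L ℂ) :
    ⟪f, Complex.I • bmul L c f⟫_ℝ = 0 := by
  have h1 := inner_I_smul_left f (bmul L c f)
  have h2 := inner_bmul_left c (Complex.I • f) f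
  rw [hc, map_smul, real_inner_comm, h1] at h2
  linarith

/-- The Lugiato-Lefever equation as an identity in `L²(0, L)` for the function `p` with second
derivative `P2` and time derivative `X`. -/
def IsEq (L α β : ℝ) (e : L2 L ℂ) (p : ℝ →ᵇ ℂ) (P2 X : L2 L ℂ) : Prop :=
  X = -(β • (Complex.I • P2)) - bc L p - α • (Complex.I • bc L p)
    + Complex.I • bc L (p * p * star p) + e

/-- Taken between two times of the same solution, this replaces the linearized equation for ψ_t: it
involves only differences of ψ, and the forcing cancels. -/
theorem IsEq.inner_sub_sub (hL : 0 ≤ L) {α β : ℝ} {e : L2 L ℂ} {a a1 b b1 : ℝ →ᵇ ℂ}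
    {A2 B2 A B : L2 L ℂ} (hA : IsEq L α β e a A2 A) (hB : IsEq L α β e b B2 B)
    (ha : IsH1 L a (bc L a1)) (ha1 : IsH1 L a1 A2) (hb : IsH1 L b (bc L b1)) (hb1 : IsH1 L b1 B2) :
    ⟪bc L a - bc L b, A - B⟫_ℝ = -‖bc L a - bc L b‖ ^ 2
      + ⟪bc L a - bc L b, Complex.I • bmul L ((a + b) * star a) (bc L a - bc L b)⟫_ℝ
      + ⟪bc L a - bc L b, Complex.I • bmul L (b * b) (conjL L (bc L a - bc L b))⟫_ℝ := by
  set D := bc L a - bc L b with hD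
  -- The splitting |a|²a − |b|²b = (a + b)ā (a − b) + b² conj(a − b). The first coefficient becomes
  -- the real function 2|ψ|² when both times merge.
  have hcub : bc L (a * a * star a) - bc L (b * b * star b)
      = bmul L ((a + b) * star a) D + bmul L (b * b) (conjL L D) := by
    simp only [hD, map_sub, conjL_bc, bmul_bc]
    simp only [← map_sub, ← map_add]
    congr 1
    ring
  have hAB : A - B = -(β • (Complex.I • (A2 - B2))) - D - α • (Complex.I • D)
      + Complex.I • bmul L ((a + b) * star a) D + Complex.I • bmul L (b * b) (conjL L D) := by
    rw [add_assoc _ (Complex.I • _), ← smul_add, ← hcub, hA, hB, hD]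
    simp only [smul_sub]
    abel
  -- Dispersion is skew: one integration by parts gives −⟨D_x, iD_x⟩ = 0.
  have h0 : ⟪D, Complex.I • (A2 - B2)⟫_ℝ = 0 := by
    have h1 := inner_deriv_eq_neg hL (ha.sub hL hb) ((ha1.sub hL hb1).smul hL Complex.I)
    rw [map_sub, ← hD, ← map_sub (bc L) a1 b1, map_smul, inner_I_smul_self] at h1
    linarith
  rw [hAB]
  simp only [inner_add_right, inner_sub_right, inner_neg_right, inner_smul_right_eq_smul, h0,
    inner_I_smul_self, real_inner_self_eq_norm_sq]
  simp

theorem bmul_real_smul (k : ℝ) (c : ℝ →ᵇ ℂ) (f : L2 L ℂ) :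
    bmul L c (k • f) = k • bmul L c f :=
  map_real_smul (bmul L c) (bmul L c).continuous k f

theorem IsEq.two_mul_inner_smul_sub_sub (hL : 0 ≤ L) {α β : ℝ} {e : L2 L ℂ} {a a1 b b1 : ℝ →ᵇ ℂ}
    {A2 B2 A B : L2 L ℂ} (hA : IsEq L α β e a A2 A) (hB : IsEq L α β e b B2 B)
    (ha : IsH1 L a (bc L a1)) (ha1 : IsH1 L a1 A2) (hb : IsH1 L b (bc L b1)) (hb1 : IsH1 L b1 B2)
    (k : ℝ) :
    2 * ⟪k • (bc L a - bc L b), k • (A - B)⟫_ℝ = -(2 * ‖k • (bc L a - bc L b)‖ ^ 2)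
      + 2 * ⟪k • (bc L a - bc L b),
          Complex.I • bmul L ((a + b) * star a) (k • (bc L a - bc L b))⟫_ℝ
      + 2 * ⟪k • (bc L a - bc L b),
          Complex.I • bmul L (b * b) (conjL L (k • (bc L a - bc L b)))⟫_ℝ := by
  have h := hA.inner_sub_sub hL hB ha ha1 hb hb1
  rw [map_smul (conjL L), bmul_real_smul, bmul_real_smul, smul_comm Complex.I k,
    smul_comm Complex.I k]
  simp only [real_inner_smul_left, real_inner_smul_right, h, norm_smul, mul_pow, Real.norm_eq_abs,
    sq_abs]
  ring

theorem tendsto_bmul {ι : Type*} {l : Filter ι} {c : ι → ℝ →ᵇ ℂ} {f : ι → L2 L ℂ} {c₀ : ℝ →ᵇ ℂ}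
    {f₀ : L2 L ℂ} (hc : Tendsto c l (𝓝 c₀)) (hf : Tendsto f l (𝓝 f₀)) :
    Tendsto (fun s => bmul L (c s) (f s)) l (𝓝 (bmul L c₀ f₀)) :=
  ((bmul (𝕜 := ℂ) L).continuous₂.tendsto (c₀, f₀)).comp (hc.prodMk_nhds hf)

theorem _root_.ContinuousOn.bmul {I : Set ℝ} {c : ℝ → ℝ →ᵇ ℂ} {f : ℝ → L2 L ℂ}
    (hc : ContinuousOn c I) (hf : ContinuousOn f I) :
    ContinuousOn (fun s => LLE.bmul L (c s) (f s)) I :=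
  fun t ht => tendsto_bmul (hc t ht) (hf t ht)

theorem timeInterval_mem_nhdsGE {τ : EReal} {t : ℝ} (ht : t ∈ timeInterval τ) :
    ∃ δ > 0, Icc t (t + 2 * δ) ⊆ timeInterval τ := by
  obtain ⟨q, hq1, hq2⟩ := EReal.lt_iff_exists_real_btwn.1 ht.2
  have hq : t < q := by exact_mod_cast hq1
  refine ⟨(q - t) / 2, by linarith, fun x hx => ⟨ht.1.trans hx.1, lt_of_le_of_lt ?_ hq2⟩⟩
  have : x ≤ q := by linarith [hx.2]
  exact_mod_cast this

theorem tendsto_add_nhdsGT (r : ℝ) : Tendsto (fun h => r + h) (𝓝[>] 0) (𝓝[>] r) := by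
  refine tendsto_nhdsWithin_iff.2 ⟨?_, ?_⟩
  · have : Tendsto (fun h => r + h) (𝓝 0) (𝓝 (r + 0)) := by
      exact (continuous_const.add continuous_id).tendsto 0
    rw [add_zero] at this
    exact this.mono_left nhdsWithin_le_nhds
  · filter_upwards [self_mem_nhdsWithin] with h hh
    simpa using hh

theorem mem_nhdsGT_timeInterval {τ : EReal} {t : ℝ} (ht : t ∈ timeInterval τ) :
    timeInterval τ ∈ 𝓝[>] t := by
  obtain ⟨δ, hδ, hsub⟩ := timeInterval_mem_nhdsGE ht
  exact mem_of_superset (Ioc_mem_nhdsGT (by linarith)) (Ioc_subset_Icc_self.trans hsub)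

theorem HasDerivWithinAt.tendsto_diffQuot {E : Type*} [NormedAddCommGroup E] [NormedSpace ℝ E]
    {τ : EReal} {f : ℝ → E} {f' : E} {r : ℝ} (hr : r ∈ timeInterval τ)
    (h : HasDerivWithinAt f f' (timeInterval τ) r) :
    Tendsto (fun h => h⁻¹ • (f (r + h) - f r)) (𝓝[>] 0) (𝓝 f') := by
  have h1 : HasDerivWithinAt f f' (Ioi r) r := h.mono_of_mem_nhdsWithin (mem_nhdsGT_timeInterval hr)
  rw [hasDerivWithinAt_iff_tendsto_slope' (by simp)] at h1
  refine (h1.comp (tendsto_add_nhdsGT r)).congr fun h => ?_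
  simp [slope_def_module]

theorem ContinuousWithinAt.tendsto_add {E : Type*} [TopologicalSpace E]
    {τ : EReal} {f : ℝ → E} {r : ℝ} (hr : r ∈ timeInterval τ)
    (h : ContinuousWithinAt f (timeInterval τ) r) :
    Tendsto (fun h => f (r + h)) (𝓝[>] 0) (𝓝 (f r)) := by
  have h1 : ContinuousWithinAt f (Ioi r) r := h.mono_of_mem_nhdsWithin (mem_nhdsGT_timeInterval hr)
  exact Tendsto.comp h1 (tendsto_add_nhdsGT r)

/-- Mean value inequality; it supplies the domination, uniform in h. The interval of length 2δ
leaves room for the shift by h < δ. -/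
theorem norm_diffQuot_le {E : Type*} [NormedAddCommGroup E] [NormedSpace ℝ E] {I : Set ℝ}
    {P X : ℝ → E} (hd : ∀ t ∈ I, HasDerivWithinAt P (X t) I t) {t δ M : ℝ}
    (hsub : Icc t (t + 2 * δ) ⊆ I) (hM : ∀ r ∈ Icc t (t + 2 * δ), ‖X r‖ ≤ M) {h : ℝ}
    (hh : h ∈ Ioo 0 δ) {r : ℝ} (hr : r ∈ Icc t (t + δ)) :
    ‖h⁻¹ • (P (r + h) - P r)‖ ≤ M := by
  have := (convex_Icc t (t + 2 * δ)).norm_image_sub_le_of_norm_hasDerivWithin_le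
    (f := P) (f' := X) (C := M) (fun x hx => (hd x (hsub hx)).mono hsub) hM
    (x := r) (y := r + h) ⟨hr.1, by linarith [hr.2, hh.1, hh.2]⟩
    ⟨by linarith [hr.1, hh.1], by linarith [hr.2, hh.2]⟩
  simp only [add_sub_cancel_left, Real.norm_eq_abs, abs_of_pos hh.1] at this
  rw [norm_smul, norm_inv, Real.norm_eq_abs, abs_of_pos hh.1, inv_mul_le_iff₀ hh.1, mul_comm h]
  exact this

/-- The derivative of `‖X‖²`, where `X` is the derivative of `P`, can be computed from difference
quotients of `P`; differentiability of `X` is not needed. -/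
theorem hasDerivWithinAt_norm_sq_of_diffQuot {E : Type*} [NormedAddCommGroup E]
    [InnerProductSpace ℝ E] {τ : EReal} {P X : ℝ → E} {F : ℝ → ℝ}
    (hX : ContinuousOn X (timeInterval τ))
    (hd : ∀ t ∈ timeInterval τ, HasDerivWithinAt P (X t) (timeInterval τ) t)
    (hF : ContinuousOn F (timeInterval τ)) {t δ K : ℝ} (hδ : 0 < δ)
    (hsub : Icc t (t + 2 * δ) ⊆ timeInterval τ)
    (hbound : ∀ h ∈ Ioo 0 δ, ∀ r ∈ Icc t (t + δ),
      |2 * ⟪h⁻¹ • (P (r + h) - P r), h⁻¹ • (X (r + h) - X r)⟫_ℝ| ≤ K)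
    (hlim : ∀ r ∈ Icc t (t + δ), Tendsto
      (fun h => 2 * ⟪h⁻¹ • (P (r + h) - P r), h⁻¹ • (X (r + h) - X r)⟫_ℝ) (𝓝[>] 0) (𝓝 (F r))) :
    HasDerivWithinAt (fun t => ‖X t‖ ^ 2) (F t) (Ioi t) t := by
  have hsub1 : Icc t (t + δ) ⊆ timeInterval τ := (Icc_subset_Icc_right (by linarith)).trans hsub
  have hshift : ∀ h ∈ Ioo 0 δ, MapsTo (fun r => r + h) (Icc t (t + δ)) (timeInterval τ) :=
    fun h hh r hr => hsub ⟨by linarith [hr.1, hh.1], by linarith [hr.2, hh.2]⟩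
  set Y : ℝ → ℝ → E := fun h r => h⁻¹ • (P (r + h) - P r)
  set Y' : ℝ → ℝ → E := fun h r => h⁻¹ • (X (r + h) - X r)
  have hPc : ContinuousOn P (timeInterval τ) := fun r hr => (hd r hr).continuousWithinAt
  have hYc : ∀ h ∈ Ioo 0 δ, ContinuousOn (Y h) (Icc t (t + δ)) := fun h hh =>
    ((hPc.comp (by fun_prop) (hshift h hh)).sub (hPc.mono hsub1)).const_smul h⁻¹
  have hY'c : ∀ h ∈ Ioo 0 δ, ContinuousOn (Y' h) (Icc t (t + δ)) := fun h hh =>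
    ((hX.comp (by fun_prop) (hshift h hh)).sub (hX.mono hsub1)).const_smul h⁻¹
  have hPd : ∀ r ∈ Ioo t (t + 2 * δ), HasDerivAt P (X r) r := fun r hr =>
    (hd r (hsub ⟨hr.1.le, hr.2.le⟩)).hasDerivAt
      (mem_of_superset (Icc_mem_nhds hr.1 hr.2) hsub)
  have hYd : ∀ h ∈ Ioo 0 δ, ∀ r ∈ Ioo t (t + δ), HasDerivAt (Y h) (Y' h r) r := by
    intro h hh r hr
    have h1 := hPd (r + h) ⟨by linarith [hr.1, hh.1], by linarith [hr.2, hh.2]⟩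
    have h2 := hPd r ⟨hr.1, by linarith [hr.2]⟩
    exact ((h1.comp_add_const r h).sub h2).const_smul h⁻¹
  have hYlim : ∀ r ∈ Icc t (t + δ), Tendsto (fun h => Y h r) (𝓝[>] 0) (𝓝 (X r)) := fun r hr =>
    HasDerivWithinAt.tendsto_diffQuot (hsub1 hr) (hd r (hsub1 hr))
  have hmem : ∀ᶠ h in 𝓝[>] (0 : ℝ), h ∈ Ioo 0 δ := Ioo_mem_nhdsGT hδ
  -- The fundamental theorem of calculus is applied to the squared norm of the difference quotient,
  -- which is differentiable in time. Letting h → 0 by dominated convergence gives the integrated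
  -- identity for ‖X‖²; continuity of F then permits differentiation at t.
  have key : ∀ b ∈ Icc t (t + δ), ∫ r in t..b, F r = ‖X b‖ ^ 2 - ‖X t‖ ^ 2 := by
    intro b hb
    have hsubb : Icc t b ⊆ Icc t (t + δ) := Icc_subset_Icc_right hb.2
    have htb : uIoc t b ⊆ Icc t (t + δ) := by
      rw [uIoc_of_le hb.1]
      exact Ioc_subset_Icc_self.trans hsubb
    have htI : t ∈ Icc t (t + δ) := ⟨le_rfl, by linarith⟩
    have hcont : ∀ h ∈ Ioo 0 δ, ContinuousOn (fun r => 2 * ⟪Y h r, Y' h r⟫_ℝ) (Icc t (t + δ)) :=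
      fun h hh => continuousOn_const.mul ((hYc h hh).inner (𝕜 := ℝ) (hY'c h hh))
    have h1 : Tendsto (fun h => ∫ r in t..b, 2 * ⟪Y h r, Y' h r⟫_ℝ) (𝓝[>] 0)
        (𝓝 (‖X b‖ ^ 2 - ‖X t‖ ^ 2)) := by
      refine Tendsto.congr' ?_ (((hYlim b hb).norm.pow 2).sub ((hYlim t htI).norm.pow 2))
      filter_upwards [hmem] with h hh
      symm
      refine intervalIntegral.integral_eq_sub_of_hasDerivAt_of_le (f := fun r => ‖Y h r‖ ^ 2) hb.1
        (((hYc h hh).mono hsubb).norm.pow 2)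
        (fun r hr => (hYd h hh r ⟨hr.1, hr.2.trans_le hb.2⟩).norm_sq) ?_
      exact ((hcont h hh).mono hsubb).intervalIntegrable_of_Icc hb.1
    refine tendsto_nhds_unique ?_ h1
    refine intervalIntegral.tendsto_integral_filter_of_dominated_convergence
      (fun _ => K) ?_ ?_ (by simp) ?_
    · filter_upwards [hmem] with h hh
      exact ((hcont h hh).mono htb).aestronglyMeasurable measurableSet_uIoc
    · filter_upwards [hmem] with h hh
      exact Eventually.of_forall fun r hr => hbound h hh r (htb hr)
    · exact Eventually.of_forall fun r hr => hlim r (htb hr)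
  have hFTC : HasDerivWithinAt (fun b => ∫ r in t..b, F r) (F t) (Ici t) t := by
    have hFc := hF.mono hsub1
    have hmem : Icc t (t + δ) ∈ 𝓝[>] t :=
      mem_of_superset (Ioc_mem_nhdsGT (by linarith)) Ioc_subset_Icc_self
    have hcw : ContinuousWithinAt F (Ioi t) t :=
      (hFc t ⟨le_rfl, by linarith⟩).mono_of_mem_nhdsWithin hmem
    have hmeas : StronglyMeasurableAtFilter F (𝓝[>] t) volume :=
      ⟨Icc t (t + δ), hmem, hFc.aestronglyMeasurable measurableSet_Icc⟩
    exact intervalIntegral.integral_hasDerivWithinAt_right (by simp) hmeas hcw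
  refine ((hFTC.mono Ioi_subset_Ici_self).add_const (‖X t‖ ^ 2)).congr_of_eventuallyEq ?_ (by simp)
  filter_upwards [Ioc_mem_nhdsGT (show t < t + δ by linarith)] with b hb
  rw [key b (Ioc_subset_Icc_self hb)]
  ring

theorem abs_inner_I_smul_bmul_le (c : ℝ →ᵇ ℂ) (f g : L2 L ℂ) :
    |⟪f, Complex.I • bmul L c g⟫_ℝ| ≤ ‖f‖ * (‖c‖ * ‖g‖) := by
  refine (abs_real_inner_le_norm _ _).trans ?_
  rw [norm_smul, Complex.norm_I, one_mul]
  gcongr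
  exact norm_bmul_le c g

/-- Evolution of `‖ψ_t‖²` along classical solutions. As `ψ_t` need not be differentiable in time,
this does not follow by differentiating the equation. -/
theorem hasDerivWithinAt_norm_sq_timeDeriv (hL : 0 ≤ L) {α β : ℝ} {e : L2 L ℂ} {τ : EReal}
    {p p1 : ℝ → ℝ →ᵇ ℂ} {P2 X : ℝ → L2 L ℂ} (hp : ContinuousOn p (timeInterval τ))
    (hX : ContinuousOn X (timeInterval τ))
    (hH1 : ∀ t ∈ timeInterval τ, IsH1 L (p t) (bc L (p1 t)))
    (hH2 : ∀ t ∈ timeInterval τ, IsH1 L (p1 t) (P2 t))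
    (hd : ∀ t ∈ timeInterval τ, HasDerivWithinAt (fun t => bc L (p t)) (X t) (timeInterval τ) t)
    (heq : ∀ t ∈ timeInterval τ, IsEq L α β e (p t) (P2 t) (X t)) {t : ℝ}
    (ht : t ∈ timeInterval τ) :
    HasDerivWithinAt (fun t => ‖X t‖ ^ 2)
      (-(2 * ‖X t‖ ^ 2) + 2 * ⟪X t, Complex.I • bmul L (p t * p t) (conjL L (X t))⟫_ℝ)
      (Ioi t) t := by
  obtain ⟨δ, hδ, hsub⟩ := timeInterval_mem_nhdsGE ht
  have hsub1 : Icc t (t + δ) ⊆ timeInterval τ := (Icc_subset_Icc_right (by linarith)).trans hsub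
  have hshift : ∀ h ∈ Ioo 0 δ, ∀ r ∈ Icc t (t + δ), r + h ∈ Icc t (t + 2 * δ) := fun h hh r hr =>
    ⟨by linarith [hr.1, hh.1], by linarith [hr.2, hh.2]⟩
  obtain ⟨MX, hMX⟩ := (isCompact_Icc (a := t) (b := t + 2 * δ)).exists_bound_of_continuousOn
    (hX.mono hsub)
  obtain ⟨Mp, hMp⟩ := (isCompact_Icc (a := t) (b := t + 2 * δ)).exists_bound_of_continuousOn
    (hp.mono hsub)
  have hMX0 : 0 ≤ MX := (norm_nonneg _).trans (hMX t ⟨le_rfl, by linarith⟩)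
  have hMp0 : 0 ≤ Mp := (norm_nonneg _).trans (hMp t ⟨le_rfl, by linarith⟩)
  have hid : ∀ h ∈ Ioo 0 δ, ∀ r ∈ Icc t (t + δ), _ := fun h hh r hr =>
    (heq _ (hsub (hshift h hh r hr))).two_mul_inner_smul_sub_sub hL (heq _ (hsub1 hr))
      (hH1 _ (hsub (hshift h hh r hr))) (hH2 _ (hsub (hshift h hh r hr))) (hH1 _ (hsub1 hr))
      (hH2 _ (hsub1 hr)) h⁻¹
  refine hasDerivWithinAt_norm_sq_of_diffQuot
    (K := 2 * MX ^ 2 + 2 * ((Mp + Mp) * Mp * MX ^ 2) + 2 * (Mp * Mp * MX ^ 2))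
    (F := fun t => -(2 * ‖X t‖ ^ 2)
      + 2 * ⟪X t, Complex.I • bmul L (p t * p t) (conjL L (X t))⟫_ℝ)
    hX hd ?_ hδ hsub ?_ ?_
  · exact (continuousOn_const.mul (hX.norm.pow 2)).neg.add (continuousOn_const.mul
      (hX.inner (𝕜 := ℝ) (((hp.mul hp).bmul ((conjL L).continuous.comp_continuousOn hX)).const_smul
        Complex.I)))
  · intro h hh r hr
    rw [hid h hh r hr]
    have hy := norm_diffQuot_le hd hsub hMX hh hr
    set Y := h⁻¹ • (bc L (p (r + h)) - bc L (p r))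
    have hpr := hMp r (Icc_subset_Icc_right (by linarith) hr)
    have hprh := hMp (r + h) (hshift h hh r hr)
    have i1 : |⟪Y, Complex.I • bmul L ((p (r + h) + p r) * star (p (r + h))) Y⟫_ℝ|
        ≤ (Mp + Mp) * Mp * MX ^ 2 := by
      refine (abs_inner_I_smul_bmul_le _ _ _).trans ?_
      have : ‖(p (r + h) + p r) * star (p (r + h))‖ ≤ (Mp + Mp) * Mp := by
        refine (norm_mul_le _ _).trans ?_
        rw [norm_star]
        gcongr
        exact (norm_add_le _ _).trans (by gcongr)
      calc _ ≤ MX * ((Mp + Mp) * Mp * MX) := by gcongr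
        _ = _ := by ring
    have i2 : |⟪Y, Complex.I • bmul L (p r * p r) (conjL L Y)⟫_ℝ| ≤ Mp * Mp * MX ^ 2 := by
      refine (abs_inner_I_smul_bmul_le _ _ _).trans ?_
      rw [norm_conjL]
      have : ‖p r * p r‖ ≤ Mp * Mp := (norm_mul_le _ _).trans (by gcongr)
      calc _ ≤ MX * (Mp * Mp * MX) := by gcongr
        _ = _ := by ring
    have i3 : ‖Y‖ ^ 2 ≤ MX ^ 2 := by gcongr
    have i4 : 0 ≤ ‖Y‖ ^ 2 := by positivity
    rw [abs_le] at i1 i2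
    rw [abs_le]
    constructor <;> linarith [i1.1, i1.2, i2.1, i2.2]
  · intro r hr
    have hrI := hsub1 hr
    have l1 := HasDerivWithinAt.tendsto_diffQuot hrI (hd r hrI)
    have l2 : Tendsto (fun h => p (r + h)) (𝓝[>] 0) (𝓝 (p r)) :=
      ContinuousWithinAt.tendsto_add hrI (hp r hrI)
    have c1 : Tendsto (fun h => (p (r + h) + p r) * star (p (r + h))) (𝓝[>] 0)
        (𝓝 ((p r + p r) * star (p r))) := (l2.add_const _).mul ((continuous_star.tendsto _).comp l2)
    have b1 := tendsto_bmul c1 l1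
    have b2 := tendsto_bmul (tendsto_const_nhds (x := p r * p r))
      (((conjL L).continuous.tendsto _).comp l1)
    have l3 := (((l1.norm.pow 2).const_mul 2).neg.add
      ((l1.inner (𝕜 := ℝ) (b1.const_smul Complex.I)).const_mul 2)).add
      ((l1.inner (𝕜 := ℝ) (b2.const_smul Complex.I)).const_mul 2)
    -- In the limit the first coefficient is the real function 2|ψ|², so its contribution vanishes.
    rw [inner_I_smul_bmul_self (by rw [star_mul, star_star, star_add]; ring), mul_zero, add_zero] at l3
    refine l3.congr' ?_
    filter_upwards [Ioo_mem_nhdsGT hδ] with h hh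
    exact (hid h hh r hr).symm

/-- Evolution of the quadratic form `Re ∫ ψ² (v̄_x)²`, again without differentiating `v_x` in
time. -/
theorem hasDerivWithinAt_inner_bmul_sq (hL : 0 ≤ L) {I : Set ℝ} {p p1 v w : ℝ → ℝ →ᵇ ℂ}
    {V2 : ℝ → L2 L ℂ} (hp : ContinuousOn p I) (hw : ContinuousOn w I) (hV2 : ContinuousOn V2 I)
    (hp1 : ∀ t ∈ I, IsH1 L (p t) (bc L (p1 t))) (hv : ∀ t ∈ I, IsH1 L (v t) (bc L (w t)))
    (hw' : ∀ t ∈ I, IsH1 L (w t) (V2 t)) {t : ℝ} (ht : t ∈ I) {X Vt : L2 L ℂ}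
    (hdp : HasDerivWithinAt (fun t => bc L (p t)) X I t)
    (hdv : HasDerivWithinAt (fun t => bc L (v t)) Vt I t) :
    HasDerivWithinAt (fun t => ⟪bc L (w t), bmul L (p t * p t) (conjL L (bc L (w t)))⟫_ℝ)
      (⟪bc L (w t), bmul L ((p t + p t) * star (w t)) X⟫_ℝ
        - ⟪Vt, bmul L (p t * p t) (conjL L (V2 t + V2 t))
          + bmul L (star (w t + w t)) (bmul L (p t) (bc L (p1 t)) + bmul L (p t) (bc L (p1 t)))⟫_ℝ)
      I t := by
  rw [hasDerivWithinAt_iff_tendsto_slope] at hdp hdv ⊢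
  have hle : 𝓝[I \ {t}] t ≤ 𝓝[I] t := nhdsWithin_mono _ sdiff_subset
  have lp : Tendsto p (𝓝[I \ {t}] t) (𝓝 (p t)) := (hp t ht).mono_left hle
  have lw : Tendsto w (𝓝[I \ {t}] t) (𝓝 (w t)) := (hw t ht).mono_left hle
  have lV : Tendsto V2 (𝓝[I \ {t}] t) (𝓝 (V2 t)) := (hV2 t ht).mono_left hle
  have m1 := tendsto_bmul ((lp.add_const (p t)).mul ((continuous_star.tendsto _).comp lw)) hdp
  have m2 := tendsto_bmul (tendsto_const_nhds (x := p t * p t))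
    (((conjL L).continuous.tendsto _).comp (lV.add_const (V2 t)))
  have m3 := tendsto_bmul ((continuous_star.tendsto _).comp (lw.add_const (w t)))
    (tendsto_const_nhds (x := bmul L (p t) (bc L (p1 t)) + bmul L (p t) (bc L (p1 t))))
  refine Tendsto.congr' ?_ (((((bc L).continuous.tendsto _).comp lw).inner (𝕜 := ℝ) m1).sub
    (hdv.inner (𝕜 := ℝ) (m2.add m3)))
  filter_upwards [self_mem_nhdsWithin] with s hs
  have hvs := (hv s hs.1).sub hL (hv t ht)
  rw [← map_sub] at hvs
  -- By symmetry, the form at s minus the form at t is its change through ψ, plus ⟨w_s − w_t, ψ_t²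
  -- conj(w_s + w_t)⟩, where the index denotes the time. Integration by parts moves the spatial
  -- derivative off w_s − w_t = (v_s − v_t)_x, so only difference quotients of ψ and v in L² remain.
  have hI := inner_deriv_eq_neg hL hvs
    (((hp1 t ht).mul hL (hp1 t ht)).mul hL ((hw' s hs.1).add hL (hw' t ht)).star)
  have h1 : bmul L ((p s + p t) * star (w s)) (bc L (p s) - bc L (p t))
      = bmul L (p s * p s) (conjL L (bc L (w s))) - bmul L (p t * p t) (conjL L (bc L (w s))) := by
    rw [← map_sub, conjL_bc, bmul_bc, bmul_bc, bmul_bc, ← map_sub]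
    congr 1
    ring
  have h2 : bc L (p t * p t * star (w s + w t))
      = bmul L (p t * p t) (conjL L (bc L (w s))) + bmul L (p t * p t) (conjL L (bc L (w t))) := by
    rw [conjL_bc, conjL_bc, bmul_bc, bmul_bc, ← map_add, star_add, mul_add]
  simp only [slope_def_module, Function.comp_apply, bmul_real_smul, real_inner_smul_left,
    real_inner_smul_right, smul_eq_mul]
  rw [← mul_sub, h1, ← map_sub (bc L) (v s) (v t)]
  rw [h2, map_sub, inner_sub_left, inner_add_right, inner_add_right,
    inner_bmul_conjL_comm (p t * p t) (bc L (w t)) (bc L (w s))] at hI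
  rw [inner_sub_right, ← neg_eq_iff_eq_neg.2 hI]
  congr 1
  ring

end

section

variable {L : ℝ}

/-! ### Convergence in the supremum norm -/

/-- Sobolev's inequality applied to differences: continuity in time with values in H¹ is continuity
in the supremum norm. -/
theorem IsH1.continuousOn {𝕜 : Type*} [RCLike 𝕜] {T : ℝ} (hT : 0 < T) (hTL : T ≤ L) {I : Set ℝ}
    {c : ℝ → ℝ →ᵇ 𝕜} {d : ℝ → L2 L 𝕜} (h : ∀ t ∈ I, IsH1 L (c t) (d t))
    (hc : ContinuousOn (fun t => bc L (c t)) I) (hd : ContinuousOn d I) : ContinuousOn c I := by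
  have hL : 0 ≤ L := hT.le.trans hTL
  intro t ht
  have h1 := tendsto_iff_norm_sub_tendsto_zero.1 (hc t ht)
  have h2 := tendsto_iff_norm_sub_tendsto_zero.1 (hd t ht)
  rw [ContinuousWithinAt, tendsto_iff_norm_sub_tendsto_zero]
  refine squeeze_zero' (Eventually.of_forall fun _ => norm_nonneg _) ?_
    (by simpa using (h1.const_mul (√T)⁻¹).add (h2.const_mul √T))
  filter_upwards [self_mem_nhdsWithin] with s hs
  have := ((h s hs).sub hL (h t ht)).norm_le hT hTL
  rwa [map_sub] at this

theorem IsH1.hasDerivWithinAt {T : ℝ} (hT : 0 < T) (hTL : T ≤ L) {I : Set ℝ}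
    {c : ℝ → ℝ →ᵇ ℝ} {d : ℝ → L2 L ℝ} {c' : ℝ →ᵇ ℝ} {d' : L2 L ℝ} {t : ℝ} (ht : t ∈ I)
    (h : ∀ t ∈ I, IsH1 L (c t) (d t)) (h' : IsH1 L c' d')
    (hc : HasDerivWithinAt (fun t => bc L (c t)) (bc L c') I t)
    (hd : HasDerivWithinAt d d' I t) : HasDerivWithinAt c c' I t := by
  have hL : 0 ≤ L := hT.le.trans hTL
  rw [hasDerivWithinAt_iff_tendsto_slope, tendsto_iff_norm_sub_tendsto_zero] at hc hd ⊢
  refine squeeze_zero' (Eventually.of_forall fun _ => norm_nonneg _) ?_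
    (by simpa using (hc.const_mul (√T)⁻¹).add (hd.const_mul √T))
  filter_upwards [self_mem_nhdsWithin] with s hs
  have := ((((h s hs.1).sub hL (h t ht)).smul hL (s - t)⁻¹).sub hL h').norm_le hT hTL
  simp only [map_sub, map_smul] at this
  simpa only [slope_def_module] using this

/-! ### Composition with a modulated argument -/

/-- The bounded continuous function `x ↦ f (x + q x)`. -/
def shiftComp (f : ℝ →ᵇ ℂ) (q : ℝ →ᵇ ℝ) : ℝ →ᵇ ℂ :=
  f.compContinuous ⟨fun x => x + q x, by fun_prop⟩

@[simp] theorem shiftComp_apply (f : ℝ →ᵇ ℂ) (q : ℝ →ᵇ ℝ) (x : ℝ) :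
    shiftComp f q x = f (x + q x) := rfl

theorem norm_shiftComp_le (f : ℝ →ᵇ ℂ) (q : ℝ →ᵇ ℝ) : ‖shiftComp f q‖ ≤ ‖f‖ :=
  (BoundedContinuousFunction.norm_le (norm_nonneg _)).2 fun _ => f.norm_coe_le_norm _

/-- The complexification of a real-valued function. -/
def toComplex : (ℝ →ᵇ ℝ) →L[ℝ] (ℝ →ᵇ ℂ) :=
  Complex.ofRealCLM.compLeftContinuousBounded ℝ

@[simp] theorem toComplex_apply (q : ℝ →ᵇ ℝ) (x : ℝ) : toComplex q x = q x := rfl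

theorem norm_toComplex_le (q : ℝ →ᵇ ℝ) : ‖toComplex q‖ ≤ ‖q‖ :=
  (BoundedContinuousFunction.norm_le (norm_nonneg _)).2 fun x => by
    rw [toComplex_apply, Complex.norm_real]
    exact q.norm_coe_le_norm x

theorem norm_bc_toComplex (hL : 0 ≤ L) (q : ℝ →ᵇ ℝ) : ‖bc L (toComplex q)‖ = ‖bc L q‖ := by
  rw [← sq_eq_sq₀ (norm_nonneg _) (norm_nonneg _), norm_sq_bc hL, norm_sq_bc hL]
  simp

theorem norm_sub_le_of_hasDerivAt {f f' : ℝ →ᵇ ℂ} (h : ∀ x, HasDerivAt f (f' x) x) (x y : ℝ) :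
    ‖f y - f x‖ ≤ ‖f'‖ * |y - x| :=
  convex_univ.norm_image_sub_le_of_norm_hasDerivWithin_le
    (fun z _ => (h z).hasDerivWithinAt) (fun z _ => f'.norm_coe_le_norm z) (mem_univ x) (mem_univ y)

theorem norm_sub_sub_le_of_hasDerivAt {f f' f'' : ℝ →ᵇ ℂ} (h : ∀ x, HasDerivAt f (f' x) x)
    (h' : ∀ x, HasDerivAt f' (f'' x) x) (x y : ℝ) :
    ‖f y - f x - f' x * ((y - x : ℝ) : ℂ)‖ ≤ ‖f''‖ * |y - x| * |y - x| := by
  have h1 : ∀ z, HasDerivAt (fun z => f z - f' x * (z : ℂ)) (f' z - f' x * 1) z := fun z =>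
    (h z).sub ((Complex.ofRealCLM.hasDerivAt (x := z)).const_mul (f' x))
  have := (convex_uIcc x y).norm_image_sub_le_of_norm_hasDerivWithin_le
    (C := ‖f''‖ * |y - x|) (fun z _ => (h1 z).hasDerivWithinAt) (fun z hz => by
      rw [mul_one]
      refine (norm_sub_le_of_hasDerivAt h' x z).trans ?_
      exact mul_le_mul_of_nonneg_left (abs_sub_left_of_mem_uIcc hz) (norm_nonneg _)) left_mem_uIcc right_mem_uIcc
  refine le_trans (le_of_eq ?_) this
  congr 1
  push_cast
  ring

theorem continuous_shiftComp {f f' : ℝ →ᵇ ℂ} (h : ∀ x, HasDerivAt f (f' x) x) :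
    Continuous (shiftComp f) := by
  refine (LipschitzWith.of_dist_le_mul (K := ‖f'‖₊) fun q q' => ?_).continuous
  rw [dist_eq_norm, dist_eq_norm]
  refine (BoundedContinuousFunction.norm_le (by positivity)).2 fun x => ?_
  rw [BoundedContinuousFunction.sub_apply, shiftComp_apply, shiftComp_apply]
  refine (norm_sub_le_of_hasDerivAt h _ _).trans ?_
  rw [coe_nnnorm, add_sub_add_left_eq_sub]
  gcongr
  exact (q - q').norm_coe_le_norm x

/-- The Taylor remainder is at most ‖f''‖ ‖e‖² uniformly in x. Working in the supremum norm makes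
superposition differentiable, and the chain rule then gives the time derivative of the modulated
wave. -/
theorem hasFDerivAt_shiftComp {f f' f'' : ℝ →ᵇ ℂ} (h : ∀ x, HasDerivAt f (f' x) x)
    (h' : ∀ x, HasDerivAt f' (f'' x) x) (q : ℝ →ᵇ ℝ) :
    HasFDerivAt (shiftComp f)
      ((ContinuousLinearMap.mul ℝ (ℝ →ᵇ ℂ) (shiftComp f' q)).comp toComplex) q := by
  rw [hasFDerivAt_iff_isLittleO_nhds_zero]
  refine Asymptotics.IsBigO.trans_isLittleO (g := fun e : ℝ →ᵇ ℝ => ‖e‖ ^ 2) ?_ ?_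
  · refine Asymptotics.IsBigO.of_bound ‖f''‖ (Eventually.of_forall fun e => ?_)
    refine (BoundedContinuousFunction.norm_le (by positivity)).2 fun x => ?_
    have h1 := norm_sub_sub_le_of_hasDerivAt h h' (x + q x) (x + (q + e) x)
    have h2 : x + (q + e) x - (x + q x) = e x := by
      rw [BoundedContinuousFunction.add_apply]; ring
    rw [h2] at h1
    refine (le_of_eq ?_).trans (h1.trans ?_)
    · rfl
    · have := e.norm_coe_le_norm x
      rw [Real.norm_eq_abs] at this
      rw [norm_pow, norm_norm, mul_assoc, sq]
      gcongr
  · refine Asymptotics.IsLittleO.of_norm_right ?_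
    exact Asymptotics.isLittleO_norm_right.2 (Asymptotics.isLittleO_norm_pow_id one_lt_two)

theorem IsH1.hasDerivAt {c c' : ℝ →ᵇ ℝ} (h : IsH1 L c (bc L c')) {x : ℝ} (hx : x ∈ Ioo 0 L) :
    HasDerivAt c (c' x) x := by
  have h1 : HasDerivAt (fun y => c 0 + ∫ s in (0 : ℝ)..y, c' s) (c' x) x :=
    (intervalIntegral.integral_hasDerivAt_right (c'.continuous.intervalIntegrable _ _)
      (c'.continuous.stronglyMeasurableAtFilter _ _) c'.continuous.continuousAt).const_add _
  refine h1.congr_of_eventuallyEq ?_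
  filter_upwards [Ioo_mem_nhds hx.1 hx.2] with y hy
  rw [h.2 y ⟨hy.1.le, hy.2.le⟩, integral_congr_L2 (coeFn_bc c') ⟨hy.1.le, hy.2.le⟩]

theorem periodic_shiftComp {f : ℝ →ᵇ ℂ} {q : ℝ →ᵇ ℝ} (hf : Function.Periodic f L)
    (hq : Function.Periodic q L) : Function.Periodic (shiftComp f q) L := fun x => by
  rw [shiftComp_apply, shiftComp_apply, hq x, add_right_comm, hf]

section modulation

variable {f0 f1 f2 : ℝ →ᵇ ℂ} {q g1 g2 : ℝ →ᵇ ℝ}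

/-- The derivative of `f0 (x + q x)`, where `f1` and `g1` are the derivatives of `f0` and `q`. -/
def shiftDeriv (f1 : ℝ →ᵇ ℂ) (q g1 : ℝ →ᵇ ℝ) : ℝ →ᵇ ℂ := shiftComp f1 q * (1 + toComplex g1)

/-- The second derivative of `f0 (x + q x)`. -/
def shiftDeriv2 (f1 f2 : ℝ →ᵇ ℂ) (q g1 g2 : ℝ →ᵇ ℝ) : ℝ →ᵇ ℂ :=
  shiftComp f2 q * (1 + toComplex g1) * (1 + toComplex g1) + shiftComp f1 q * toComplex g2

theorem hasDerivAt_shiftComp (hf : ∀ x, HasDerivAt f0 (f1 x) x) (hq : IsH1 L q (bc L g1)) {x : ℝ}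
    (hx : x ∈ Ioo 0 L) :
    HasDerivAt (shiftComp f0 q) (shiftDeriv f1 q g1 x) x := by
  have h1 : HasDerivAt (fun x => x + q x) (1 + g1 x) x := (hasDerivAt_id x).add (hq.hasDerivAt hx)
  have h2 := (hf (x + q x)).scomp x h1
  exact h2.congr_deriv (by simp [shiftDeriv, mul_comm])

theorem isH1_shiftComp (hf : ∀ x, HasDerivAt f0 (f1 x) x) (hfp : Function.Periodic f0 L)
    (hq : IsH1 L q (bc L g1)) : IsH1 L (shiftComp f0 q) (bc L (shiftDeriv f1 q g1)) :=
  IsH1.of_hasDerivAt (periodic_shiftComp hfp hq.1) fun _ hx => hasDerivAt_shiftComp hf hq hx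

theorem isH1_shiftDeriv (hf : ∀ x, HasDerivAt f1 (f2 x) x) (hfp : Function.Periodic f1 L)
    (hq : IsH1 L q (bc L g1)) (hg : IsH1 L g1 (bc L g2)) :
    IsH1 L (shiftDeriv f1 q g1) (bc L (shiftDeriv2 f1 f2 q g1 g2)) := by
  refine IsH1.of_hasDerivAt ((periodic_shiftComp hfp hq.1).mul fun x => ?_) fun x hx => ?_
  · simp [hg.1 x]
  · have h1 := hasDerivAt_shiftComp hf hq hx
    have h2 : HasDerivAt (1 + toComplex g1 : ℝ →ᵇ ℂ) (toComplex g2 x) x :=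
      (hg.hasDerivAt hx).ofReal_comp.const_add 1
    exact (h1.mul h2).congr_deriv (by simp [shiftDeriv, shiftDeriv2])

theorem norm_shiftDeriv_le (f1 : ℝ →ᵇ ℂ) (q g1 : ℝ →ᵇ ℝ) :
    ‖shiftDeriv f1 q g1‖ ≤ ‖f1‖ * (1 + ‖g1‖) := by
  refine (norm_mul_le _ _).trans (mul_le_mul (norm_shiftComp_le _ _) ?_ (norm_nonneg _)
    (norm_nonneg _))
  refine (norm_add_le _ _).trans (add_le_add ?_ (norm_toComplex_le _))
  rw [norm_one]

/-- The defect between the second derivative of the modulated wave and φ'' at the shifted point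
comes from (1 + γ_x)² − 1 = (2 + γ_x)γ_x and from γ_xx. It is thus small in L² with γ_x and γ_xx,
independently of γ itself. -/
theorem norm_bc_shiftDeriv2_sub_le (hL : 0 ≤ L) (f1 f2 : ℝ →ᵇ ℂ) (q g1 g2 : ℝ →ᵇ ℝ) :
    ‖bc L (shiftDeriv2 f1 f2 q g1 g2 - shiftComp f2 q)‖
      ≤ ‖f2‖ * (2 + ‖g1‖) * ‖bc L g1‖ + ‖f1‖ * ‖bc L g2‖ := by
  have e : shiftDeriv2 f1 f2 q g1 g2 - shiftComp f2 q
      = shiftComp f2 q * (2 + toComplex g1) * toComplex g1 + shiftComp f1 q * toComplex g2 := by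
    rw [shiftDeriv2]; ring
  have h2 : ‖(2 : ℝ →ᵇ ℂ)‖ ≤ 2 := by
    have : (2 : ℝ →ᵇ ℂ) = 1 + 1 := by norm_num
    rw [this]
    refine (norm_add_le _ _).trans ?_
    rw [norm_one]; norm_num
  rw [e, map_add, ← bmul_bc, ← bmul_bc]
  refine (norm_add_le _ _).trans (add_le_add ((norm_bmul_le _ _).trans ?_)
    ((norm_bmul_le _ _).trans ?_))
  · rw [norm_bc_toComplex hL]
    gcongr
    refine (norm_mul_le _ _).trans (mul_le_mul (norm_shiftComp_le _ _) ?_ (norm_nonneg _)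
      (norm_nonneg _))
    exact (norm_add_le _ _).trans (add_le_add h2 (norm_toComplex_le _))
  · rw [norm_bc_toComplex hL]
    gcongr
    exact norm_shiftComp_le _ _

theorem norm_bc_shiftComp_mul_le (hL : 0 ≤ L) (f1 : ℝ →ᵇ ℂ) (q g : ℝ →ᵇ ℝ) (a : ℝ) :
    ‖bc L (shiftComp f1 q * toComplex (g + a • 1))‖
      ≤ ‖f1‖ * (‖bc L g‖ + √L * |a|) := by
  have h1 : ‖bc L (a • (1 : ℝ →ᵇ ℝ))‖ = √L * |a| := by
    rw [← sq_eq_sq₀ (norm_nonneg _) (by positivity), norm_sq_bc hL, mul_pow, Real.sq_sqrt hL]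
    simp
  rw [← bmul_bc]
  refine (norm_bmul_le _ _).trans ?_
  rw [norm_bc_toComplex hL, map_add]
  gcongr
  · exact norm_shiftComp_le _ _
  · exact (norm_add_le _ _).trans_eq (by rw [h1])

end modulation

end

section

variable {L : ℝ}

/-! ### The energy -/

/-- The modified energy `‖ψ_t‖² - β Re ∫ ψ² (v̄_x)²`. -/
def energy (L β : ℝ) (p w : ℝ →ᵇ ℂ) (X : L2 L ℂ) : ℝ :=
  ‖X‖ ^ 2 - β * ⟪bc L w, bmul L (p * p) (conjL L (bc L w))⟫_ℝ

/-- The time derivative of the modified energy, where `p1`, `w`, `V2` stand for `ψ_x`, `v_x`,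
`v_xx`, and `X`, `X - m` for `ψ_t`, `v_t`. -/
def energyDeriv (L β : ℝ) (p p1 w : ℝ →ᵇ ℂ) (V2 X m : L2 L ℂ) : ℝ :=
  -(2 * ‖X‖ ^ 2) + 2 * ⟪X, Complex.I • bmul L (p * p) (conjL L X)⟫_ℝ
    - β * (⟪bc L w, bmul L ((p + p) * star w) X⟫_ℝ
      - ⟪X - m, bmul L (p * p) (conjL L (V2 + V2))
        + bmul L (star (w + w)) (bmul L p (bc L p1) + bmul L p (bc L p1))⟫_ℝ)

theorem abs_inner_bmul_le {c : ℝ →ᵇ ℂ} {K : ℝ} (hc : ‖c‖ ≤ K) (f g : L2 L ℂ) :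
    |⟪f, bmul L c g⟫_ℝ| ≤ K * ‖f‖ * ‖g‖ := by
  refine (abs_real_inner_le_norm _ _).trans ?_
  rw [mul_comm K, mul_assoc]
  gcongr
  exact (norm_bmul_le c g).trans (by gcongr)

theorem abs_inner_I_smul_bmul_le_of_norm_le {c : ℝ →ᵇ ℂ} {K : ℝ} (hc : ‖c‖ ≤ K) (f g : L2 L ℂ) :
    |⟪f, Complex.I • bmul L c g⟫_ℝ| ≤ K * ‖f‖ * ‖g‖ := by
  refine (abs_inner_I_smul_bmul_le c f g).trans ?_
  rw [mul_comm K, mul_assoc]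
  gcongr

/-- The key cancellation. Conjugating `hr` expresses β conj(v_xx) through i conj(r) − i conj(ψ_t),
so the correction produces −2⟨X, iψ² X̄⟩, which removes the indefinite term from the derivative of
‖X‖². -/
theorem energyDeriv_eq {β : ℝ} {p p1 w : ℝ →ᵇ ℂ} {V2 X m r : L2 L ℂ}
    (hr : β • (Complex.I • V2) = r - X) :
    energyDeriv L β p p1 w V2 X m = -(2 * ‖X‖ ^ 2)
      + 2 * ⟪X, Complex.I • bmul L (p * p) (conjL L r)⟫_ℝ
      + 2 * ⟪m, Complex.I • bmul L (p * p) (conjL L X)⟫_ℝ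
      - 2 * ⟪m, Complex.I • bmul L (p * p) (conjL L r)⟫_ℝ
      - β * ⟪bc L w, bmul L ((p + p) * star w) X⟫_ℝ
      + 4 * β * ⟪X, bmul L (star w * p) (bc L p1)⟫_ℝ
      - 4 * β * ⟪m, bmul L (star w * p) (bc L p1)⟫_ℝ := by
  have h1 : β • V2 = -(Complex.I • (r - X)) := by
    rw [← hr, smul_comm Complex.I β, smul_smul Complex.I, Complex.I_mul_I, neg_one_smul, smul_neg,
      neg_neg]
  have h2 : β • bmul L (p * p) (conjL L V2)
      = Complex.I • bmul L (p * p) (conjL L r) - Complex.I • bmul L (p * p) (conjL L X) := by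
    rw [← bmul_real_smul, ← map_smul (conjL L), h1, map_neg, conjL_I_smul, neg_neg, map_smul,
      map_sub, map_sub, smul_sub]
  have h3 : ∀ f : L2 L ℂ, β * ⟪f, bmul L (p * p) (conjL L V2)⟫_ℝ
      = ⟪f, Complex.I • bmul L (p * p) (conjL L r)⟫_ℝ
        - ⟪f, Complex.I • bmul L (p * p) (conjL L X)⟫_ℝ := fun f => by
    rw [← real_inner_smul_right, h2, inner_sub_right]
  have h4 := h3 X
  have h5 := h3 m
  simp only [energyDeriv, star_add, map_add, add_apply, ← bmul_mul,
    inner_sub_left, inner_add_right]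
  linear_combination 2 * h4 - 2 * h5

theorem energyDeriv_le {β M : ℝ} {p p1 w : ℝ →ᵇ ℂ} {V2 X m r : L2 L ℂ}
    (hp : ‖p‖ ≤ M) (hw : ‖w‖ ≤ M) {p1' w' : ℝ}
    (hr : β • (Complex.I • V2) = r - X) (hw' : ‖bc L w‖ = w')
    (hp1 : ∀ f : L2 L ℂ, |⟪f, bmul L (star w * p) (bc L p1)⟫_ℝ| ≤ p1' * ‖f‖ * w') :
    energyDeriv L β p p1 w V2 X m ≤ -(2 * ‖X‖ ^ 2) + 2 * (M ^ 2 * ‖X‖ * ‖r‖)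
      + 2 * (M ^ 2 * ‖m‖ * ‖X‖) + 2 * (M ^ 2 * ‖m‖ * ‖r‖) + |β| * (2 * M ^ 2 * w' * ‖X‖)
      + 4 * |β| * (p1' * ‖X‖ * w') + 4 * |β| * (p1' * ‖m‖ * w') := by
  have hM : 0 ≤ M := (norm_nonneg _).trans hp
  have hpp : ‖p * p‖ ≤ M ^ 2 := (norm_mul_le _ _).trans (by rw [sq]; gcongr)
  have hpw : ‖(p + p) * star w‖ ≤ 2 * M ^ 2 := by
    refine (norm_mul_le _ _).trans ?_
    rw [norm_star]
    calc _ ≤ (M + M) * M := by gcongr; exact (norm_add_le _ _).trans (by gcongr)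
      _ = _ := by ring
  have e1 := abs_inner_I_smul_bmul_le_of_norm_le hpp X (conjL L r)
  have e2 := abs_inner_I_smul_bmul_le_of_norm_le hpp m (conjL L X)
  have e3 := abs_inner_I_smul_bmul_le_of_norm_le hpp m (conjL L r)
  have e4 := abs_inner_bmul_le hpw (bc L w) X
  have e5 := hp1 X
  have e6 := hp1 m
  rw [norm_conjL] at e1 e2 e3
  rw [hw'] at e4
  have hmul : ∀ {a c : ℝ}, |a| ≤ c → |β * a| ≤ |β| * c := fun h => by rw [abs_mul]; gcongr
  have f4 := hmul e4
  have f5 := hmul e5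
  have f6 := hmul e6
  rw [abs_le] at e1 e2 e3 f4 f5 f6
  rw [energyDeriv_eq hr]
  linarith [e1.2, e2.2, e3.1, f4.1, f5.2, f6.1]

/-- Here x, r, m, v, W stand for the L²-norms of ψ_t, the remainder, the time derivative of the
modulated wave, v and v_x. The term in the last parentheses bounds E itself, and leaves a full −x²
for Young's inequality. -/
theorem mul_energy_bound {b A v x r m W : ℝ} (hb : 0 < b) (hA : 0 ≤ A)
    (hW : b * W ^ 2 ≤ v * (x + r)) :
    -(2 * x ^ 2) + 2 * (A * x * r) + 2 * (A * m * x) + 2 * (A * m * r) + b * (2 * A * W * x)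
      + 4 * b * (A * x * W) + 4 * b * (A * m * W) + (x ^ 2 + b * (A * W ^ 2))
    ≤ (2 * (3 * A + 72 * b * A ^ 2) ^ 2 + (3 * A + 72 * b * A ^ 2) + 8 * A ^ 2 + A + 2 * b * A)
      * (v ^ 2 + r ^ 2 + m ^ 2) := by
  -- Total coefficient needed for b W²: A from E and 2A from `e5`, together with 72 b A² from `e4`.
  -- Interpolation then trades all of it for c v(x + r), and the four terms x²/8 are absorbed by
  -- −x².
  set c := 3 * A + 72 * b * A ^ 2 with hc
  have hc0 : 0 ≤ c := by positivity
  have h1 : c * (b * W ^ 2) ≤ c * (v * (x + r)) := mul_le_mul_of_nonneg_left hW hc0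
  have e1 : 2 * (A * x * r) ≤ x ^ 2 / 8 + 8 * A ^ 2 * r ^ 2 := by
    nlinarith [sq_nonneg (x - 8 * A * r)]
  have e2 : 2 * (A * m * x) ≤ x ^ 2 / 8 + 8 * A ^ 2 * m ^ 2 := by
    nlinarith [sq_nonneg (x - 8 * A * m)]
  have e3 : 2 * (A * m * r) ≤ A * m ^ 2 + A * r ^ 2 := by
    nlinarith [mul_nonneg hA (sq_nonneg (m - r))]
  have e4 : 6 * b * A * W * x ≤ x ^ 2 / 8 + 72 * b ^ 2 * A ^ 2 * W ^ 2 := by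
    nlinarith [sq_nonneg (x - 24 * b * A * W)]
  have e5 : 4 * b * (A * m * W) ≤ 2 * b * A * m ^ 2 + 2 * b * A * W ^ 2 := by
    nlinarith [mul_nonneg (mul_nonneg hb.le hA) (sq_nonneg (m - W))]
  have e6 : c * (v * x) ≤ x ^ 2 / 8 + 2 * c ^ 2 * v ^ 2 := by
    nlinarith [sq_nonneg (x - 4 * c * v)]
  have e7 : c * (v * r) ≤ c * v ^ 2 + c * r ^ 2 := by
    nlinarith [mul_nonneg hc0 (sq_nonneg (v - r)), mul_nonneg hc0 (sq_nonneg v),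
      mul_nonneg hc0 (sq_nonneg r)]
  have e8 : c * (b * W ^ 2) = b * (A * W ^ 2) + 2 * b * A * W ^ 2 + 72 * b ^ 2 * A ^ 2 * W ^ 2 := by
    rw [hc]; ring
  have z : ∀ {s t : ℝ}, 0 ≤ s → 0 ≤ s * t ^ 2 := fun h => mul_nonneg h (sq_nonneg _)
  have hbA : 0 ≤ b * A := by positivity
  have hA2 : 0 ≤ A ^ 2 := by positivity
  have hc2 : 0 ≤ c ^ 2 := by positivity
  nlinarith [z (t := v) hA, z (t := v) hbA, z (t := v) hA2, z (t := r) hc2, z (t := r) hbA,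
    z (t := m) hc2, z (t := m) hc0, z (t := x) zero_le_one]

/-- E bounds x² after the W²-term is absorbed by interpolation; the equation bounds V by (x + r)/b,
and W lies between v and V. The factor 6/b² is (3/2)·(2/b²)·2, one factor from each of these steps.
-/
theorem coercivity_bound {b A v x r W V E : ℝ} (hb : 0 < b) (hA : 0 ≤ A)
    (hV : 0 ≤ V) (hW : b * W ^ 2 ≤ v * (x + r)) (hW' : W ^ 2 ≤ v * V) (hbV : b * V ≤ x + r)
    (hE : x ^ 2 - b * (A * W ^ 2) ≤ E) :
    v ^ 2 + W ^ 2 + V ^ 2 ≤ 6 / b ^ 2 * E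
      + (3 / 2 + 3 / b ^ 2 * (A ^ 2 + A + 1)) * (v ^ 2 + r ^ 2) := by
  have h1 : x ^ 2 ≤ 2 * E + (A ^ 2 + A) * (v ^ 2 + r ^ 2) := by
    have := mul_le_mul_of_nonneg_left hW hA
    nlinarith [sq_nonneg (x - A * v), mul_nonneg hA (sq_nonneg (v - r)),
      mul_nonneg (sq_nonneg A) (sq_nonneg r)]
  have h2 : V ^ 2 ≤ 2 / b ^ 2 * (x ^ 2 + r ^ 2) := by
    rw [div_mul_eq_mul_div, le_div_iff₀ (by positivity)]
    have := mul_self_le_mul_self (by positivity) hbV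
    nlinarith [sq_nonneg (x - r)]
  have h3 : W ^ 2 ≤ v ^ 2 / 2 + V ^ 2 / 2 := by nlinarith [sq_nonneg (v - V)]
  have h4 : 2 / b ^ 2 * (x ^ 2 + r ^ 2)
      ≤ 2 / b ^ 2 * (2 * E + (A ^ 2 + A + 1) * (v ^ 2 + r ^ 2)) :=
    mul_le_mul_of_nonneg_left (by nlinarith [sq_nonneg v]) (by positivity)
  have h5 : 2 / b ^ 2 * (2 * E + (A ^ 2 + A + 1) * (v ^ 2 + r ^ 2)) * (3 / 2)
      = 6 / b ^ 2 * E + 3 / b ^ 2 * (A ^ 2 + A + 1) * (v ^ 2 + r ^ 2) := by ring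
  nlinarith [sq_nonneg r]

/-- Bounds for the energy and its derivative, where `r` is the part of `ψ_t` which does not involve
`v_xx`. -/
theorem energy_bounds (hL : 0 ≤ L) {β M : ℝ} (hβ : β ≠ 0) {p p1 v w : ℝ →ᵇ ℂ} {V2 X m r : L2 L ℂ}
    (hp : ‖p‖ ≤ M) (hp1 : ‖p1‖ ≤ M) (hw : ‖w‖ ≤ M) (hv1 : IsH1 L v (bc L w))
    (hv2 : IsH1 L w V2) (hr : β • (Complex.I • V2) = r - X) :
    energyDeriv L β p p1 w V2 X m + energy L β p w X
        ≤ (2 * (3 * M ^ 2 + 72 * |β| * (M ^ 2) ^ 2) ^ 2 + (3 * M ^ 2 + 72 * |β| * (M ^ 2) ^ 2)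
          + 8 * (M ^ 2) ^ 2 + M ^ 2 + 2 * |β| * M ^ 2) * (‖bc L v‖ ^ 2 + ‖r‖ ^ 2 + ‖m‖ ^ 2) ∧
      ‖bc L v‖ ^ 2 + ‖bc L w‖ ^ 2 + ‖V2‖ ^ 2 ≤ 6 / |β| ^ 2 * energy L β p w X
        + (3 / 2 + 3 / |β| ^ 2 * ((M ^ 2) ^ 2 + M ^ 2 + 1)) * (‖bc L v‖ ^ 2 + ‖r‖ ^ 2) ∧
      energy L β p w X ≤ 2 * |β| ^ 2 * ‖V2‖ ^ 2 + 2 * ‖r‖ ^ 2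
        + |β| * M ^ 2 * ‖bc L w‖ ^ 2 := by
  have hM : 0 ≤ M := (norm_nonneg _).trans hp
  have hb : 0 < |β| := abs_pos.2 hβ
  have hpp : ‖p * p‖ ≤ M ^ 2 := (norm_mul_le _ _).trans (by rw [sq]; gcongr)
  have hbV : |β| * ‖V2‖ = ‖r - X‖ := by
    rw [← hr, norm_smul, norm_smul, Complex.norm_I, one_mul, Real.norm_eq_abs]
  have hbV' : |β| * ‖V2‖ ≤ ‖X‖ + ‖r‖ := by
    rw [hbV, add_comm]; exact norm_sub_le _ _
  have hW' : ‖bc L w‖ ^ 2 ≤ ‖bc L v‖ * ‖V2‖ := by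
    have h1 := inner_deriv_eq_neg hL hv1 hv2
    rw [real_inner_self_eq_norm_sq] at h1
    rw [h1]
    exact (neg_le_abs _).trans (abs_real_inner_le_norm _ _)
  have hW : |β| * ‖bc L w‖ ^ 2 ≤ ‖bc L v‖ * (‖X‖ + ‖r‖) := by
    calc |β| * ‖bc L w‖ ^ 2 ≤ |β| * (‖bc L v‖ * ‖V2‖) := by gcongr
      _ = ‖bc L v‖ * (|β| * ‖V2‖) := by ring
      _ ≤ _ := by gcongr
  have hB : |β * ⟪bc L w, bmul L (p * p) (conjL L (bc L w))⟫_ℝ| ≤ |β| * (M ^ 2 * ‖bc L w‖ ^ 2) := by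
    rw [abs_mul]
    gcongr
    refine (abs_inner_bmul_le hpp _ _).trans_eq ?_
    rw [norm_conjL]; ring
  rw [abs_le] at hB
  have hE1 : energy L β p w X ≤ ‖X‖ ^ 2 + |β| * (M ^ 2 * ‖bc L w‖ ^ 2) := by
    rw [energy]; linarith [hB.1]
  have hE2 : ‖X‖ ^ 2 - |β| * (M ^ 2 * ‖bc L w‖ ^ 2) ≤ energy L β p w X := by
    rw [energy]; linarith [hB.2]
  have hp1' : ∀ f : L2 L ℂ, |⟪f, bmul L (star w * p) (bc L p1)⟫_ℝ| ≤ M ^ 2 * ‖f‖ * ‖bc L w‖ := by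
    intro f
    -- Regrouped so that ψ and ψ_x are measured in the supremum norm and only v_x in L²; the L²-norm
    -- of ψ_x need not be bounded uniformly in N.
    have e : bmul L (star w * p) (bc L p1) = bmul L (p * p1) (conjL L (bc L w)) := by
      rw [conjL_bc, bmul_bc, bmul_bc]
      congr 1
      ring
    rw [e, ← norm_conjL (bc L w)]
    exact abs_inner_bmul_le ((norm_mul_le _ _).trans (by rw [sq]; gcongr)) _ _
  refine ⟨?_, coercivity_bound hb (by positivity) (norm_nonneg _) hW hW' hbV' hE2,
    ?_⟩
  · have h1 := energyDeriv_le (m := m) hp hw hr rfl hp1'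
    have h2 := mul_energy_bound (m := ‖m‖) hb (sq_nonneg M) hW
    linarith
  · have hx : ‖X‖ ≤ ‖r‖ + |β| * ‖V2‖ := by
      rw [hbV]
      calc ‖X‖ = ‖r - (r - X)‖ := by rw [sub_sub_cancel]
        _ ≤ _ := norm_sub_le _ _
    have hx2 : ‖X‖ ^ 2 ≤ 2 * |β| ^ 2 * ‖V2‖ ^ 2 + 2 * ‖r‖ ^ 2 := by
      have := mul_self_le_mul_self (norm_nonneg X) hx
      nlinarith [sq_nonneg (‖r‖ - |β| * ‖V2‖)]
    linarith

/-- The part of `ψ_t` not involving `v_xx` is controlled by `v` and by the residual of the modulated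
wave. -/
theorem norm_remainder_le {α β M : ℝ} {e : L2 L ℂ} {p s s2 S2 : ℝ →ᵇ ℂ}
    {V2 X : L2 L ℂ} (hX : IsEq L α β e p (V2 + bc L S2) X) (hs : IsEq L α β e s (bc L s2) 0)
    (hp : ‖p‖ ≤ M) (hsM : ‖s‖ ≤ M) :
    ‖X + β • (Complex.I • V2)‖
      ≤ (1 + |α| + 3 * M ^ 2) * ‖bc L (p - s)‖ + |β| * ‖bc L (S2 - s2)‖ := by
  have hM : 0 ≤ M := (norm_nonneg _).trans hp
  have hcub : p * p * star p - s * s * star s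
      = (p * star p + s * star p) * (p - s) + s * s * star (p - s) := by
    rw [star_sub]; ring
  have e1 : X + β • (Complex.I • V2) = -(bc L (p - s)) - α • (Complex.I • bc L (p - s))
      + Complex.I • (bmul L (p * star p + s * star p) (bc L (p - s))
        + bmul L (s * s) (conjL L (bc L (p - s)))) - β • (Complex.I • bc L (S2 - s2)) := by
    rw [conjL_bc, bmul_bc, bmul_bc, ← map_add, ← hcub]
    -- The zero subtracted here is the profile equation at the shifted argument; this removes the
    -- forcing and leaves only terms in p − s and the defect S2 − s2.
    have h0 : X = X - 0 := (sub_zero X).symm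
    rw [h0, hs, hX]
    simp only [map_sub, smul_sub, smul_add]
    abel
  have n1 : ‖p * star p + s * star p‖ ≤ 2 * M ^ 2 := by
    refine (norm_add_le _ _).trans ?_
    have h1 : ‖p * star p‖ ≤ M * M := (norm_mul_le _ _).trans (by rw [norm_star]; gcongr)
    have h2 : ‖s * star p‖ ≤ M * M := (norm_mul_le _ _).trans (by rw [norm_star]; gcongr)
    linarith
  have n2 : ‖s * s‖ ≤ M ^ 2 := (norm_mul_le _ _).trans (by rw [sq]; gcongr)
  rw [e1]
  set D := bc L (p - s)
  calc _ ≤ ‖D‖ + |α| * ‖D‖ + (2 * M ^ 2 * ‖D‖ + M ^ 2 * ‖D‖) + |β| * ‖bc L (S2 - s2)‖ := by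
        refine (norm_sub_le _ _).trans (add_le_add ((norm_add_le _ _).trans (add_le_add
          ((norm_sub_le _ _).trans (add_le_add ?_ ?_)) ?_)) ?_)
        · rw [norm_neg]
        · rw [norm_smul, norm_smul, Complex.norm_I, one_mul, Real.norm_eq_abs]
        · rw [norm_smul, Complex.norm_I, one_mul]
          refine (norm_add_le _ _).trans (add_le_add ?_ ?_)
          · exact (norm_bmul_le _ _).trans (by gcongr)
          · refine (norm_bmul_le _ _).trans ?_
            rw [norm_conjL]
            gcongr
        · rw [norm_smul, norm_smul, Complex.norm_I, one_mul, Real.norm_eq_abs]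
    _ = _ := by ring

/-! ### Grönwall's inequality -/

/-- The integrating factor is exp s. Right derivatives suffice, which is all that is available for
the energy. -/
theorem le_exp_mul_add_integral {f f' D : ℝ → ℝ} {t K : ℝ} (ht : 0 ≤ t)
    (hf : ContinuousOn f (Icc 0 t)) (hf' : ∀ s ∈ Ioo 0 t, HasDerivWithinAt f (f' s) (Ioi s) s)
    (hD : ContinuousOn D (Icc 0 t)) (h : ∀ s ∈ Ioo 0 t, f' s + f s ≤ K * D s) :
    f t ≤ Real.exp (-t) * f 0 + K * ∫ s in (0 : ℝ)..t, Real.exp (-(t - s)) * D s := by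
  have h1 := intervalIntegral.sub_le_integral_of_hasDeriv_right_of_le (g := fun s => Real.exp s * f s)
    (g' := fun s => Real.exp s * f s + Real.exp s * f' s) (φ := fun s => Real.exp s * (K * D s)) ht
    (Real.continuous_exp.continuousOn.mul hf)
    (fun s hs => (Real.hasDerivAt_exp s).hasDerivWithinAt.mul (hf' s hs))
    ((Real.continuous_exp.continuousOn.mul (continuousOn_const.mul hD)).integrableOn_Icc)
    (fun s hs => by
      have := mul_le_mul_of_nonneg_left (h s hs) (Real.exp_pos s).le
      linarith)
  rw [Real.exp_zero, one_mul] at h1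
  have h2 : ∫ s in (0 : ℝ)..t, Real.exp s * (K * D s)
      = Real.exp t * (K * ∫ s in (0 : ℝ)..t, Real.exp (-(t - s)) * D s) := by
    rw [← intervalIntegral.integral_const_mul, ← intervalIntegral.integral_const_mul]
    refine intervalIntegral.integral_congr fun s _ => ?_
    have : Real.exp s = Real.exp t * Real.exp (-(t - s)) := by
      rw [← Real.exp_add]; congr 1; ring
    simp only [this]
    ring
  rw [h2] at h1
  have h3 := mul_le_mul_of_nonneg_left h1 (Real.exp_pos (-t)).le
  have h4 : Real.exp (-t) * Real.exp t = 1 := by rw [← Real.exp_add]; simp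
  have h5 : Real.exp (-t) * (Real.exp t * f t - f 0) = f t - Real.exp (-t) * f 0 := by
    rw [mul_sub, ← mul_assoc, h4, one_mul]
  rw [h5, ← mul_assoc, h4, one_mul] at h3
  linarith

end

section

/-! ### The damping estimate for absolutely continuous representatives -/

/-- One constant for all periods. Factoring out 6/|β|² in the coercivity bound makes the same K
serve as weight of the modulation terms added to the energy; this is the reason for the summand
|β|²/6 · K₂. -/
theorem exists_energy_bounds {β : ℝ} (hβ : β ≠ 0) (M : ℝ) : ∃ K > 0, ∀ {L : ℝ}, 0 ≤ L →
    ∀ {p p1 v w : ℝ →ᵇ ℂ} {V2 X m : L2 L ℂ}, ‖p‖ ≤ M → ‖p1‖ ≤ M → ‖w‖ ≤ M → IsH1 L v (bc L w) →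
      IsH1 L w V2 →
      energyDeriv L β p p1 w V2 X m + energy L β p w X
        ≤ K * (‖bc L v‖ ^ 2 + ‖X + β • (Complex.I • V2)‖ ^ 2 + ‖m‖ ^ 2) ∧
      ‖bc L v‖ ^ 2 + ‖bc L w‖ ^ 2 + ‖V2‖ ^ 2 ≤ 6 / |β| ^ 2 * (energy L β p w X
        + K * (‖bc L v‖ ^ 2 + ‖X + β • (Complex.I • V2)‖ ^ 2)) ∧
      energy L β p w X
        ≤ K * (‖bc L w‖ ^ 2 + ‖V2‖ ^ 2 + ‖X + β • (Complex.I • V2)‖ ^ 2) := by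
  have hb : 0 < |β| := abs_pos.2 hβ
  set K₁ := 2 * (3 * M ^ 2 + 72 * |β| * (M ^ 2) ^ 2) ^ 2 + (3 * M ^ 2 + 72 * |β| * (M ^ 2) ^ 2)
    + 8 * (M ^ 2) ^ 2 + M ^ 2 + 2 * |β| * M ^ 2
  set K₂ := 3 / 2 + 3 / |β| ^ 2 * ((M ^ 2) ^ 2 + M ^ 2 + 1)
  have h1 : 0 ≤ K₁ := by positivity
  have h2 : 0 ≤ K₂ := by positivity
  refine ⟨K₁ + |β| ^ 2 / 6 * K₂ + 2 * |β| ^ 2 + 2 + |β| * M ^ 2, by positivity, ?_⟩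
  intro L hL p p1 v w V2 X m hp hp1 hw hv1 hv2
  obtain ⟨e1, e2, e3⟩ := energy_bounds (m := m) (r := X + β • (Complex.I • V2)) hL hβ hp hp1 hw hv1
    hv2 (add_sub_cancel_left _ _).symm
  set K := K₁ + |β| ^ 2 / 6 * K₂ + 2 * |β| ^ 2 + 2 + |β| * M ^ 2 with hK
  have k2 : 0 ≤ |β| ^ 2 / 6 * K₂ := by positivity
  have k3 : 0 ≤ |β| ^ 2 := by positivity
  have k4 : 0 ≤ |β| * M ^ 2 := by positivity
  refine ⟨e1.trans ?_, e2.trans ?_, e3.trans ?_⟩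
  · gcongr
    linarith
  · have h3 : K₂ = 6 / |β| ^ 2 * (|β| ^ 2 / 6 * K₂) := by field_simp
    have h4 : K₂ ≤ 6 / |β| ^ 2 * K :=
      h3.le.trans (mul_le_mul_of_nonneg_left (by linarith) (by positivity))
    have h5 := mul_le_mul_of_nonneg_right h4
      (show 0 ≤ ‖bc L v‖ ^ 2 + ‖X + β • (Complex.I • V2)‖ ^ 2 by positivity)
    rw [mul_add (6 / |β| ^ 2), ← mul_assoc]
    exact add_le_add_right h5 _
  · have l1 : 2 * |β| ^ 2 ≤ K := by linarith
    have l2 : 2 ≤ K := by linarith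
    have l3 : |β| * M ^ 2 ≤ K := by linarith
    have := mul_le_mul_of_nonneg_right l1 (sq_nonneg ‖V2‖)
    have := mul_le_mul_of_nonneg_right l2 (sq_nonneg ‖X + β • (Complex.I • V2)‖)
    have := mul_le_mul_of_nonneg_right l3 (sq_nonneg ‖bc L w‖)
    linarith

/-- A stationary wave of the Lugiato-Lefever equation together with its first derivatives. -/
structure Wave (α β F T : ℝ) where
  (f0 f1 f2 f3 : ℝ →ᵇ ℂ)
  h0 : ∀ x, HasDerivAt f0 (f1 x) x
  h1 : ∀ x, HasDerivAt f1 (f2 x) x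
  h2 : ∀ x, HasDerivAt f2 (f3 x) x
  per0 : Function.Periodic f0 T
  per1 : Function.Periodic f1 T
  stat : ∀ x, -Complex.I * β * f2 x - (1 + Complex.I * α) * f0 x
      + Complex.I * (‖f0 x‖ : ℂ) ^ 2 * f0 x + F = 0

/-- A solution `p` of the Lugiato-Lefever equation with time derivative `X`, and a modulation of the
phase given by `G0` and `σ` with time derivatives `Γ0` and `σt`; `p1`, `P2`, `G1`, `G2`, `G3`, `Γ1`
and `Γ2` are derivatives in space. -/
structure ModulatedSolution (α β F L : ℝ) (τ : EReal) where
  (p p1 : ℝ → ℝ →ᵇ ℂ)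
  (P2 X : ℝ → L2 L ℂ)
  (G0 G1 G2 Γ0 : ℝ → ℝ →ᵇ ℝ)
  (G3 Γ1 Γ2 : ℝ → L2 L ℝ)
  (σ σt : ℝ → ℝ)
  hp : ∀ t ∈ timeInterval τ, IsH1 L (p t) (bc L (p1 t))
  hp1 : ∀ t ∈ timeInterval τ, IsH1 L (p1 t) (P2 t)
  hG0 : ∀ t ∈ timeInterval τ, IsH1 L (G0 t) (bc L (G1 t))
  hG1 : ∀ t ∈ timeInterval τ, IsH1 L (G1 t) (bc L (G2 t))
  hG2 : ∀ t ∈ timeInterval τ, IsH1 L (G2 t) (G3 t)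
  hΓ0 : ∀ t ∈ timeInterval τ, IsH1 L (Γ0 t) (Γ1 t)
  cp : ContinuousOn (fun t => bc L (p t)) (timeInterval τ)
  cp1 : ContinuousOn (fun t => bc L (p1 t)) (timeInterval τ)
  cP2 : ContinuousOn P2 (timeInterval τ)
  cX : ContinuousOn X (timeInterval τ)
  cG0 : ContinuousOn (fun t => bc L (G0 t)) (timeInterval τ)
  cG1 : ContinuousOn (fun t => bc L (G1 t)) (timeInterval τ)
  cG2 : ContinuousOn (fun t => bc L (G2 t)) (timeInterval τ)
  cG3 : ContinuousOn G3 (timeInterval τ)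
  dp : ∀ t ∈ timeInterval τ, HasDerivWithinAt (fun t => bc L (p t)) (X t) (timeInterval τ) t
  dG0 : ∀ t ∈ timeInterval τ,
    HasDerivWithinAt (fun t => bc L (G0 t)) (bc L (Γ0 t)) (timeInterval τ) t
  dG1 : ∀ t ∈ timeInterval τ, HasDerivWithinAt (fun t => bc L (G1 t)) (Γ1 t) (timeInterval τ) t
  dG2 : ∀ t ∈ timeInterval τ, HasDerivWithinAt (fun t => bc L (G2 t)) (Γ2 t) (timeInterval τ) t
  dσ : ∀ t ∈ timeInterval τ, HasDerivWithinAt σ (σt t) (timeInterval τ) t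
  eq : ∀ t ∈ timeInterval τ,
    IsEq L α β (bc L (BoundedContinuousFunction.const ℝ (F : ℂ))) (p t) (P2 t) (X t)

theorem isEq_of_ae {L α β F : ℝ} {f ft f2 : ℝ → ℂ} {p : ℝ →ᵇ ℂ} {P2 : L2 L ℂ}
    (hft : MemLp ft 2 (volume.restrict (Ioc 0 L))) (hf : f =ᵐ[volume.restrict (Ioc 0 L)] p)
    (hf2 : f2 =ᵐ[volume.restrict (Ioc 0 L)] P2)
    (h : ∀ᵐ x ∂volume.restrict (Ioc 0 L), ft x = -Complex.I * β * f2 x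
      - (1 + Complex.I * α) * f x + Complex.I * (‖f x‖ : ℂ) ^ 2 * f x + F) :
    IsEq L α β (bc L (BoundedContinuousFunction.const ℝ (F : ℂ))) p P2 (toH L ft) := by
  rw [IsEq, toH_eq_iff hft]
  set a := -(β • (Complex.I • P2)) with ha
  set b := a - bc L p with hb
  set c := b - α • (Complex.I • bc L p) with hc
  set d := c + Complex.I • bc L (p * p * star p) with hd
  filter_upwards [h, hf, hf2, Lp.coeFn_add d (bc L (BoundedContinuousFunction.const ℝ (F : ℂ))),
    Lp.coeFn_add c (Complex.I • bc L (p * p * star p)),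
    Lp.coeFn_sub b (α • (Complex.I • bc L p)), Lp.coeFn_sub a (bc L p),
    Lp.coeFn_neg (β • (Complex.I • P2)), Lp.coeFn_smul β (Complex.I • P2),
    Lp.coeFn_smul Complex.I P2, Lp.coeFn_smul α (Complex.I • bc L p),
    Lp.coeFn_smul Complex.I (bc L p), Lp.coeFn_smul Complex.I (bc L (p * p * star p)),
    coeFn_bc (L := L) p, coeFn_bc (L := L) (p * p * star p),
    coeFn_bc (L := L) (BoundedContinuousFunction.const ℝ (F : ℂ))]
    with x h e1 e2 i1 i2 i3 i4 i5 i6 i7 i8 i9 i10 i11 i12 i13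
  rw [i1, Pi.add_apply, hd, i2, Pi.add_apply, hc, i3, Pi.sub_apply, hb, i4, Pi.sub_apply, ha, i5,
    Pi.neg_apply, i6, Pi.smul_apply, i7, Pi.smul_apply, i8, Pi.smul_apply, i9, Pi.smul_apply, i10,
    Pi.smul_apply, i11, i12, i13, h, e1, e2]
  simp only [BoundedContinuousFunction.mul_apply, BoundedContinuousFunction.star_apply,
    BoundedContinuousFunction.const_apply, smul_eq_mul, Complex.real_smul, ← Complex.mul_conj',
    RCLike.star_def]
  ring

/-- The stationary equation is evaluated pointwise at x + q(x). The second-derivative slot holds φ''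
at that point, not the second derivative of the composition, so the identity is exact for every q.
-/
theorem Wave.isEq {α β F T : ℝ} (φ : Wave α β F T) (L : ℝ) (q : ℝ →ᵇ ℝ) :
    IsEq L α β (bc L (BoundedContinuousFunction.const ℝ (F : ℂ))) (shiftComp φ.f0 q)
      (bc L (shiftComp φ.f2 q)) 0 := by
  have hm : MemLp (fun _ : ℝ => (0 : ℂ)) 2 (volume.restrict (Ioc 0 L)) := MemLp.zero'
  have h0 : toH L (fun _ : ℝ => (0 : ℂ)) = 0 :=
    (toH_eq_iff hm (d := 0)).2 (Lp.coeFn_zero ℂ 2 (volume.restrict (Ioc 0 L))).symm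
  have hs : ∀ x, (0 : ℂ) = -Complex.I * β * shiftComp φ.f2 q x
      - (1 + Complex.I * α) * shiftComp φ.f0 q x
      + Complex.I * (‖shiftComp φ.f0 q x‖ : ℂ) ^ 2 * shiftComp φ.f0 q x + F := fun x =>
    (φ.stat (x + q x)).symm
  rw [← h0]
  exact isEq_of_ae hm (EventuallyEq.refl _ _) (coeFn_bc _).symm (Eventually.of_forall hs)

theorem mem_timeInterval_of_le {τ : EReal} {s t : ℝ} (ht : t ∈ timeInterval τ) (h0 : 0 ≤ s)
    (hst : s ≤ t) : s ∈ timeInterval τ :=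
  ⟨h0, lt_of_le_of_lt (by exact_mod_cast hst) ht.2⟩

namespace ModulatedSolution

variable {α β F T L : ℝ} {τ : EReal} (U : ModulatedSolution α β F L τ) (φ : Wave α β F T) (N : ℕ)

/-- The modulation of the phase. -/
def q (t : ℝ) : ℝ →ᵇ ℝ := U.G0 t + (U.σ t / N) • (1 : ℝ →ᵇ ℝ)

/-- The forward-modulated perturbation. -/
def v (t : ℝ) : ℝ →ᵇ ℂ := U.p t - shiftComp φ.f0 (U.q N t)

/-- The derivative of the forward-modulated perturbation. -/
def w (t : ℝ) : ℝ →ᵇ ℂ := U.p1 t - shiftDeriv φ.f1 (U.q N t) (U.G1 t)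

/-- The second derivative of the forward-modulated perturbation. -/
def V2 (t : ℝ) : L2 L ℂ :=
  U.P2 t - bc L (shiftDeriv2 φ.f1 φ.f2 (U.q N t) (U.G1 t) (U.G2 t))

/-- The time derivative of the modulated wave. -/
def m (t : ℝ) : L2 L ℂ :=
  bc L (shiftComp φ.f1 (U.q N t) * toComplex (U.Γ0 t + (U.σt t / N) • (1 : ℝ →ᵇ ℝ)))

/-- The squared `H²`-norm of the forward-modulated perturbation. -/
def normSq (t : ℝ) : ℝ := ‖bc L (U.v φ N t)‖ ^ 2 + ‖bc L (U.w φ N t)‖ ^ 2 + ‖U.V2 φ N t‖ ^ 2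

variable {N} (hT : 0 < T) (hTL : T ≤ L) (hLN : L = N * T)
include hT hTL

theorem isH1_q {t : ℝ} (ht : t ∈ timeInterval τ) : IsH1 L (U.q N t) (bc L (U.G1 t)) := by
  have h1 : IsH1 L (1 : ℝ →ᵇ ℝ) 0 := by
    refine ⟨fun x => rfl, fun x hx => ?_⟩
    rw [integral_congr_L2 (Lp.coeFn_zero ℝ 2 (volume.restrict (Ioc 0 L))) hx]
    simp
  have := (U.hG0 t ht).add (hT.le.trans hTL) (h1.smul (hT.le.trans hTL) (U.σ t / N))
  rwa [smul_zero, add_zero] at this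

theorem continuousOn_q : ContinuousOn (U.q N) (timeInterval τ) :=
  (IsH1.continuousOn hT hTL U.hG0 U.cG0 U.cG1).add
    ((ContinuousOn.div_const (fun t ht => (U.dσ t ht).continuousWithinAt) _).smul
      continuousOn_const)

theorem hasDerivWithinAt_q {t : ℝ} (ht : t ∈ timeInterval τ) :
    HasDerivWithinAt (U.q N) (U.Γ0 t + (U.σt t / N) • (1 : ℝ →ᵇ ℝ)) (timeInterval τ) t :=
  (IsH1.hasDerivWithinAt hT hTL ht U.hG0 (U.hΓ0 t ht) (U.dG0 t ht) (U.dG1 t ht)).add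
    (((U.dσ t ht).div_const (N : ℝ)).smul_const (1 : ℝ →ᵇ ℝ))

theorem continuousOn_w : ContinuousOn (U.w φ N) (timeInterval τ) := by
  have h1 := (continuous_shiftComp φ.h1).comp_continuousOn (U.continuousOn_q hT hTL (N := N))
  have h2 := toComplex.continuous.comp_continuousOn
    (IsH1.continuousOn hT hTL U.hG1 U.cG1 U.cG2)
  exact (IsH1.continuousOn hT hTL U.hp1 U.cp1 U.cP2).sub (h1.mul (continuousOn_const.add h2))

theorem continuousOn_V2 : ContinuousOn (U.V2 φ N) (timeInterval τ) := by
  have h1 := (continuous_shiftComp φ.h1).comp_continuousOn (U.continuousOn_q hT hTL (N := N))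
  have h2 := (continuous_shiftComp φ.h2).comp_continuousOn (U.continuousOn_q hT hTL (N := N))
  have h3 := continuousOn_const (c := (1 : ℝ →ᵇ ℂ)) |>.add (toComplex.continuous.comp_continuousOn
    (IsH1.continuousOn hT hTL U.hG1 U.cG1 U.cG2))
  have h4 := toComplex.continuous.comp_continuousOn
    (IsH1.continuousOn hT hTL U.hG2 U.cG2 U.cG3)
  exact U.cP2.sub ((bc L).continuous.comp_continuousOn (((h2.mul h3).mul h3).add (h1.mul h4)))

theorem hasDerivWithinAt_v {t : ℝ} (ht : t ∈ timeInterval τ) :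
    HasDerivWithinAt (fun t => bc L (U.v φ N t)) (U.X t - U.m φ N t) (timeInterval τ) t := by
  have h1 := (hasFDerivAt_shiftComp φ.h0 φ.h1 (U.q N t)).comp_hasDerivWithinAt t
    (U.hasDerivWithinAt_q hT hTL ht)
  have h2 := ((bc L).restrictScalars ℝ).hasFDerivAt.comp_hasDerivWithinAt t h1
  have h3 := (U.dp t ht).sub h2
  refine (h3.congr_of_eventuallyEq ?_ ?_).congr_deriv rfl
  · exact Eventually.of_forall fun s => map_sub (bc L) _ _
  · exact map_sub (bc L) _ _

include hLN

theorem isH1_v {t : ℝ} (ht : t ∈ timeInterval τ) : IsH1 L (U.v φ N t) (bc L (U.w φ N t)) := by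
  have := (U.hp t ht).sub (hT.le.trans hTL) (isH1_shiftComp φ.h0
    (by rw [hLN]; exact φ.per0.nat_mul N) (U.isH1_q hT hTL ht (N := N)))
  rwa [← map_sub] at this

theorem isH1_w {t : ℝ} (ht : t ∈ timeInterval τ) : IsH1 L (U.w φ N t) (U.V2 φ N t) :=
  (U.hp1 t ht).sub (hT.le.trans hTL) (isH1_shiftDeriv φ.h1
    (by rw [hLN]; exact φ.per1.nat_mul N) (U.isH1_q hT hTL ht (N := N)) (U.hG1 t ht))

/-- Only the right derivative is obtained, because the evolution of ‖ψ_t‖² rests on forward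
difference quotients. -/
theorem hasDerivWithinAt_energy {t : ℝ} (ht : t ∈ timeInterval τ) :
    HasDerivWithinAt (fun t => energy L β (U.p t) (U.w φ N t) (U.X t))
      (energyDeriv L β (U.p t) (U.p1 t) (U.w φ N t) (U.V2 φ N t) (U.X t) (U.m φ N t)) (Ioi t) t := by
  have hL : 0 ≤ L := hT.le.trans hTL
  have cp := IsH1.continuousOn hT hTL U.hp U.cp U.cp1
  have h1 := hasDerivWithinAt_norm_sq_timeDeriv hL cp U.cX U.hp U.hp1 U.dp U.eq ht
  have h2 := hasDerivWithinAt_inner_bmul_sq hL cp (U.continuousOn_w φ hT hTL (N := N))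
    (U.continuousOn_V2 φ hT hTL) U.hp (fun t ht => U.isH1_v φ hT hTL hLN ht)
    (fun t ht => U.isH1_w φ hT hTL hLN ht) ht (U.dp t ht) (U.hasDerivWithinAt_v φ hT hTL ht)
  exact h1.sub ((h2.mono_of_mem_nhdsWithin (mem_nhdsGT_timeInterval ht)).const_mul β)

end ModulatedSolution

end

/-! ### Bounds uniform in N and the damping estimate for modulated solutions -/

section

namespace ModulatedSolution

variable {α β F T L : ℝ} {τ : EReal} (U : ModulatedSolution α β F L τ) (φ : Wave α β F T) (N : ℕ)

/-- The smallness assumption at time `s`. -/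
def Small (s : ℝ) : Prop :=
  ‖bc L (U.v φ N s)‖ ≤ 1 ∧ ‖bc L (U.w φ N s)‖ ≤ 1 ∧ ‖U.V2 φ N s‖ ≤ 1 ∧ ‖bc L (U.G1 s)‖ ≤ 1
    ∧ ‖bc L (U.G2 s)‖ ≤ 1

variable {N} (hT : 0 < T) (hTL : T ≤ L) (hLN : L = N * T)
include hT hTL

theorem norm_G1_le {s : ℝ} (hs : s ∈ timeInterval τ) (h : U.Small φ N s) :
    ‖U.G1 s‖ ≤ (√T)⁻¹ + √T := by
  refine ((U.hG1 s hs).norm_le hT hTL).trans ?_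
  obtain ⟨-, -, -, h4, h5⟩ := h
  nlinarith [Real.sqrt_pos.2 hT, inv_pos.2 (Real.sqrt_pos.2 hT)]

theorem norm_remainder_le {M : ℝ} {s : ℝ} (hs : s ∈ timeInterval τ) (h : U.Small φ N s)
    (hp : ‖U.p s‖ ≤ M) (hM : ‖φ.f0‖ ≤ M) :
    ‖U.X s + β • (Complex.I • U.V2 φ N s)‖ ≤ (1 + |α| + 3 * M ^ 2) * ‖bc L (U.v φ N s)‖
      + |β| * (‖φ.f2‖ * (2 + ((√T)⁻¹ + √T))) * ‖bc L (U.G1 s)‖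
      + |β| * ‖φ.f1‖ * ‖bc L (U.G2 s)‖ := by
  have hX : IsEq L α β (bc L (BoundedContinuousFunction.const ℝ (F : ℂ))) (U.p s) (U.V2 φ N s
      + bc L (shiftDeriv2 φ.f1 φ.f2 (U.q N s) (U.G1 s) (U.G2 s))) (U.X s) := by
    rw [V2, sub_add_cancel]
    exact U.eq s hs
  refine (LLE.norm_remainder_le hX (φ.isEq L (U.q N s)) hp
    ((norm_shiftComp_le _ _).trans hM)).trans ?_
  have h1 := norm_bc_shiftDeriv2_sub_le (hT.le.trans hTL) φ.f1 φ.f2 (U.q N s) (U.G1 s) (U.G2 s)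
  have h2 : ‖φ.f2‖ * (2 + ‖U.G1 s‖) * ‖bc L (U.G1 s)‖
      ≤ ‖φ.f2‖ * (2 + ((√T)⁻¹ + √T)) * ‖bc L (U.G1 s)‖ := by
    gcongr
    exact U.norm_G1_le φ hT hTL hs h
  have h3 := mul_le_mul_of_nonneg_left (h1.trans (add_le_add h2 le_rfl)) (abs_nonneg β)
  rw [v]
  linarith

include hLN

/-- Sobolev bounds v, v_x and γ_x in the supremum norm by (√T)⁻¹ + √T; adding back the modulated
wave and its derivative gives a bound on ψ and ψ_x that does not involve N. -/
theorem norm_sup_le {s : ℝ} (hs : s ∈ timeInterval τ) (h : U.Small φ N s) :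
    ‖U.p s‖ ≤ (√T)⁻¹ + √T + ‖φ.f0‖ + ‖φ.f1‖ * (1 + ((√T)⁻¹ + √T)) ∧
      ‖U.p1 s‖ ≤ (√T)⁻¹ + √T + ‖φ.f0‖ + ‖φ.f1‖ * (1 + ((√T)⁻¹ + √T)) ∧
      ‖U.w φ N s‖ ≤ (√T)⁻¹ + √T + ‖φ.f0‖ + ‖φ.f1‖ * (1 + ((√T)⁻¹ + √T)) := by
  have hG1 := U.norm_G1_le φ hT hTL hs h
  obtain ⟨h1, h2, h3, -, -⟩ := h
  have hT1 := inv_pos.2 (Real.sqrt_pos.2 hT)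
  have hT2 := Real.sqrt_pos.2 hT
  have hv : ‖U.v φ N s‖ ≤ (√T)⁻¹ + √T := by
    refine ((U.isH1_v φ hT hTL hLN hs).norm_le hT hTL).trans ?_
    nlinarith
  have hw : ‖U.w φ N s‖ ≤ (√T)⁻¹ + √T := by
    refine ((U.isH1_w φ hT hTL hLN hs).norm_le hT hTL).trans ?_
    nlinarith
  have hs1 : ‖shiftDeriv φ.f1 (U.q N s) (U.G1 s)‖ ≤ ‖φ.f1‖ * (1 + ((√T)⁻¹ + √T)) :=
    (norm_shiftDeriv_le _ _ _).trans (by gcongr)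
  have hs0 := norm_shiftComp_le φ.f0 (U.q N s)
  have n0 := norm_nonneg φ.f0
  have n1 : 0 ≤ ‖φ.f1‖ * (1 + ((√T)⁻¹ + √T)) := by positivity
  refine ⟨?_, ?_, by linarith⟩
  · have e : U.p s = U.v φ N s + shiftComp φ.f0 (U.q N s) := (sub_add_cancel _ _).symm
    rw [e]
    exact (norm_add_le _ _).trans (by linarith)
  · have e : U.p1 s = U.w φ N s + shiftDeriv φ.f1 (U.q N s) (U.G1 s) := (sub_add_cancel _ _).symm
    rw [e]
    exact (norm_add_le _ _).trans (by linarith)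

theorem norm_m_le (hN : 1 ≤ N) (s : ℝ) :
    ‖U.m φ N s‖ ≤ ‖φ.f1‖ * (‖bc L (U.Γ0 s)‖ + √T * |U.σt s|) := by
  refine (norm_bc_shiftComp_mul_le (hT.le.trans hTL) _ _ _ _).trans ?_
  refine mul_le_mul_of_nonneg_left (add_le_add_right ?_ _) (norm_nonneg _)
  have hN0 : (1 : ℝ) ≤ N := by exact_mod_cast hN
  -- The constant function σ_t/N has L²(0, NT)-norm √(NT)/N · |σ_t| ≤ √T |σ_t|: the normalization of
  -- σ by 1/N beats the growth of the period.
  have hN1 : √(N : ℝ) ≤ N := Real.sqrt_le_iff.2 ⟨by linarith, by nlinarith⟩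
  have hL : √L = √(N : ℝ) * √T := by rw [hLN, Real.sqrt_mul (by linarith)]
  rw [hL, abs_div, abs_of_pos (by linarith : (0 : ℝ) < N),
    mul_div_assoc', div_le_iff₀ (by linarith)]
  have : 0 ≤ √T * |U.σt s| := by positivity
  nlinarith

end ModulatedSolution

theorem sq_le_of_le_add_add {a b c x y z r : ℝ} (hr : 0 ≤ r) (h : r ≤ a * x + b * y + c * z) :
    r ^ 2 ≤ 3 * (a ^ 2 + b ^ 2 + c ^ 2) * (x ^ 2 + y ^ 2 + z ^ 2) := by
  have h1 : r ^ 2 ≤ (a * x + b * y + c * z) ^ 2 := by gcongr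
  have h2 : (a * x + b * y + c * z) ^ 2 ≤ (a ^ 2 + b ^ 2 + c ^ 2) * (x ^ 2 + y ^ 2 + z ^ 2) := by
    nlinarith [sq_nonneg (a * y - b * x), sq_nonneg (a * z - c * x), sq_nonneg (b * z - c * y)]
  have h3 : 0 ≤ (a ^ 2 + b ^ 2 + c ^ 2) * (x ^ 2 + y ^ 2 + z ^ 2) := by positivity
  linarith

theorem energy_bounds_of_le {R S a b c d e x y r m : ℝ} (hR : 0 ≤ R) (hS : 0 ≤ S) (ha : 0 ≤ a)
    (hb : 0 ≤ b) (hc : 0 ≤ c) (hd : 0 ≤ d) (he : 0 ≤ e) (hx : 0 ≤ x) (hy : 0 ≤ y)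
    (hr : r ≤ R * (a + d + e)) (hm : m ≤ S * (x + y)) :
    a + r + m ≤ (1 + R + S) * (a + d + e + x + y) ∧ a + r ≤ (1 + R + S) * (a + d + e) ∧
      b + c + r ≤ (1 + R + S) * (a + b + c + d + e) := by
  have p1 := mul_nonneg hR (add_nonneg hx hy)
  have p2 := mul_nonneg hS (add_nonneg ha (add_nonneg hd he))
  have p3 := mul_nonneg hS (add_nonneg hb hc)
  have p4 := mul_nonneg hR (add_nonneg hb hc)
  exact ⟨by linarith, by linarith, by linarith⟩

/-- Bounds for the energy of a modulated solution in terms of the perturbation, the modulation and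
its time derivative. -/
theorem exists_modulated_energy_bounds {α β F T : ℝ} (hβ : β ≠ 0) (hT : 0 < T)
    (φ : Wave α β F T) : ∃ K > 0, ∀ {N : ℕ}, 1 ≤ N → ∀ {L : ℝ}, L = N * T → ∀ {τ : EReal}
    (U : ModulatedSolution α β F L τ) {s : ℝ}, s ∈ timeInterval τ → U.Small φ N s →
      energyDeriv L β (U.p s) (U.p1 s) (U.w φ N s) (U.V2 φ N s) (U.X s) (U.m φ N s)
          + energy L β (U.p s) (U.w φ N s) (U.X s)
        ≤ K * (‖bc L (U.v φ N s)‖ ^ 2 + ‖bc L (U.G1 s)‖ ^ 2 + ‖bc L (U.G2 s)‖ ^ 2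
          + ‖bc L (U.Γ0 s)‖ ^ 2 + |U.σt s| ^ 2) ∧
      U.normSq φ N s ≤ 6 / |β| ^ 2 * (energy L β (U.p s) (U.w φ N s) (U.X s)
        + K * (‖bc L (U.v φ N s)‖ ^ 2 + ‖bc L (U.G1 s)‖ ^ 2 + ‖bc L (U.G2 s)‖ ^ 2)) ∧
      energy L β (U.p s) (U.w φ N s) (U.X s)
        ≤ K * (U.normSq φ N s + ‖bc L (U.G1 s)‖ ^ 2 + ‖bc L (U.G2 s)‖ ^ 2) := by
  set M := (√T)⁻¹ + √T + ‖φ.f0‖ + ‖φ.f1‖ * (1 + ((√T)⁻¹ + √T))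
  obtain ⟨K, hK, hE⟩ := exists_energy_bounds hβ M
  set R := 3 * ((1 + |α| + 3 * M ^ 2) ^ 2 + (|β| * (‖φ.f2‖ * (2 + ((√T)⁻¹ + √T)))) ^ 2
    + (|β| * ‖φ.f1‖) ^ 2) with hR
  -- The term 0 ^ 2 pads the two-term bound on the time derivative of the modulated wave to the
  -- three-term form of `sq_le_of_le_add_add`.
  set S := 3 * (‖φ.f1‖ ^ 2 + (‖φ.f1‖ * √T) ^ 2 + 0 ^ 2) with hS
  have hR0 : 0 ≤ R := by positivity
  have hS0 : 0 ≤ S := by positivity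
  refine ⟨K * (1 + R + S), by positivity, ?_⟩
  intro N hN L hL τ U s hs hsm
  have hN0 : (1 : ℝ) ≤ N := by exact_mod_cast hN
  have hTL : T ≤ L := by rw [hL]; nlinarith
  obtain ⟨b1, b2, b3⟩ := U.norm_sup_le φ hT hTL hL hs hsm
  obtain ⟨e1, e2, e3⟩ := hE (m := U.m φ N s) (hT.le.trans hTL) b1 b2 b3
    (U.isH1_v φ hT hTL hL hs) (U.isH1_w φ hT hTL hL hs)
  have hM : ‖φ.f0‖ ≤ M := by
    have : 0 ≤ (√T)⁻¹ + √T := by positivity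
    have : 0 ≤ ‖φ.f1‖ * (1 + ((√T)⁻¹ + √T)) := by positivity
    simp only [M]
    linarith
  have hr := sq_le_of_le_add_add (norm_nonneg _) (U.norm_remainder_le φ hT hTL hs hsm b1 hM)
  have hm := sq_le_of_le_add_add (a := ‖φ.f1‖) (b := ‖φ.f1‖ * √T) (c := 0) (z := 0)
    (x := ‖bc L (U.Γ0 s)‖) (y := |U.σt s|) (norm_nonneg _)
    ((U.norm_m_le φ hT hTL hL hN s).trans_eq (by ring))
  rw [← hR] at hr
  rw [← hS] at hm
  rw [ModulatedSolution.normSq]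
  obtain ⟨k1, k2, k3⟩ := energy_bounds_of_le hR0 hS0 (sq_nonneg ‖bc L (U.v φ N s)‖)
    (sq_nonneg ‖bc L (U.w φ N s)‖) (sq_nonneg ‖U.V2 φ N s‖) (sq_nonneg ‖bc L (U.G1 s)‖)
    (sq_nonneg ‖bc L (U.G2 s)‖) (sq_nonneg ‖bc L (U.Γ0 s)‖) (sq_nonneg |U.σt s|) hr
    (hm.trans_eq (by ring))
  simp only [mul_assoc K]
  exact ⟨e1.trans (mul_le_mul_of_nonneg_left k1 hK.le),
    e2.trans (mul_le_mul_of_nonneg_left (add_le_add_right (mul_le_mul_of_nonneg_left k2 hK.le) _)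
      (by positivity)),
    e3.trans (mul_le_mul_of_nonneg_left k3 hK.le)⟩

/-- The nonlinear damping estimate. -/
theorem exists_damping_bound {α β F T : ℝ} (hβ : β ≠ 0) (hT : 0 < T) (φ : Wave α β F T) :
    ∃ C > 0, ∀ {N : ℕ}, 1 ≤ N → ∀ {L : ℝ}, L = N * T → ∀ {τ : EReal}
    (U : ModulatedSolution α β F L τ), bc L (U.G1 0) = 0 → bc L (U.G2 0) = 0 →
    ∀ {t : ℝ}, t ∈ timeInterval τ → (∀ s ∈ Icc 0 t, U.Small φ N s) →
    ∀ {D : ℝ → ℝ}, ContinuousOn D (Icc 0 t) →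
    (∀ s ∈ Icc 0 t, ‖bc L (U.v φ N s)‖ ^ 2 + (‖bc L (U.G1 s)‖ ^ 2 + ‖bc L (U.G2 s)‖ ^ 2)
      + (‖bc L (U.Γ0 s)‖ ^ 2 + ‖U.Γ1 s‖ ^ 2 + ‖U.Γ2 s‖ ^ 2) + |U.σt s| ^ 2 ≤ D s) →
    U.normSq φ N t ≤ C * Real.exp (-t) * U.normSq φ N 0 + C * ‖bc L (U.v φ N t)‖ ^ 2
      + C * ∫ s in (0 : ℝ)..t, Real.exp (-(t - s)) * D s := by
  obtain ⟨K, hK, hE⟩ := exists_modulated_energy_bounds hβ hT φ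
  have hb : 0 < |β| := abs_pos.2 hβ
  refine ⟨6 / |β| ^ 2 * (3 * K), by positivity, ?_⟩
  intro N hN L hL τ U hG1 hG2 t ht hsm D hDc hD
  have hN0 : (1 : ℝ) ≤ N := by exact_mod_cast hN
  have hTL : T ≤ L := by rw [hL]; nlinarith
  have hsub : Icc 0 t ⊆ timeInterval τ := fun s hs => mem_timeInterval_of_le ht hs.1 hs.2
  set E : ℝ → ℝ := fun s => energy L β (U.p s) (U.w φ N s) (U.X s) with hEdef
  -- J compensates the modulation terms in the coercivity bound at time t. It vanishes at time 0,
  -- and its derivative involves γ_t only through Γ1 and Γ2.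
  set J : ℝ → ℝ := fun s => ‖bc L (U.G1 s)‖ ^ 2 + ‖bc L (U.G2 s)‖ ^ 2 with hJ
  have cp := IsH1.continuousOn hT hTL U.hp U.cp U.cp1
  have cw := U.continuousOn_w φ hT hTL (N := N)
  have cbw := (bc L).continuous.comp_continuousOn cw
  have cE : ContinuousOn E (timeInterval τ) :=
    (U.cX.norm.pow 2).sub (continuousOn_const.mul (cbw.inner (𝕜 := ℝ)
      ((cp.mul cp).bmul ((conjL L).continuous.comp_continuousOn cbw))))
  have cJ : ContinuousOn J (timeInterval τ) := (U.cG1.norm.pow 2).add (U.cG2.norm.pow 2)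
  have hEd := fun s (hs : s ∈ timeInterval τ) => U.hasDerivWithinAt_energy φ hT hTL hL hs
  have hJd : ∀ s ∈ timeInterval τ, HasDerivWithinAt J
      (2 * ⟪bc L (U.G1 s), U.Γ1 s⟫_ℝ + 2 * ⟪bc L (U.G2 s), U.Γ2 s⟫_ℝ) (Ioi s) s := fun s hs =>
    (((U.dG1 s hs).mono_of_mem_nhdsWithin (mem_nhdsGT_timeInterval hs)).norm_sq).add
      (((U.dG2 s hs).mono_of_mem_nhdsWithin (mem_nhdsGT_timeInterval hs)).norm_sq)
  -- The constant 3K: ‖γ_x‖² and ‖γ_xx‖² occur three times with weight K, in the energy inequality,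
  -- in K J and, after Young's inequality, in K J'.
  have hgr := le_exp_mul_add_integral (f := fun s => E s + K * J s) (K := 3 * K) ht.1
    ((cE.add (continuousOn_const.mul cJ)).mono hsub)
    (fun s hs => (hEd s (hsub (Ioo_subset_Icc_self hs))).add
      ((hJd s (hsub (Ioo_subset_Icc_self hs))).const_mul K)) hDc (fun s hs => by
        have hs' := Ioo_subset_Icc_self hs
        have h1 := (hE hN hL U (hsub hs') (hsm s hs')).1
        have h2 := mul_le_mul_of_nonneg_left (hD s hs') hK.le
        have h3 : ∀ a b : L2 L ℝ, 2 * ⟪a, b⟫_ℝ ≤ ‖a‖ ^ 2 + ‖b‖ ^ 2 := fun a b => by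
          have := real_inner_le_norm a b
          nlinarith [sq_nonneg (‖a‖ - ‖b‖)]
        have h4 := mul_le_mul_of_nonneg_left (h3 (bc L (U.G1 s)) (U.Γ1 s)) hK.le
        have h5 := mul_le_mul_of_nonneg_left (h3 (bc L (U.G2 s)) (U.Γ2 s)) hK.le
        have n : ∀ x : ℝ, 0 ≤ K * x ^ 2 := fun x => mul_nonneg hK.le (sq_nonneg x)
        simp only [hEdef, hJ]
        linarith [n ‖bc L (U.v φ N s)‖, n ‖bc L (U.G1 s)‖, n ‖bc L (U.G2 s)‖, n ‖bc L (U.Γ0 s)‖,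
          n ‖U.Γ1 s‖, n ‖U.Γ2 s‖, n |U.σt s|])
  have h0 : (0 : ℝ) ∈ Icc 0 t := ⟨le_rfl, ht.1⟩
  have hin := (hE hN hL U (hsub h0) (hsm 0 h0)).2.2
  have hJ0 : J 0 = 0 := by simp [hJ, hG1, hG2]
  simp only [hJ0, mul_zero, add_zero] at hgr
  simp only [hG1, hG2, norm_zero, ne_eq, OfNat.ofNat_ne_zero, not_false_eq_true, zero_pow,
    add_zero] at hin
  have hexp := mul_le_mul_of_nonneg_left hin (Real.exp_pos (-t)).le
  have n0 : 0 ≤ U.normSq φ N 0 := by rw [ModulatedSolution.normSq]; positivity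
  have n1 : 0 ≤ K * (Real.exp (-t) * U.normSq φ N 0) := by positivity
  have n2 : 0 ≤ K * ‖bc L (U.v φ N t)‖ ^ 2 := by positivity
  set Q := ∫ s in (0 : ℝ)..t, Real.exp (-(t - s)) * D s
  have hmain : E t + K * (‖bc L (U.v φ N t)‖ ^ 2 + ‖bc L (U.G1 t)‖ ^ 2 + ‖bc L (U.G2 t)‖ ^ 2)
      ≤ 3 * K * (Real.exp (-t) * U.normSq φ N 0 + ‖bc L (U.v φ N t)‖ ^ 2 + Q) := by
    simp only [hJ] at hgr
    simp only [hEdef] at hgr ⊢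
    linarith
  calc U.normSq φ N t ≤ _ := (hE hN hL U ht (hsm t ⟨ht.1, le_rfl⟩)).2.1
    _ ≤ _ := mul_le_mul_of_nonneg_left hmain (by positivity)
    _ = _ := by ring

end

section

/-! ### Passing from periodic Sobolev functions to their continuous representatives -/

theorem IsStationaryWave.exists_wave {α β F T : ℝ} (hT : 0 < T) {φ : ℝ → ℂ}
    (h : IsStationaryWave α β F T φ) : ∃ f : Wave α β F T, ⇑f.f0 = φ := by
  obtain ⟨hs, hp, he⟩ := h
  have hd : ∀ {f : ℝ → ℂ}, ContDiff ℝ ∞ f → Function.Periodic f T →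
      ContDiff ℝ ∞ (deriv f) ∧ Function.Periodic (deriv f) T ∧
        ∀ x, HasDerivAt f (deriv f x) x := fun {f} hf hfp =>
    ⟨(contDiff_infty_iff_deriv.1 hf).2, fun x => by
      rw [← deriv_comp_add_const, show (fun x => f (x + T)) = f from funext hfp],
      fun x => (contDiff_infty_iff_deriv.1 hf).1.differentiableAt.hasDerivAt⟩
  obtain ⟨s1, p1, d0⟩ := hd hs hp
  obtain ⟨s2, p2, d1⟩ := hd s1 p1
  obtain ⟨s3, p3, d2⟩ := hd s2 p2
  obtain ⟨f0, h0⟩ := exists_coe_eq hT hs.continuous hp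
  obtain ⟨f1, h1⟩ := exists_coe_eq hT s1.continuous p1
  obtain ⟨f2, h2⟩ := exists_coe_eq hT s2.continuous p2
  obtain ⟨f3, h3⟩ := exists_coe_eq hT s3.continuous p3
  rw [← h3] at d2
  rw [← h2] at d1 d2 he
  rw [← h1] at d0 d1 p1
  rw [← h0] at d0 hp he
  exact ⟨⟨f0, f1, f2, f3, d0, d1, d2, hp, p1, he⟩, h0⟩

section

variable {𝕜 : Type*} [RCLike 𝕜] {L : ℝ}

theorem ae_eq_of_bc_eq {f : ℝ → 𝕜} {c : ℝ →ᵇ 𝕜} (hf : MemLp f 2 (volume.restrict (Ioc 0 L)))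
    (h : bc L c = toH L f) : f =ᵐ[volume.restrict (Ioc 0 L)] c :=
  ((toH_eq_iff hf).1 h.symm).trans (coeFn_bc c)

theorem exists_isH1_family (hL : 0 < L) {m : ℕ} {I : Set ℝ} {u : ℝ → ℝ → 𝕜}
    (h : ∀ t ∈ I, MemH L (m + 1) (u t)) : ∃ c : ℝ → ℝ →ᵇ 𝕜, ∀ t ∈ I,
      bc L (c t) = toH L (u t) ∧ IsH1 L (c t) (toH L (weakDeriv L (u t))) := by
  choose! c hc using fun t ht => (h t ht).exists_isH1 hL
  exact ⟨c, hc⟩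

theorem normSqH_zero_eq (hL : 0 < L) {c : ℝ →ᵇ 𝕜} {f : ℝ → 𝕜}
    (hf : f =ᵐ[volume.restrict (Ioc 0 L)] c) : normSqH L 0 f = ‖bc L c‖ ^ 2 := by
  rw [norm_sq_bc hL.le, normSqH, zero_add, Finset.sum_range_one]
  exact integral_congr_L2 (by filter_upwards [hf] with x hx; simp [hx]) ⟨hL.le, le_rfl⟩

theorem normSqH_two_eq (hL : 0 < L) {c c1 : ℝ →ᵇ 𝕜} {d : L2 L 𝕜} (h : IsH1 L c (bc L c1))
    (h1 : IsH1 L c1 d) {f : ℝ → 𝕜} (hf : f =ᵐ[volume.restrict (Ioc 0 L)] c) :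
    normSqH L 2 f = ‖bc L c‖ ^ 2 + ‖bc L c1‖ ^ 2 + ‖d‖ ^ 2 := by
  obtain ⟨m1, e1⟩ := h.toH_weakDeriv hL hf
  obtain ⟨m2, e2⟩ := h1.toH_weakDeriv hL (ae_eq_of_bc_eq m1.2 e1.symm)
  have h0 := normSqH_zero_eq hL hf
  rw [normSqH, zero_add, Finset.sum_range_one] at h0
  rw [normSqH, Finset.sum_range_succ, Finset.sum_range_succ, Finset.sum_range_one, h0, ← e2, ← e1,
    ← integral_norm_sq_eq hL m1, ← integral_norm_sq_eq hL m2]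
  rfl

theorem ContH.continuousOn_normH_sq (hL : 0 < L) {m : ℕ} {I : Set ℝ} {u : ℝ → ℝ → 𝕜}
    (h : ContH L m I u) : ContinuousOn (fun t => normH L m (u t) ^ 2) I := by
  refine ContinuousOn.congr (f := fun t => ∑ k ∈ Finset.range (m + 1),
    ‖toH L ((weakDeriv L)^[k] (u t))‖ ^ 2) (continuousOn_finsetSum _ fun k hk => ?_) fun t ht => ?_
  · exact (h.continuousOn hL (Nat.le_of_lt_succ (Finset.mem_range.1 hk))).norm.pow 2
  · simp only [normH_sq hL, (h.1 t ht).normSqH_eq hL]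

theorem ContH.continuousOn_normH_weakDeriv_sq (hL : 0 < L) {m : ℕ} {I : Set ℝ} {u : ℝ → ℝ → 𝕜}
    (h : ContH L (m + 1) I u) : ContinuousOn (fun t => normH L m (weakDeriv L (u t)) ^ 2) I := by
  refine ContinuousOn.congr (f := fun t => ∑ k ∈ Finset.range (m + 1),
    ‖toH L ((weakDeriv L)^[k + 1] (u t))‖ ^ 2) (continuousOn_finsetSum _ fun k hk => ?_)
    fun t ht => ?_
  · exact (h.continuousOn hL (Nat.succ_le_of_lt (Finset.mem_range.1 hk))).norm.pow 2
  · simp only [normH_sq hL, ((h.1 t ht).weakDeriv hL).2.normSqH_eq hL, Function.iterate_succ_apply]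

theorem MemH.norm_sq_add_norm_sq_le (hL : 0 < L) {m : ℕ} (hm : 1 ≤ m) {f : ℝ → 𝕜}
    (h : MemH L m f) : ‖toH L f‖ ^ 2 + ‖toH L (LLE.weakDeriv L f)‖ ^ 2 ≤ normH L m f ^ 2 := by
  rw [normH_sq hL, h.normSqH_eq hL]
  refine le_trans (le_of_eq ?_) (Finset.sum_le_sum_of_subset_of_nonneg
    (Finset.range_subset_range.2 (show 2 ≤ m + 1 by omega)) fun _ _ _ => by positivity)
  rw [Finset.sum_range_succ, Finset.sum_range_one]
  rfl

end

theorem ContH.mono {E : Type*} [NormedAddCommGroup E] [NormedSpace ℝ E] {L : ℝ} {m : ℕ}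
    {I J : Set ℝ} {u : ℝ → ℝ → E} (h : ContH L m I u) (hJ : J ⊆ I) : ContH L m J u :=
  ⟨fun t ht => h.1 t (hJ ht), fun t ht => (h.2 t (hJ ht)).mono_left (nhdsWithin_mono t hJ)⟩

theorem IsC1H.mono {E : Type*} [NormedAddCommGroup E] [NormedSpace ℝ E] {L : ℝ} {m : ℕ}
    {I J : Set ℝ} {u u' : ℝ → ℝ → E} (h : IsC1H L m I u u') (hJ : J ⊆ I) : IsC1H L m J u u' :=
  ⟨h.1.mono hJ, h.2.1.mono hJ, fun t ht =>
    (h.2.2 t (hJ ht)).mono_left (nhdsWithin_mono t (sdiff_subset_sdiff_left hJ))⟩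

theorem IsClassicalSolution.mono {α β F L : ℝ} {τ τ' : EReal} {ψ : ℝ → ℝ → ℂ}
    (h : IsClassicalSolution α β F L τ ψ) (hτ : τ' ≤ τ) : IsClassicalSolution α β F L τ' ψ := by
  have hI : timeInterval τ' ⊆ timeInterval τ := fun t ht => ⟨ht.1, ht.2.trans_le hτ⟩
  obtain ⟨h1, ψt, h2, h3⟩ := h
  exact ⟨h1.mono hI, ψt, h2.mono hI, fun t ht => h3 t (hI ht)⟩

/-- Continuity of γ in H⁴ gives continuous representatives of γ, γ_x and γ_xx, hence continuity of
v_xx in time. Differentiability in H² is just enough to differentiate ‖γ_xx‖². -/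
theorem IsClassicalSolution.exists_modulatedSolution {α β F L : ℝ} (hL : 0 < L) {τ : EReal}
    {ψ : ℝ → ℝ → ℂ} (h : IsClassicalSolution α β F L τ ψ) {γ γt : ℝ → ℝ → ℝ}
    (hγ : ContH L 4 (timeInterval τ) γ) (hγt : IsC1H L 2 (timeInterval τ) γ γt) {σ σt : ℝ → ℝ}
    (hσ : IsC1Real (timeInterval τ) σ σt) :
    ∃ U : ModulatedSolution α β F L τ, U.σ = σ ∧ U.σt = σt ∧ ∀ t ∈ timeInterval τ,
      ψ t =ᵐ[volume.restrict (Ioc 0 L)] U.p t ∧ γ t =ᵐ[volume.restrict (Ioc 0 L)] U.G0 t ∧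
      bc L (U.G1 t) = toH L (weakDeriv L (γ t)) ∧
      bc L (U.G2 t) = toH L (weakDeriv L (weakDeriv L (γ t))) ∧
      bc L (U.Γ0 t) = toH L (γt t) ∧ U.Γ1 t = toH L (weakDeriv L (γt t)) ∧
      U.Γ2 t = toH L (weakDeriv L (weakDeriv L (γt t))) := by
  obtain ⟨hψ, ψt, hψt, heq⟩ := h
  obtain ⟨p, hp⟩ := exists_isH1_family hL hψ.1
  obtain ⟨p1, hp1⟩ := exists_isH1_family hL fun t ht => ((hψ.1 t ht).weakDeriv hL).2
  have hγ1 := fun t ht => ((hγ.1 t ht).weakDeriv hL).2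
  have hγ2 := fun t ht => ((hγ1 t ht).weakDeriv hL).2
  obtain ⟨G0, hG0⟩ := exists_isH1_family hL hγ.1
  obtain ⟨G1, hG1⟩ := exists_isH1_family hL hγ1
  obtain ⟨G2, hG2⟩ := exists_isH1_family hL hγ2
  obtain ⟨Γ0, hΓ0⟩ := exists_isH1_family hL hγt.2.1.1
  have ap : ∀ t ∈ timeInterval τ, ψ t =ᵐ[volume.restrict (Ioc 0 L)] p t := fun t ht =>
    ae_eq_of_bc_eq (hψ.1 t ht).memL2.2 (hp t ht).1
  refine ⟨{ p := p, p1 := p1, P2 := fun t => toH L (weakDeriv L (weakDeriv L (ψ t)))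
            X := fun t => toH L (ψt t), G0 := G0, G1 := G1, G2 := G2, Γ0 := Γ0
            G3 := fun t => toH L (weakDeriv L (weakDeriv L (weakDeriv L (γ t))))
            Γ1 := fun t => toH L (weakDeriv L (γt t))
            Γ2 := fun t => toH L (weakDeriv L (weakDeriv L (γt t)))
            σ := σ, σt := σt
            hp := fun t ht => (hp1 t ht).1 ▸ (hp t ht).2
            hp1 := fun t ht => (hp1 t ht).2
            hG0 := fun t ht => (hG1 t ht).1 ▸ (hG0 t ht).2
            hG1 := fun t ht => (hG2 t ht).1 ▸ (hG1 t ht).2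
            hG2 := fun t ht => (hG2 t ht).2
            hΓ0 := fun t ht => (hΓ0 t ht).2
            cp := (hψ.continuousOn hL (k := 0) (by norm_num)).congr fun t ht => (hp t ht).1
            cp1 := (hψ.continuousOn hL (k := 1) (by norm_num)).congr fun t ht => (hp1 t ht).1
            cP2 := hψ.continuousOn hL (k := 2) (by norm_num)
            cX := hψt.2.1.continuousOn hL (k := 0) (by norm_num)
            cG0 := (hγ.continuousOn hL (k := 0) (by norm_num)).congr fun t ht => (hG0 t ht).1
            cG1 := (hγ.continuousOn hL (k := 1) (by norm_num)).congr fun t ht => (hG1 t ht).1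
            cG2 := (hγ.continuousOn hL (k := 2) (by norm_num)).congr fun t ht => (hG2 t ht).1
            cG3 := hγ.continuousOn hL (k := 3) (by norm_num)
            dp := fun t ht => (hψt.hasDerivWithinAt hL (k := 0) (by norm_num) ht).congr
              (fun s hs => (hp s hs).1) (hp t ht).1
            dG0 := fun t ht => (hΓ0 t ht).1 ▸
              (hγt.hasDerivWithinAt hL (k := 0) (by norm_num) ht).congr
                (fun s hs => (hG0 s hs).1) (hG0 t ht).1
            dG1 := fun t ht => (hγt.hasDerivWithinAt hL (k := 1) (by norm_num) ht).congr
              (fun s hs => (hG1 s hs).1) (hG1 t ht).1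
            dG2 := fun t ht => (hγt.hasDerivWithinAt hL (k := 2) (by norm_num) ht).congr
              (fun s hs => (hG2 s hs).1) (hG2 t ht).1
            dσ := hσ.1
            eq := fun t ht => isEq_of_ae (hψt.2.1.1 t ht).memL2.2 (ap t ht)
              (coeFn_toH (((hψ.1 t ht).weakDeriv hL).2.weakDeriv hL).2.memL2.2).symm
              (ae_restrict_of_ae (heq t ht)) }, rfl, rfl, fun t ht => ⟨ap t ht,
      ae_eq_of_bc_eq (hγ.1 t ht).memL2.2 (hG0 t ht).1, (hG1 t ht).1, (hG2 t ht).1, (hΓ0 t ht).1,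
      rfl, rfl⟩⟩

theorem MemH.toH_iterate_eq_zero {𝕜 : Type*} [RCLike 𝕜] {L : ℝ} (hL : 0 < L) {m k : ℕ}
    (hk : k ≤ m) {f : ℝ → 𝕜} (h : MemH L m f) (hf : f =ᵐ[volume.restrict (Ioc 0 L)] 0) :
    toH L ((LLE.weakDeriv L)^[k] f) = 0 := by
  -- Linearity with both coefficients zero evaluates the chosen weak derivatives of the zero
  -- function.
  have h0 := (h.smul_add_smul hL 0 0 h).2 k hk
  simp only [zero_smul, add_zero] at h0
  rw [toH_iterate_congr hL hf, h0]

theorem forwardPert_ae_eq {α β F T L : ℝ} {τ : EReal} (f : Wave α β F T) (N : ℕ)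
    (U : ModulatedSolution α β F L τ) {ψ : ℝ → ℝ → ℂ} {γ : ℝ → ℝ → ℝ} {t : ℝ}
    (h1 : ψ t =ᵐ[volume.restrict (Ioc 0 L)] U.p t)
    (h2 : γ t =ᵐ[volume.restrict (Ioc 0 L)] U.G0 t) :
    forwardPert f.f0 N ψ γ U.σ t =ᵐ[volume.restrict (Ioc 0 L)] U.v f N t := by
  filter_upwards [h1, h2] with x h1 h2
  change ψ t x - f.f0 (x + γ t x + U.σ t / N) = U.p t x - f.f0 (x + (U.G0 t x + U.σ t / N * 1))
  rw [h1, h2, mul_one, add_assoc]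

end

end LLE

end

/-! ### The damping estimate in Sobolev norms -/

theorem proposition3p6 (α β F T : ℝ) (hβ : β ≠ 0) (hF : 0 < F) (hT : 0 < T)
    (φ : ℝ → ℂ) (hφ : LLE.IsStationaryWave α β F T φ) :
    ∃ R₁ > (0 : ℝ), ∃ C > (0 : ℝ), ∀ N : ℕ, 1 ≤ N →
      -- the initial perturbation and the perturbed solution
      ∀ v₀ : ℝ → ℂ, LLE.MemH (N * T) 2 v₀ →
      ∀ (Tmax : EReal) (ψ : ℝ → ℝ → ℂ), LLE.IsClassicalSolution α β F (N * T) Tmax ψ →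
        (∀ᵐ x, ψ 0 x = φ x + v₀ x) →
      -- the phase modulations and their time derivatives
      ∀ τmax : EReal, 0 < τmax → τmax ≤ Tmax →
      ∀ γ γt : ℝ → ℝ → ℝ, LLE.ContH (N * T) 4 (LLE.timeInterval τmax) γ →
        LLE.IsC1H (N * T) 2 (LLE.timeInterval τmax) γ γt → (∀ᵐ x, γ 0 x = 0) →
      ∀ σ σt : ℝ → ℝ, LLE.IsC1Real (LLE.timeInterval τmax) σ σt → σ 0 = 0 →
      ∀ t ∈ LLE.timeInterval τmax,
        (∀ s ∈ Set.Icc 0 t,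
          LLE.normH (N * T) 2 (LLE.forwardPert φ N ψ γ σ s)
            + LLE.normH (N * T) 3 (LLE.weakDeriv (N * T) (γ s))
            + LLE.normH (N * T) 2 (γt s) + |σt s| ≤ R₁) →
        LLE.normH (N * T) 2 (LLE.forwardPert φ N ψ γ σ t) ^ 2 ≤
          C * Real.exp (-t) * LLE.normH (N * T) 2 v₀ ^ 2
            + C * LLE.normH (N * T) 0 (LLE.forwardPert φ N ψ γ σ t) ^ 2
            + C * ∫ s in (0 : ℝ)..t, Real.exp (-(t - s)) *
                (LLE.normH (N * T) 0 (LLE.forwardPert φ N ψ γ σ s) ^ 2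
                  + LLE.normH (N * T) 3 (LLE.weakDeriv (N * T) (γ s)) ^ 2
                  + LLE.normH (N * T) 2 (γt s) ^ 2 + |σt s| ^ 2) := by
  obtain ⟨f, rfl⟩ := hφ.exists_wave hT
  obtain ⟨C, hC, hmain⟩ := LLE.exists_damping_bound hβ hT f
  -- R₁ = 1 suffices: the hypothesis serves only to give uniform supremum bounds, and no nonlinear
  -- term is absorbed by smallness.
  refine ⟨1, one_pos, C, hC, ?_⟩
  intro N hN v₀ hv₀ Tmax ψ hψ hψ0 τmax hτ0 hτ γ γt hγ hγt hγ0 σ σt hσ hσ0 t ht hsmall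
  have hN0 : (1 : ℝ) ≤ N := by exact_mod_cast hN
  set L : ℝ := N * T with hLdef
  have hTL : T ≤ L := by rw [hLdef]; nlinarith
  have hL : 0 < L := hT.trans_le hTL
  obtain ⟨U, rfl, rfl, hU⟩ := (hψ.mono hτ).exists_modulatedSolution hL hγ hγt hσ
  have hsub : Icc 0 t ⊆ LLE.timeInterval τmax := fun s hs =>
    LLE.mem_timeInterval_of_le ht hs.1 hs.2
  have hv := fun s hs => LLE.forwardPert_ae_eq f N U (hU s hs).1 (hU s hs).2.1
  have n0 : ∀ s ∈ LLE.timeInterval τmax, LLE.normH L 0 (LLE.forwardPert f.f0 N ψ γ U.σ s) ^ 2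
      = ‖LLE.bc L (U.v f N s)‖ ^ 2 := fun s hs => by
    rw [LLE.normH_sq hL, LLE.normSqH_zero_eq hL (hv s hs)]
  have n2 : ∀ s ∈ LLE.timeInterval τmax, LLE.normH L 2 (LLE.forwardPert f.f0 N ψ γ U.σ s) ^ 2
      = U.normSq f N s := fun s hs => by
    rw [LLE.normH_sq hL, LLE.normSqH_two_eq hL (U.isH1_v f hT hTL hLdef hs)
      (U.isH1_w f hT hTL hLdef hs) (hv s hs)]
    rfl
  have m1 := fun s hs => ((hγ.1 s hs).weakDeriv hL).2
  have hsm : ∀ s ∈ Icc 0 t, U.Small f N s := by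
    intro s hs
    have h := hsmall s hs
    have a1 : 0 ≤ LLE.normH L 2 (LLE.forwardPert f.f0 N ψ γ U.σ s) := Real.sqrt_nonneg _
    have a2 : 0 ≤ LLE.normH L 3 (LLE.weakDeriv L (γ s)) := Real.sqrt_nonneg _
    have a3 : 0 ≤ LLE.normH L 2 (γt s) := Real.sqrt_nonneg _
    have a4 := abs_nonneg (U.σt s)
    have h2 := n2 s (hsub hs)
    rw [LLE.ModulatedSolution.normSq] at h2
    have h3 := pow_le_one₀ (n := 2) a1 (by linarith)
    rw [h2] at h3
    obtain ⟨-, -, e1, e2, -⟩ := hU s (hsub hs)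
    refine ⟨?_, ?_, ?_, ?_, ?_⟩
    · exact (sq_le_one_iff₀ (norm_nonneg _)).1 (by nlinarith)
    · exact (sq_le_one_iff₀ (norm_nonneg _)).1 (by nlinarith)
    · exact (sq_le_one_iff₀ (norm_nonneg _)).1 (by nlinarith)
    · rw [e1]
      exact ((m1 s (hsub hs)).norm_toH_le hL (k := 0) (by norm_num)).trans (by linarith)
    · rw [e2]
      exact ((m1 s (hsub hs)).norm_toH_le hL (k := 1) (by norm_num)).trans (by linarith)
  have h00 : (0 : ℝ) ∈ LLE.timeInterval τmax := hsub ⟨le_rfl, ht.1⟩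
  have hγ0' := ae_restrict_of_ae (s := Ioc 0 L) hγ0
  have g1 : LLE.bc L (U.G1 0) = 0 := by
    rw [(hU 0 h00).2.2.1]
    exact (hγ.1 0 h00).toH_iterate_eq_zero hL (k := 1) (by norm_num) hγ0'
  have g2 : LLE.bc L (U.G2 0) = 0 := by
    rw [(hU 0 h00).2.2.2.1]
    exact (hγ.1 0 h00).toH_iterate_eq_zero hL (k := 2) (by norm_num) hγ0'
  have hinit : LLE.normH L 2 v₀ ^ 2 = U.normSq f N 0 := by
    -- As γ and σ vanish at time 0, the initial forward-modulated perturbation is v₀.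
    have e : v₀ =ᵐ[volume.restrict (Ioc 0 L)] U.v f N 0 := by
      filter_upwards [hv 0 h00, hγ0', ae_restrict_of_ae (s := Ioc 0 L) hψ0] with x h1 h2 h3
      rw [← h1, LLE.forwardPert, h2, h3, hσ0, zero_div, add_zero, add_zero, add_sub_cancel_left]
    rw [LLE.normH_sq hL, LLE.normSqH_two_eq hL (U.isH1_v f hT hTL hLdef h00)
      (U.isH1_w f hT hTL hLdef h00) e]
    rfl
  rw [n2 t ht, n0 t ht, hinit]
  refine hmain hN hLdef U g1 g2 ht hsm ?_ ?_
  · refine ContinuousOn.mono ?_ hsub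
    refine (((ContinuousOn.congr ?_ n0).add (hγ.continuousOn_normH_weakDeriv_sq hL)).add
      (hγt.2.1.continuousOn_normH_sq hL)).add (hσ.2.abs.pow 2)
    exact (ContinuousOn.norm fun s hs =>
      (U.hasDerivWithinAt_v f hT hTL hs).continuousWithinAt).pow 2
  · intro s hs
    obtain ⟨-, -, e1, e2, e3, e4, e5⟩ := hU s (hsub hs)
    -- Of the H³-norm of γ_x only the contributions of γ_x and γ_xx are needed.
    have b1 := (m1 s (hsub hs)).norm_sq_add_norm_sq_le hL (by norm_num)
    have b2 := LLE.normH_sq hL 2 (γt s)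
    rw [(hγt.2.1.1 s (hsub hs)).normSqH_eq hL, Finset.sum_range_succ, Finset.sum_range_succ,
      Finset.sum_range_one] at b2
    rw [n0 s (hsub hs), e1, e2, e3, e4, e5]
    exact add_le_add (add_le_add (add_le_add le_rfl b1) b2.symm.le) le_rfl
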